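/- **Notation.** Write $L^2=L^2(-1,1)$ and let $W^{1,2}_0=W^{1,2}_0(-1,1)$ be the closure of $C_c^\infty(-1,1)$ in $W^{1,2}(-1,1)$; a prime denotes the (weak) derivative. For $S\in L^2$ and $T,U\in W^{1,2}_0$ put $$c_1=\sqrt{\int_{-1}^1 e^{4U}(1-x^2)\,dx},\quad c_2=\int_{-1}^1 ST\,dx,\quad c_3=\frac1{\sqrt2}\int_{-1}^1 S\,dx,$$ $$M_1=\max\{0,4-c_3^4\},\qquad M_2=\max\Big\{0,\frac{\sqrt{M_1}-2|c_2|}{c_1}\Big\},$$ $$I[S,T,U]=\frac12\int_{-1}^1\Big[U'^2(1-x^2)-2xU'+(S^2+T'^2)e^{-2U}\Big]dx+\frac{M_2^2}{2}.$$ **Black holes.** An axisymmetric and stationary charged black hole with surrounding matter is given, near its event horizon $R=r_h>0$, by functions $\hat u>0$, $\hat\mu>0$, $\omega$, $A_\varphi$, $\Phi$ of $(R,\theta)$, smooth for $|R-r_h|<\delta$, with line element $$ds^2=\hat\mu\Big(\frac{dR^2}{R^2-r_h^2}+d\theta^2\Big)+\hat u\sin^2\theta\,(d\varphi-\omega\,dt)^2-\frac4{\hat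 u}(R^2-r_h^2)\,dt^2$$ and electromagnetic potential $(0,0,A_\varphi,A_t)$ in the coordinates $(R,\theta,\varphi,t)$, where $A_t=\Phi-\omega A_\varphi$. The electrovacuum Einstein–Maxwell equations with vanishing cosmological constant hold for $r_h<R<r_h+\delta$. On the horizon, $\omega=\omega_h$, $\Phi=\Phi_h$ and $2r_h/\sqrt{\hat\mu\hat u}=\kappa$ are constant; at both poles of the horizon $\hat\mu=\hat u=2r_h/\kappa$; and $A_\varphi=0$ on the axis. The angular momentum, charge and area of the horizon, all integrands being evaluated at $R=r_h$, are $$J=-\frac14\int_0^\pi\hat u\Big[\frac{\hat u}{4}\,\omega_{,R}\sin^2\theta-A_\varphi(\Phi_{,R}-A_\varphi\omega_{,R})\Big]\sin\theta\,d\theta,$$ $$Q=-\frac14\int_0^\pi\hat u\,(\Phi_{,R}-A_\varphi\omega_{,R})\sin\theta\,d\theta,\qquad A=2\pi\int_0^\pi\sqrt{\hat\mu\hat u}\,\sin\theta\,d\theta,$$ and $p_J=8\pi J/A$, $p_Q=4\pi Q^2/A$. **Sub-extremality.** Use coordinates $(v,R,\theta,\chi)$ that are regular at the horizon, given by $dt=dv-\frac{r_h}{\kappa(R^2-r_h^2)}dR$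 and $d\varphi=d\chi+\omega_h\,dt$. The black hole is *sub-extremal* if there are trapped surfaces in every sufficiently small interior vicinity of the horizon, to first order, in the following sense. There are smooth functions $\tau$ and $h>0$ on the sphere $S^2\ni(\theta,\chi)$ and constants $c,\varepsilon_0>0$ such that, for $0<\varepsilon<\varepsilon_0$, the outgoing null expansion of the closed surface $S_\varepsilon=\{v=\tau,\ R=r_h-\varepsilon h\}$ is at most $-c\,\varepsilon$. Here the outgoing null normal $l_\varepsilon$ of $S_\varepsilon$ is normalized by $dv(l_\varepsilon)=1$ and depends smoothly on $\varepsilon\in[0,\varepsilon_0)$, with $l_0=\partial_v$ the generator of the horizon; the expansion is the logarithmic rate of change of the area element of $S_\varepsilon$ under displacement along $l_\varepsilon$. **Lemma.** (i) For all $S\in L^2$ and $T,U\in W_0^{1,2}$ one has $I[S,T,U]\ge1$. (ii) If $I[S,T,U]\ge 1$ for all $S\in L^2$ and $T,U\in W_0^{1,2}$, then every sub-extremal axisymmetric and stationary charged black hole with surrounding matter satisfies $p_J^2+p_Q^2<1$. -/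

import Mathlib

open MeasureTheory Set Filter
open scoped ContDiff Topology ENNReal

noncomputable section

/-! ## Function spaces on the interval `(-1, 1)` -/

/-- Lebesgue measure on the open interval `(-1, 1)`. -/
def intervalMeasure : Measure ℝ := volume.restrict (Ioo (-1) 1)

/-- Smooth functions whose support is a compact subset of `(-1, 1)`. -/
def IsTestFunction (φ : ℝ → ℝ) : Prop :=
  ContDiff ℝ ∞ φ ∧ HasCompactSupport φ ∧ tsupport φ ⊆ Ioo (-1) 1

/-- `f'` is the weak derivative of `f` on `(-1, 1)`. -/
def IsWeakDeriv (f f' : ℝ → ℝ) : Prop :=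
  ∀ φ : ℝ → ℝ, IsTestFunction φ →
    ∫ x in (-1 : ℝ)..1, f x * deriv φ x = -∫ x in (-1 : ℝ)..1, f' x * φ x

/-- `f`, with weak derivative `f'`, belongs to the Sobolev space `W₀^{1,2}(-1, 1)`, the closure of
the test functions in the norm of `W^{1,2}(-1, 1)`. -/
structure MemW012 (f f' : ℝ → ℝ) : Prop where
  memLp : MemLp f 2 intervalMeasure
  memLp_deriv : MemLp f' 2 intervalMeasure
  weakDeriv : IsWeakDeriv f f'
  approx : ∃ φ : ℕ → ℝ → ℝ, (∀ n, IsTestFunction (φ n)) ∧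
    Tendsto (fun n => eLpNorm (fun x => φ n x - f x) 2 intervalMeasure) atTop (𝓝 0) ∧
    Tendsto (fun n => eLpNorm (fun x => deriv (φ n) x - f' x) 2 intervalMeasure) atTop (𝓝 0)

/-! ## The functional -/

/-- `c₁ = (∫ e^{4U} (1 - x²))^{1/2}` -/
def c1 (U : ℝ → ℝ) : ℝ := √(∫ x in (-1 : ℝ)..1, Real.exp (4 * U x) * (1 - x ^ 2))

/-- `c₂ = ∫ S T` -/
def c2 (S T : ℝ → ℝ) : ℝ := ∫ x in (-1 : ℝ)..1, S x * T x

/-- `c₃ = (∫ S) / √2` -/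
def c3 (S : ℝ → ℝ) : ℝ := 1 / √2 * ∫ x in (-1 : ℝ)..1, S x

def M1 (S : ℝ → ℝ) : ℝ := max 0 (4 - c3 S ^ 4)

def M2 (S T U : ℝ → ℝ) : ℝ := max 0 ((√(M1 S) - 2 * |c2 S T|) / c1 U)

/-- The functional `I[S, T, U]`; `T'` and `U'` are the weak derivatives of `T` and `U`. -/
def functionalI (S T T' U U' : ℝ → ℝ) : ℝ :=
  1 / 2 * (∫ x in (-1 : ℝ)..1,
      (U' x ^ 2 * (1 - x ^ 2) - 2 * x * U' x
        + (S x ^ 2 + T' x ^ 2) * Real.exp (-2 * U x)))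
    + M2 S T U ^ 2 / 2

/-! ## Stationary axisymmetric black holes in Einstein-Maxwell theory -/

/-- Partial derivative in the first variable (the radial coordinate `R`). -/
def dR (f : ℝ → ℝ → ℝ) (R θ : ℝ) : ℝ := deriv (fun r => f r θ) R

/-- Partial derivative in the second variable (the polar angle `θ`). -/
def dθ (f : ℝ → ℝ → ℝ) (R θ : ℝ) : ℝ := deriv (fun t => f R t) θ

/-- The data describing a stationary axisymmetric electrovacuum vicinity of a horizon `R = rh` in
Boyer-Lindquist-type coordinates `(t, R, θ, φ)`: the line element is
`μ (dR² / (R² - rh²) + dθ²) + u sin²θ (dφ - Ω dt)² - (4 / u) (R² - rh²) dt²`,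
the electromagnetic potential has the components `Aφ` and `A_t = Φ - Ω Aφ`, and the coordinate `R`
ranges over `(rh - δ, rh + δ)`. The constants `κ`, `Ωh`, `Φh` are the surface gravity, the angular
velocity and the comoving electric potential of the horizon. Functions of `(R, θ)` are taken to be
extended past the axis `θ = 0, π` to all real `θ` (for functions that are smooth on the sphere:
as even `2π`-periodic functions of `θ`). -/
structure HorizonData where
  rh : ℝ
  κ : ℝ
  Ωh : ℝ
  Φh : ℝ
  δ : ℝ
  u : ℝ → ℝ → ℝ
  μ : ℝ → ℝ → ℝ
  Ω : ℝ → ℝ → ℝ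
  Aφ : ℝ → ℝ → ℝ
  Φ : ℝ → ℝ → ℝ

namespace HorizonData

variable (B : HorizonData)

/-- The north pole value of `u` on the horizon. -/
def uN : ℝ := B.u B.rh 0

/-- `(1 / 2) log (u / uN)` -/
def ut (R θ : ℝ) : ℝ := 1 / 2 * Real.log (B.u R θ / B.uN)

/-- `(1 / 2) log (μ / uN)` -/
def μt (R θ : ℝ) : ℝ := 1 / 2 * Real.log (B.μ R θ / B.uN)

/-- `∂_R Φ - Aφ ∂_R Ω` -/
def ER (R θ : ℝ) : ℝ := dR B.Φ R θ - B.Aφ R θ * dR B.Ω R θ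

/-- `∂_θ Φ - Aφ ∂_θ Ω` -/
def Eθ (R θ : ℝ) : ℝ := dθ B.Φ R θ - B.Aφ R θ * dθ B.Ω R θ

/-- The Einstein-Maxwell equations in electrovacuum at the point `(R, θ)` off the axis, in
Boyer-Lindquist-type coordinates and with vanishing cosmological constant. -/
structure EinsteinMaxwellAt (R θ : ℝ) : Prop where
  eq_u :
    (R ^ 2 - B.rh ^ 2) * dR (dR B.ut) R θ + 2 * R * dR B.ut R θ + dθ (dθ B.ut) R θ
        + Real.cot θ * dθ B.ut R θ
      = 1 - B.u R θ ^ 2 / 8 * Real.sin θ ^ 2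
            * (dR B.Ω R θ ^ 2 + dθ B.Ω R θ ^ 2 / (R ^ 2 - B.rh ^ 2))
          - 1 / (B.u R θ * Real.sin θ ^ 2)
            * ((R ^ 2 - B.rh ^ 2) * dR B.Aφ R θ ^ 2 + dθ B.Aφ R θ ^ 2)
          - B.u R θ / 4 * (B.ER R θ ^ 2 + B.Eθ R θ ^ 2 / (R ^ 2 - B.rh ^ 2))
  eq_μ :
    (R ^ 2 - B.rh ^ 2) * dR (dR B.μt) R θ + R * dR B.μt R θ + dθ (dθ B.μt) R θ
      = B.u R θ ^ 2 / 16 * Real.sin θ ^ 2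
            * (dR B.Ω R θ ^ 2 + dθ B.Ω R θ ^ 2 / (R ^ 2 - B.rh ^ 2))
          - (R ^ 2 - B.rh ^ 2) * dR B.ut R θ ^ 2 + R * dR B.ut R θ
          - dθ B.ut R θ * (dθ B.ut R θ + Real.cot θ)
  eq_Ω :
    (R ^ 2 - B.rh ^ 2) * (dR (dR B.Ω) R θ + 4 * dR B.Ω R θ * dR B.ut R θ)
        + dθ (dθ B.Ω) R θ + dθ B.Ω R θ * (3 * Real.cot θ + 4 * dθ B.ut R θ)
      = 4 / (B.u R θ * Real.sin θ ^ 2)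
          * ((R ^ 2 - B.rh ^ 2) * dR B.Aφ R θ * B.ER R θ + dθ B.Aφ R θ * B.Eθ R θ)
  eq_Φ :
    (R ^ 2 - B.rh ^ 2) * (dR (dR B.Φ) R θ - B.Aφ R θ * dR (dR B.Ω) R θ
          + 2 * dR B.ut R θ * B.ER R θ - dR B.Aφ R θ * dR B.Ω R θ)
        + dθ (dθ B.Φ) R θ - B.Aφ R θ * dθ (dθ B.Ω) R θ
        + (2 * dθ B.ut R θ + Real.cot θ) * B.Eθ R θ - dθ B.Aφ R θ * dθ B.Ω R θ
      = 0
  eq_A :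
    (R ^ 2 - B.rh ^ 2) * (dR (dR B.Aφ) R θ - 2 * dR B.ut R θ * dR B.Aφ R θ)
        + 2 * R * dR B.Aφ R θ + dθ (dθ B.Aφ) R θ
        - (2 * dθ B.ut R θ + Real.cot θ) * dθ B.Aφ R θ
      = B.u R θ ^ 2 / 4 * Real.sin θ ^ 2
          * (B.ER R θ * dR B.Ω R θ + B.Eθ R θ / (R ^ 2 - B.rh ^ 2) * dθ B.Ω R θ)

/-- A function of `(R, θ)` is smooth across the horizon, for `R` in `(rh - δ, rh + δ)`. -/
def SmoothNear (f : ℝ → ℝ → ℝ) : Prop :=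
  ContDiffOn ℝ ∞ (fun p : ℝ × ℝ => f p.1 p.2) (Ioo (B.rh - B.δ) (B.rh + B.δ) ×ˢ univ)

/-- `B` describes an axisymmetric and stationary charged black hole: the potentials are smooth
across the horizon, the Einstein-Maxwell equations hold in the exterior electrovacuum vicinity
`rh < R < rh + δ` (nothing is assumed about the matter further outside), and the boundary
conditions on the horizon and the regularity conditions on the axis are satisfied. -/
structure IsBlackHole : Prop where
  rh_pos : 0 < B.rh
  δ_pos : 0 < B.δ
  smooth_u : B.SmoothNear B.u
  smooth_μ : B.SmoothNear B.μ
  smooth_Ω : B.SmoothNear B.Ω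
  smooth_A : B.SmoothNear B.Aφ
  smooth_Φ : B.SmoothNear B.Φ
  u_pos : ∀ R ∈ Ioo (B.rh - B.δ) (B.rh + B.δ), ∀ θ ∈ Icc 0 Real.pi, 0 < B.u R θ
  μ_pos : ∀ R ∈ Ioo (B.rh - B.δ) (B.rh + B.δ), ∀ θ ∈ Icc 0 Real.pi, 0 < B.μ R θ
  field_eq : ∀ R ∈ Ioo B.rh (B.rh + B.δ), ∀ θ ∈ Ioo 0 Real.pi, B.EinsteinMaxwellAt R θ
  horizon_Ω : ∀ θ ∈ Icc 0 Real.pi, B.Ω B.rh θ = B.Ωh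
  horizon_κ : ∀ θ ∈ Icc 0 Real.pi, 2 * B.rh / √(B.μ B.rh θ * B.u B.rh θ) = B.κ
  horizon_Φ : ∀ θ ∈ Icc 0 Real.pi, B.Φ B.rh θ = B.Φh
  north_μ : B.μ B.rh 0 = 2 * B.rh / B.κ
  north_u : B.u B.rh 0 = 2 * B.rh / B.κ
  south_μ : B.μ B.rh Real.pi = 2 * B.rh / B.κ
  south_u : B.u B.rh Real.pi = 2 * B.rh / B.κ
  axis_north : ∀ R ∈ Ico B.rh (B.rh + B.δ), B.Aφ R 0 = 0
  axis_south : ∀ R ∈ Ico B.rh (B.rh + B.δ), B.Aφ R Real.pi = 0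

/-- The angular momentum of the black hole (Komar integral over the horizon). -/
def J : ℝ :=
  -(1 / 4) * ∫ θ in (0 : ℝ)..Real.pi,
    B.u B.rh θ * (B.u B.rh θ / 4 * dR B.Ω B.rh θ * Real.sin θ ^ 2 - B.Aφ B.rh θ * B.ER B.rh θ)
      * Real.sin θ

/-- The electric charge of the black hole (flux integral over the horizon). -/
def Q : ℝ :=
  -(1 / 4) * ∫ θ in (0 : ℝ)..Real.pi, B.u B.rh θ * B.ER B.rh θ * Real.sin θ

/-- The area of the horizon. -/
def A : ℝ :=
  2 * Real.pi * ∫ θ in (0 : ℝ)..Real.pi, √(B.μ B.rh θ * B.u B.rh θ) * Real.sin θ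

def pJ : ℝ := 8 * Real.pi * B.J / B.A

def pQ : ℝ := 4 * Real.pi * B.Q ^ 2 / B.A

/-! ### Trapped surfaces and sub-extremality -/

/-- The metric at `(R, θ)`, as a bilinear form in the components with respect to `(t, R, θ, φ)`. -/
def metricBL (R θ : ℝ) (X Y : Fin 4 → ℝ) : ℝ :=
  B.μ R θ * (X 1 * Y 1 / (R ^ 2 - B.rh ^ 2) + X 2 * Y 2)
    + B.u R θ * Real.sin θ ^ 2 * (X 3 - B.Ω R θ * X 0) * (Y 3 - B.Ω R θ * Y 0)
    - 4 / B.u R θ * (R ^ 2 - B.rh ^ 2) * X 0 * Y 0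

/-- Horizon-penetrating corotating coordinates `(v, R, θ, χ)` are given by
`dt = dv - rh / (κ (R² - rh²)) dR` and `dφ = dχ + Ωh dt`. This converts the components of a tangent
vector at radius `R` with respect to `(v, R, θ, χ)` into those with respect to `(t, R, θ, φ)`. -/
def toBL (R : ℝ) (X : Fin 4 → ℝ) : Fin 4 → ℝ :=
  ![X 0 - B.rh / (B.κ * (R ^ 2 - B.rh ^ 2)) * X 1, X 1, X 2,
    X 3 + B.Ωh * (X 0 - B.rh / (B.κ * (R ^ 2 - B.rh ^ 2)) * X 1)]

/-- The metric at the point `p = (v, R, θ, χ)`, off the horizon, in horizon-penetrating coordinates.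
The coefficients extend smoothly to the horizon, and `∂_v` is there the null generator. -/
def metric (p X Y : Fin 4 → ℝ) : ℝ :=
  B.metricBL (p 1) (p 2) (B.toBL (p 1) X) (B.toBL (p 1) Y)

/-- The first tangent vector of a surface parametrized by two real parameters. -/
def tangent₁ (σ : ℝ → ℝ → Fin 4 → ℝ) (a b : ℝ) : Fin 4 → ℝ := deriv (fun s => σ s b) a

/-- The second tangent vector. -/
def tangent₂ (σ : ℝ → ℝ → Fin 4 → ℝ) (a b : ℝ) : Fin 4 → ℝ := deriv (fun s => σ a s) b

/-- The area density of a parametrized spacelike surface. -/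
def areaDensity (σ : ℝ → ℝ → Fin 4 → ℝ) (a b : ℝ) : ℝ :=
  √(B.metric (σ a b) (tangent₁ σ a b) (tangent₁ σ a b)
        * B.metric (σ a b) (tangent₂ σ a b) (tangent₂ σ a b)
      - B.metric (σ a b) (tangent₁ σ a b) (tangent₂ σ a b) ^ 2)

/-- The expansion of the surface `σ` along the vector field `l` on it: the logarithmic rate of change
of the area density when the surface is displaced along `l`. -/
def expansion (σ l : ℝ → ℝ → Fin 4 → ℝ) (a b : ℝ) : ℝ :=
  logDeriv (fun s : ℝ => B.areaDensity (fun a' b' => σ a' b' + s • l a' b') a b) 0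

/-- `l` is a null normal of the surface `σ` at the parameters `(a, b)`. -/
structure IsNullNormal (σ l : ℝ → ℝ → Fin 4 → ℝ) (a b : ℝ) : Prop where
  null : B.metric (σ a b) (l a b) (l a b) = 0
  normal₁ : B.metric (σ a b) (l a b) (tangent₁ σ a b) = 0
  normal₂ : B.metric (σ a b) (l a b) (tangent₂ σ a b) = 0

/-- The point of the unit sphere with polar angle `θ` and azimuth `χ`. -/
def spherePoint (θ χ : ℝ) : Fin 3 → ℝ :=
  ![Real.sin θ * Real.cos χ, Real.sin θ * Real.sin χ, Real.cos θ]

/-- The closed surface `v = τ`, `R = rh - ε h` over the sphere, parametrized by `(θ, χ)`. For `ε = 0`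
it is a cross-section of the horizon, for small `ε > 0` and `h > 0` it lies in the interior. -/
def surface (τ h : (Fin 3 → ℝ) → ℝ) (ε θ χ : ℝ) : Fin 4 → ℝ :=
  ![τ (spherePoint θ χ), B.rh - ε * h (spherePoint θ χ), θ, χ]

/-- Sub-extremality: some cross-section `v = τ` of the event horizon can be deformed into the interior
so that the surfaces `S ε` obtained for small `ε > 0`, which lie in every prescribed vicinity of the
horizon, are trapped, to first order in the displacement: the expansion of their outgoing null
normal `l ε` is at most `-c ε` for some `c > 0`. The outgoing null normal is the one that extends
smoothly to the null generator `∂_v` of the horizon as `ε` tends to `0`; it is normalized by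
`dv (l) = 1`. On the horizon itself the expansion vanishes, so the condition says that the derivative
of the outgoing expansion under the inward deformation is negative. -/
def SubExtremal : Prop :=
  ∃ (τ h : (Fin 3 → ℝ) → ℝ) (ε₀ c : ℝ) (l : ℝ → ℝ → ℝ → Fin 4 → ℝ),
    ContDiff ℝ ∞ τ ∧ ContDiff ℝ ∞ h ∧ (∀ θ χ : ℝ, 0 < h (spherePoint θ χ)) ∧ 0 < ε₀ ∧ 0 < c ∧
    ContDiffOn ℝ ∞ (fun p : ℝ × ℝ × ℝ => l p.1 p.2.1 p.2.2)
      (Ico 0 ε₀ ×ˢ Ioo 0 Real.pi ×ˢ univ) ∧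
    (∀ θ ∈ Ioo 0 Real.pi, ∀ χ : ℝ, l 0 θ χ = ![1, 0, 0, 0]) ∧
    ∀ ε ∈ Ioo 0 ε₀, ∀ θ ∈ Ioo 0 Real.pi, ∀ χ : ℝ,
      l ε θ χ 0 = 1 ∧
      B.IsNullNormal (B.surface τ h ε) (l ε) θ χ ∧
      B.expansion (B.surface τ h ε) (l ε) θ χ ≤ -(c * ε)

end HorizonData

end

/-! Both assertions rest on one lower bound for the energy of a curve in the complex hyperbolic
plane, `two_add_log_le_energy`. In horospherical coordinates (η, ψ, T, W) the metric is (dη/2η)² +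
(dψ² + dT²)/η + (dW + ψ dT − T dψ)²/η². Put x = cos θ, η = e^{2U} sin²θ, ψ' = S sin θ, and let V
sin²θ be the vertical velocity with respect to the parameter log tan(θ/2). Then the integrand is the
squared speed minus cos²θ, divided by sin θ. The curve leaves the ideal point at the Heisenberg
origin at θ = 0 and reaches another ideal point at θ = π. The Busemann function b = ½ log(N/η) of
the former, with N = (η + ψ² + T²)² + 4W², has unit gradient, so |γ'|² ≥ 2⟨γ', ∇b⟩ − 1. Integration
leaves boundary terms only, and the energy is at least 2 + log(N(π)/16).

For (i), V is at one's disposal. The choice proportional to e^{2U} contributes exactly M₂² to the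
energy, and the definitions of M₁ and M₂ give N(π) ≥ 16, hence 2I ≥ 2 for smooth data. Density of
smooth functions extends this to all of L² and W₀^{1,2} (`one_le_functionalI`).

For (ii), the energy bound is applied to the horizon itself. Since μu is constant there, adding the
horizon limits of the equations for u and μ (`horizonRate_eq`) identifies the energy density with (1
− ρ) sin θ, where ρ is `horizonRate`. The end point of the curve encodes J and Q, with N(π)/16 = pJ²
+ pQ². If this sum were at least 1, the mean of ρ could not be positive.

Positivity of that mean is what sub-extremality provides. The null normals are ∂_v plus terms of
order ε, which the null and orthogonality conditions determine to first order. Dividing the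
expansion by ε, letting ε tend to 0 and substituting z = log h − κτ gives the Riccati-type
inequality z_θθ + cot θ z_θ + z_θ² + C (z_χχ + z_χ²) − D z_χ − ρ ≤ −ck/h with C ≥ 0
(`logDisplacement_inequality`). Integrated over the round sphere, the terms linear in z vanish and
the squares have the good sign, so the mean of ρ is positive (`integral_mul_sin_pos_of_riccati`). -/

/-! ## A calibration inequality on the complex hyperbolic plane -/

/-- The unit-speed gradient field of the Busemann function `½ log (N / η)` calibrates the energy
density. -/
lemma energy_density_ge (e s c p q S V ψ T W : ℝ) (he : 0 < e) (hs : 0 < s)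
    (hsc : s ^ 2 + c ^ 2 = 1) :
    (2 * (e * s ^ 2 + ψ ^ 2 + T ^ 2)
          * (2 * e * p * s ^ 2 + 2 * e * s * c + 2 * ψ * (S * s) + 2 * T * q)
        + 8 * W * (V * e * s ^ 3 + S * s * T - ψ * q))
        / ((e * s ^ 2 + ψ ^ 2 + T ^ 2) ^ 2 + 4 * W ^ 2) - 2 * p - 2 * (1 + c) / s + s
      ≤ s * (p ^ 2 + 2 * (c / s) * p + (S ^ 2 + q ^ 2 / s ^ 2) / e + V ^ 2 * s ^ 2) := by
  have hN : 0 < (e * s ^ 2 + ψ ^ 2 + T ^ 2) ^ 2 + 4 * W ^ 2 := by positivity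
  rw [← sub_nonneg]
  -- The difference is |γ' − ∇b|²/s, with the velocity taken in the parameter log tan(θ/2). The four
  -- fractions over N are the components of ∇b in the orthonormal frame, up to the factor √e in the
  -- two horizontal ones. Expanding the square uses |∇b| = 1.
  have key : s * (p ^ 2 + 2 * (c / s) * p + (S ^ 2 + q ^ 2 / s ^ 2) / e + V ^ 2 * s ^ 2)
      - ((2 * (e * s ^ 2 + ψ ^ 2 + T ^ 2)
          * (2 * e * p * s ^ 2 + 2 * e * s * c + 2 * ψ * (S * s) + 2 * T * q)
        + 8 * W * (V * e * s ^ 3 + S * s * T - ψ * q))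
        / ((e * s ^ 2 + ψ ^ 2 + T ^ 2) ^ 2 + 4 * W ^ 2) - 2 * p - 2 * (1 + c) / s + s)
      = 1 / s * ((s * p + c - ((e * s ^ 2) ^ 2 - (ψ ^ 2 + T ^ 2) ^ 2 - 4 * W ^ 2)
            / ((e * s ^ 2 + ψ ^ 2 + T ^ 2) ^ 2 + 4 * W ^ 2)) ^ 2
          + (S * s - e * s * (2 * ψ * (e * s ^ 2 + ψ ^ 2 + T ^ 2) + 4 * W * T)
            / ((e * s ^ 2 + ψ ^ 2 + T ^ 2) ^ 2 + 4 * W ^ 2)) ^ 2 / e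
          + (q - e * s * (2 * T * (e * s ^ 2 + ψ ^ 2 + T ^ 2) - 4 * W * ψ)
            / ((e * s ^ 2 + ψ ^ 2 + T ^ 2) ^ 2 + 4 * W ^ 2)) ^ 2 / e
          + (V * s ^ 2 - 4 * (e * s ^ 2) * W
            / ((e * s ^ 2 + ψ ^ 2 + T ^ 2) ^ 2 + 4 * W ^ 2)) ^ 2) := by
    have hc : c ^ 2 = 1 - s ^ 2 := by linarith
    generalize hNd : (e * s ^ 2 + ψ ^ 2 + T ^ 2) ^ 2 + 4 * W ^ 2 = N at *
    have hN0 := hN.ne'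
    field_simp
    -- With N kept as an atom through `field_simp`, its definition is used to eliminate W² and W⁴;
    -- what remains is a polynomial identity.
    have h4 : W ^ 2 = (N - (e * s ^ 2 + ψ ^ 2 + T ^ 2) ^ 2) / 4 := by linarith
    ring_nf
    simp only [hc]
    have h6 : W ^ 4 = ((N - (e * s ^ 2 + ψ ^ 2 + T ^ 2) ^ 2) / 4) ^ 2 := by rw [← h4]; ring
    simp only [h4, h6]
    ring
  rw [key]
  positivity

/-! ### Primitives and boundary behaviour at the poles -/

lemma hasDerivAt_primitive {k : ℝ → ℝ} {a b θ : ℝ} (hk : ContinuousOn k (Icc a b))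
    (hθ : θ ∈ Ioo a b) : HasDerivAt (fun x => ∫ t in a..x, k t) (k θ) θ := by
  have hab : a ≤ θ := hθ.1.le
  refine intervalIntegral.integral_hasDerivAt_right ?_ ?_ ?_
  · refine (hk.mono ?_).intervalIntegrable
    rw [uIcc_of_le hab]
    exact Icc_subset_Icc le_rfl hθ.2.le
  · exact (hk.mono Ioo_subset_Icc_self).stronglyMeasurableAtFilter isOpen_Ioo θ hθ
  · exact hk.continuousAt (Icc_mem_nhds hθ.1 hθ.2)

lemma continuousOn_primitive_Icc {k : ℝ → ℝ} {a b : ℝ} (hab : a ≤ b)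
    (hk : ContinuousOn k (Icc a b)) : ContinuousOn (fun x => ∫ t in a..x, k t) (Icc a b) := by
  have := intervalIntegral.continuousOn_primitive_interval (f := k) (μ := volume) (a := a) (b := b)
    (by rw [uIcc_of_le hab]; exact hk.integrableOn_Icc)
  rwa [uIcc_of_le hab] at this

lemma tendsto_one_sub_cos_nhdsGT : Tendsto (fun θ => 1 - Real.cos θ) (𝓝[>] 0) (𝓝 0) := by
  have : Continuous fun θ => 1 - Real.cos θ := by fun_prop
  simpa using (this.tendsto 0).mono_left nhdsWithin_le_nhds

lemma Ioo_zero_pi_mem_nhdsGT : Ioo 0 Real.pi ∈ 𝓝[>] (0 : ℝ) := Ioo_mem_nhdsGT Real.pi_pos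

/-- L'Hôpital's rule against `1 - cos`. -/
lemma tendsto_div_one_sub_cos {F F' : ℝ → ℝ} {d : ℝ}
    (hF : ∀ θ ∈ Ioo 0 Real.pi, HasDerivAt F (F' θ) θ) (hF0 : Tendsto F (𝓝[>] 0) (𝓝 0))
    (hd : Tendsto (fun θ => F' θ / Real.sin θ) (𝓝[>] 0) (𝓝 d)) :
    Tendsto (fun θ => F θ / (1 - Real.cos θ)) (𝓝[>] 0) (𝓝 d) := by
  refine HasDerivAt.lhopital_zero_nhdsGT (f' := F') (g' := Real.sin) ?_ ?_ ?_ hF0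
    tendsto_one_sub_cos_nhdsGT hd
  · filter_upwards [Ioo_zero_pi_mem_nhdsGT] with θ hθ using hF θ hθ
  · refine Eventually.of_forall fun θ => ?_
    simpa using (Real.hasDerivAt_cos θ).const_sub 1
  · filter_upwards [Ioo_zero_pi_mem_nhdsGT] with θ hθ
    exact (Real.sin_pos_of_pos_of_lt_pi hθ.1 hθ.2).ne'

lemma tendsto_pi_sub_nhdsGT : Tendsto (fun η => Real.pi - η) (𝓝[>] 0) (𝓝[<] Real.pi) := by
  refine tendsto_nhdsWithin_iff.2 ⟨?_, ?_⟩
  · have : Continuous fun η : ℝ => Real.pi - η := by fun_prop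
    simpa using (this.tendsto 0).mono_left nhdsWithin_le_nhds
  · filter_upwards [self_mem_nhdsWithin] with η hη
    have : 0 < η := hη
    simpa using this

/-- The energy density, in terms of the polar angle. -/
noncomputable def energyDensity (U Uθ Tθ S V : ℝ → ℝ) (θ : ℝ) : ℝ :=
  Real.sin θ * (Uθ θ ^ 2 + 2 * (Real.cos θ / Real.sin θ) * Uθ θ
    + (S θ ^ 2 + Tθ θ ^ 2 / Real.sin θ ^ 2) / Real.exp (2 * U θ) + V θ ^ 2 * Real.sin θ ^ 2)

/-- The lower bound for the regularized energy of a curve in the complex hyperbolic plane that joins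
two ideal points, in terms of the Heisenberg distance of these. -/
theorem two_add_log_le_energy {U Uθ T Tθ S V : ℝ → ℝ} {τ₀ D : ℝ}
    (hU : ∀ θ ∈ Icc 0 Real.pi, HasDerivAt U (Uθ θ) θ)
    (hT : ∀ θ ∈ Icc 0 Real.pi, HasDerivAt T (Tθ θ) θ)
    (hUθ : ContinuousOn Uθ (Icc 0 Real.pi)) (hTθ : ContinuousOn Tθ (Icc 0 Real.pi))
    (hS : ContinuousOn S (Icc 0 Real.pi)) (hV : ContinuousOn V (Icc 0 Real.pi))
    (hU0 : U 0 = 0) (hUπ : U Real.pi = 0) (hT0 : T 0 = 0) (hTπ : T Real.pi = 0)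
    (hτ : Tendsto (fun θ => Tθ θ / Real.sin θ) (𝓝[>] 0) (𝓝 τ₀))
    (hN : 0 < (∫ θ in (0 : ℝ)..Real.pi, S θ * Real.sin θ) ^ 4
      + 4 * (∫ θ in (0 : ℝ)..Real.pi, (V θ * Real.exp (2 * U θ) * Real.sin θ ^ 2
          + 2 * S θ * T θ) * Real.sin θ) ^ 2)
    (hD : Tendsto (fun η => ∫ θ in η..(Real.pi - η), energyDensity U Uθ Tθ S V θ)
      (𝓝[>] 0) (𝓝 D)) :
    2 + Real.log (((∫ θ in (0 : ℝ)..Real.pi, S θ * Real.sin θ) ^ 4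
      + 4 * (∫ θ in (0 : ℝ)..Real.pi, (V θ * Real.exp (2 * U θ) * Real.sin θ ^ 2
          + 2 * S θ * T θ) * Real.sin θ) ^ 2) / 16) ≤ D := by
  have hpi := Real.pi_pos
  have hsub : Ioo 0 Real.pi ⊆ Icc 0 Real.pi := Ioo_subset_Icc_self
  have cU : ContinuousOn U (Icc 0 Real.pi) := fun θ hθ =>
    (hU θ hθ).continuousAt.continuousWithinAt
  have cT : ContinuousOn T (Icc 0 Real.pi) := fun θ hθ =>
    (hT θ hθ).continuousAt.continuousWithinAt
  set κ : ℝ → ℝ := fun θ => V θ * Real.exp (2 * U θ) * Real.sin θ ^ 2 + 2 * S θ * T θ with hκ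
  have cκ : ContinuousOn κ (Icc 0 Real.pi) := by fun_prop
  set ψ : ℝ → ℝ := fun x => ∫ θ in (0 : ℝ)..x, S θ * Real.sin θ with hψ
  set K : ℝ → ℝ := fun x => ∫ θ in (0 : ℝ)..x, κ θ * Real.sin θ with hK
  have cSs : ContinuousOn (fun θ => S θ * Real.sin θ) (Icc 0 Real.pi) := by fun_prop
  have cκs : ContinuousOn (fun θ => κ θ * Real.sin θ) (Icc 0 Real.pi) := by fun_prop
  have dψ : ∀ θ ∈ Ioo 0 Real.pi, HasDerivAt ψ (S θ * Real.sin θ) θ := fun θ hθ =>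
    hasDerivAt_primitive cSs hθ
  have dK : ∀ θ ∈ Ioo 0 Real.pi, HasDerivAt K (κ θ * Real.sin θ) θ := fun θ hθ =>
    hasDerivAt_primitive cκs hθ
  have cψ : ContinuousOn ψ (Icc 0 Real.pi) := continuousOn_primitive_Icc hpi.le cSs
  have cK : ContinuousOn K (Icc 0 Real.pi) := continuousOn_primitive_Icc hpi.le cκs
  have right0 : ∀ f : ℝ → ℝ, ContinuousOn f (Icc 0 Real.pi) →
      Tendsto f (𝓝[>] 0) (𝓝 (f 0)) := fun f hf =>
    (hf 0 ⟨le_rfl, hpi.le⟩).mono_left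
      (nhdsWithin_le_of_mem (mem_of_superset Ioo_zero_pi_mem_nhdsGT hsub))
  have leftπ : ∀ f : ℝ → ℝ, ContinuousOn f (Icc 0 Real.pi) →
      Tendsto (fun η => f (Real.pi - η)) (𝓝[>] 0) (𝓝 (f Real.pi)) := fun f hf =>
    ((hf Real.pi ⟨hpi.le, le_rfl⟩).mono_left (nhdsWithin_le_of_mem
      (mem_of_superset (Ioo_mem_nhdsLT hpi) hsub))).comp tendsto_pi_sub_nhdsGT
  have hψ0 : ψ 0 = 0 := by simp [hψ]
  have hK0 : K 0 = 0 := by simp [hK]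
  have hsin : ∀ θ ∈ Ioo 0 Real.pi, 0 < Real.sin θ := fun θ hθ =>
    Real.sin_pos_of_pos_of_lt_pi hθ.1 hθ.2
  have hcos : ∀ θ ∈ Ioo 0 Real.pi, 0 < 1 - Real.cos θ := fun θ hθ => by
    have h1 := Real.cos_le_one θ
    have h2 : Real.cos θ ≠ 1 := fun h => by
      have := hsin θ hθ
      have h3 := Real.sin_sq_add_cos_sq θ
      rw [h] at h3
      nlinarith
    have := lt_of_le_of_ne h1 h2
    linarith
  -- the quantities that stay bounded relative to `1 - cos`
  have lψ : Tendsto (fun θ => ψ θ / (1 - Real.cos θ)) (𝓝[>] 0) (𝓝 (S 0)) := by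
    refine tendsto_div_one_sub_cos dψ (by simpa [hψ0] using right0 ψ cψ) ?_
    refine (right0 S hS).congr' ?_
    filter_upwards [Ioo_zero_pi_mem_nhdsGT] with θ hθ
    field_simp [(hsin θ hθ).ne']
  have lT : Tendsto (fun θ => T θ / (1 - Real.cos θ)) (𝓝[>] 0) (𝓝 τ₀) :=
    tendsto_div_one_sub_cos (fun θ hθ => hT θ (hsub hθ)) (by simpa [hT0] using right0 T cT) hτ
  have lK : Tendsto (fun θ => K θ / (1 - Real.cos θ)) (𝓝[>] 0) (𝓝 0) := by
    refine tendsto_div_one_sub_cos dK (by simpa [hK0] using right0 K cK) ?_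
    have h := right0 κ cκ
    have h0 : κ 0 = 0 := by simp [hκ, hT0]
    rw [h0] at h
    refine h.congr' ?_
    filter_upwards [Ioo_zero_pi_mem_nhdsGT] with θ hθ
    field_simp [(hsin θ hθ).ne']
  -- Subtracting ψT from K gives the vertical Heisenberg coordinate in which the contact form is dW
  -- + ψ dT − T dψ.
  set W : ℝ → ℝ := fun θ => K θ - ψ θ * T θ with hW
  set N : ℝ → ℝ := fun θ =>
    (Real.exp (2 * U θ) * Real.sin θ ^ 2 + ψ θ ^ 2 + T θ ^ 2) ^ 2 + 4 * W θ ^ 2 with hNdef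
  have cW : ContinuousOn W (Icc 0 Real.pi) := by fun_prop
  have cN : ContinuousOn N (Icc 0 Real.pi) := by fun_prop
  have Npos : ∀ θ ∈ Ioo 0 Real.pi, 0 < N θ := fun θ hθ => by
    have := hsin θ hθ
    positivity
  -- This is 2b − 2 log tan(θ/2) − cos θ. The last two terms have derivative −2/sin θ + sin θ = −(1
  -- + cos²θ)/sin θ, which accounts for the −1 of the calibration and for the subtracted cos²θ.
  set B : ℝ → ℝ := fun θ =>
    Real.log (N θ) - 2 * U θ - 2 * Real.log (1 - Real.cos θ) - Real.cos θ with hB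
  set N' : ℝ → ℝ := fun θ =>
    2 * (Real.exp (2 * U θ) * Real.sin θ ^ 2 + ψ θ ^ 2 + T θ ^ 2)
          * (2 * Real.exp (2 * U θ) * Uθ θ * Real.sin θ ^ 2
            + 2 * Real.exp (2 * U θ) * Real.sin θ * Real.cos θ + 2 * ψ θ * (S θ * Real.sin θ)
            + 2 * T θ * Tθ θ)
        + 8 * W θ * (V θ * Real.exp (2 * U θ) * Real.sin θ ^ 3 + S θ * Real.sin θ * T θ
            - ψ θ * Tθ θ) with hN'
  have dB : ∀ θ ∈ Ioo 0 Real.pi, HasDerivAt B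
      (N' θ / N θ - 2 * Uθ θ - 2 * (1 + Real.cos θ) / Real.sin θ + Real.sin θ) θ := by
    intro θ hθ
    have h1 := hU θ (hsub hθ)
    have h2 := hT θ (hsub hθ)
    have h3 := dψ θ hθ
    have h4 := dK θ hθ
    have h5 := Real.hasDerivAt_sin θ
    have h6 := Real.hasDerivAt_cos θ
    have dN : HasDerivAt N (N' θ) θ := by
      have h := (((((h1.const_mul 2).exp.mul (h5.pow 2)).add (h3.pow 2)).add (h2.pow 2)).pow
        2).add (((h4.sub (h3.mul h2)).pow 2).const_mul 4)
      refine h.congr_deriv ?_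
      simp only [hN', hW, hκ, Pi.add_apply, Pi.mul_apply, Pi.pow_apply, Pi.sub_apply]
      push_cast
      ring
    have h := (((dN.log (Npos θ hθ).ne').sub (h1.const_mul 2)).sub
      (((h6.const_sub 1).log (hcos θ hθ).ne').const_mul 2)).sub h6
    refine h.congr_deriv ?_
    have hs := hsin θ hθ
    have hc := hcos θ hθ
    have e : Real.sin θ / (1 - Real.cos θ) = (1 + Real.cos θ) / Real.sin θ := by
      rw [div_eq_div_iff hc.ne' hs.ne']
      have := Real.sin_sq_add_cos_sq θ
      nlinarith
    rw [neg_neg, e]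
    ring
  have cE : ContinuousOn (energyDensity U Uθ Tθ S V) (Ioo 0 Real.pi) := by
    have hUθ := hUθ.mono hsub
    have hTθ := hTθ.mono hsub
    have hS := hS.mono hsub
    have hV := hV.mono hsub
    have cU := cU.mono hsub
    unfold energyDensity
    have h1 : ∀ θ ∈ Ioo 0 Real.pi, Real.sin θ ≠ 0 := fun θ hθ => (hsin θ hθ).ne'
    have h2 : ∀ θ ∈ Ioo 0 Real.pi, Real.sin θ ^ 2 ≠ 0 := fun θ hθ => pow_ne_zero 2 (h1 θ hθ)
    have h3 : ∀ θ ∈ Ioo 0 Real.pi, Real.exp (2 * U θ) ≠ 0 := fun θ _ => (Real.exp_pos _).ne'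
    fun_prop (disch := assumption)
  have cB' : ContinuousOn (fun θ => N' θ / N θ - 2 * Uθ θ - 2 * (1 + Real.cos θ) / Real.sin θ
      + Real.sin θ) (Ioo 0 Real.pi) := by
    have hUθ := hUθ.mono hsub
    have hTθ := hTθ.mono hsub
    have hS := hS.mono hsub
    have hV := hV.mono hsub
    have cU := cU.mono hsub
    have cT := cT.mono hsub
    have cψ := cψ.mono hsub
    have cW := cW.mono hsub
    have cN := cN.mono hsub
    have h1 : ∀ θ ∈ Ioo 0 Real.pi, Real.sin θ ≠ 0 := fun θ hθ => (hsin θ hθ).ne'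
    have h2 : ∀ θ ∈ Ioo 0 Real.pi, N θ ≠ 0 := fun θ hθ => (Npos θ hθ).ne'
    have cN' : ContinuousOn N' (Ioo 0 Real.pi) := by fun_prop
    fun_prop (disch := assumption)
  have main : ∀ᶠ η in 𝓝[>] (0 : ℝ),
      B (Real.pi - η) - B η ≤ ∫ θ in η..(Real.pi - η), energyDensity U Uθ Tθ S V θ := by
    filter_upwards [Ioo_mem_nhdsGT (half_pos hpi)] with η hη
    have hη1 : η ≤ Real.pi - η := by linarith [hη.2]
    have hI : Icc η (Real.pi - η) ⊆ Ioo 0 Real.pi := fun x hx =>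
      ⟨by linarith [hη.1, hx.1], by linarith [hη.1, hx.2]⟩
    have hI' : uIcc η (Real.pi - η) ⊆ Ioo 0 Real.pi := by rwa [uIcc_of_le hη1]
    have ftc := intervalIntegral.integral_eq_sub_of_hasDerivAt
      (fun x hx => dB x (hI' hx)) ((cB'.mono hI').intervalIntegrable)
    rw [← ftc]
    refine intervalIntegral.integral_mono_on hη1 ((cB'.mono hI').intervalIntegrable)
      ((cE.mono hI').intervalIntegrable) fun θ hθ => ?_
    exact energy_density_ge (Real.exp (2 * U θ)) (Real.sin θ) (Real.cos θ) (Uθ θ) (Tθ θ) (S θ)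
      (V θ) (ψ θ) (T θ) (W θ) (Real.exp_pos _) (hsin θ (hI hθ)) (Real.sin_sq_add_cos_sq θ)
  have hNπ : N Real.pi = (∫ θ in (0 : ℝ)..Real.pi, S θ * Real.sin θ) ^ 4
      + 4 * (∫ θ in (0 : ℝ)..Real.pi, (V θ * Real.exp (2 * U θ) * Real.sin θ ^ 2
          + 2 * S θ * T θ) * Real.sin θ) ^ 2 := by
    simp only [hNdef, hW, hTπ, hψ, hK, hκ, Real.sin_pi]
    ring
  rw [← hNπ] at hN ⊢
  -- At the south pole nothing degenerates: N(π) > 0 by hypothesis, and log 2 comes from 1 − cos π =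
  -- 2.
  have lim1 : Tendsto (fun η => B (Real.pi - η)) (𝓝[>] 0) (𝓝 (Real.log (N Real.pi)
      - 2 * Real.log 2 + 1)) := by
    have h := ((((leftπ N cN).log hN.ne').sub ((leftπ U cU).const_mul 2)).sub
      (((leftπ (fun θ => 1 - Real.cos θ) (by fun_prop)).log (by simp)).const_mul 2)).sub
      (leftπ Real.cos (by fun_prop))
    have e : Real.log (N Real.pi) - 2 * U Real.pi - 2 * Real.log (1 - Real.cos Real.pi)
        - Real.cos Real.pi = Real.log (N Real.pi) - 2 * Real.log 2 + 1 := by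
      rw [hUπ, Real.cos_pi]
      norm_num
    rwa [e] at h
  -- Both logarithms diverge at the north pole, but N/(1 − cos θ)² tends to 4: η/(1 − cos θ) =
  -- e^{2U}(1 + cos θ) tends to 2, while the contributions of ψ, T and W are of higher order.
  have lim0 : Tendsto B (𝓝[>] 0) (𝓝 (2 * Real.log 2 - 1)) := by
    have hlim : Tendsto (fun θ => (Real.exp (2 * U θ) * (1 + Real.cos θ)
        + (ψ θ / (1 - Real.cos θ)) * ψ θ + (T θ / (1 - Real.cos θ)) * T θ) ^ 2
        + 4 * (K θ / (1 - Real.cos θ) - ψ θ / (1 - Real.cos θ) * T θ) ^ 2) (𝓝[>] 0) (𝓝 4) := by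
      have h := ((((right0 (fun θ => Real.exp (2 * U θ) * (1 + Real.cos θ)) (by fun_prop)).add
        (lψ.mul (right0 ψ cψ))).add (lT.mul (right0 T cT))).pow 2).add
        (((lK.sub (lψ.mul (right0 T cT))).pow 2).const_mul 4)
      convert h using 2
      simp [hU0, hψ0, hT0]
      norm_num
    have h := ((hlim.log (by norm_num)).sub ((right0 U cU).const_mul 2)).sub
      (right0 Real.cos (by fun_prop))
    have e : Real.log 4 - 2 * U 0 - Real.cos 0 = 2 * Real.log 2 - 1 := by
      rw [hU0, show (4 : ℝ) = 2 ^ 2 by norm_num, Real.log_pow]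
      simp
    rw [e] at h
    refine h.congr' ?_
    filter_upwards [Ioo_zero_pi_mem_nhdsGT] with θ hθ
    have hc := hcos θ hθ
    have e2 : (Real.exp (2 * U θ) * (1 + Real.cos θ)
        + (ψ θ / (1 - Real.cos θ)) * ψ θ + (T θ / (1 - Real.cos θ)) * T θ) ^ 2
        + 4 * (K θ / (1 - Real.cos θ) - ψ θ / (1 - Real.cos θ) * T θ) ^ 2
        = N θ / (1 - Real.cos θ) ^ 2 := by
      have hss : Real.sin θ ^ 2 = (1 - Real.cos θ) * (1 + Real.cos θ) := by
        have := Real.sin_sq_add_cos_sq θ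
        linarith
      simp only [hNdef, hW, hss]
      field_simp
    rw [e2, Real.log_div (Npos θ hθ).ne' (pow_pos hc 2).ne', Real.log_pow]
    simp only [hB]
    push_cast
    ring
  have := le_of_tendsto_of_tendsto (lim1.sub lim0) hD main
  have e16 : Real.log (N Real.pi / 16) = Real.log (N Real.pi) - 4 * Real.log 2 := by
    rw [Real.log_div hN.ne' (by norm_num), show (16 : ℝ) = 2 ^ 4 by norm_num, Real.log_pow]
    norm_num
  rw [e16]
  linarith

/-! ## Convergence of integrals along `L²`-convergent sequences -/

/-- The square-integrable functions `fn n` converge to `f` in `L²`. -/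
structure TendstoL2 (μ : Measure ℝ) (fn : ℕ → ℝ → ℝ) (f : ℝ → ℝ) : Prop where
  memLp_seq : ∀ n, MemLp (fn n) 2 μ
  memLp : MemLp f 2 μ
  tendsto : Tendsto (fun n => eLpNorm (fun x => fn n x - f x) 2 μ) atTop (𝓝 0)

namespace TendstoL2

variable {μ : Measure ℝ} {fn gn : ℕ → ℝ → ℝ} {f g : ℝ → ℝ}

lemma const (hf : MemLp f 2 μ) : TendstoL2 μ (fun _ => f) f :=
  ⟨fun _ => hf, hf, by simp⟩

lemma comp (hf : TendstoL2 μ fn f) {ns : ℕ → ℕ} (hns : StrictMono ns) :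
    TendstoL2 μ (fun n => fn (ns n)) f :=
  ⟨fun _ => hf.memLp_seq _, hf.memLp, hf.tendsto.comp hns.tendsto_atTop⟩

lemma integrable_mul (hf : MemLp f 2 μ) (hg : MemLp g 2 μ) :
    Integrable (fun x => f x * g x) μ :=
  hf.integrable_mul hg

/-- The integral is the inner product of L², which is jointly continuous. -/
lemma tendsto_integral_mul (hf : TendstoL2 μ fn f) (hg : TendstoL2 μ gn g) :
    Tendsto (fun n => ∫ x, fn n x * gn n x ∂μ) atTop (𝓝 (∫ x, f x * g x ∂μ)) := by
  have h1 := (Lp.tendsto_Lp_iff_tendsto_eLpNorm'' fn hf.memLp_seq f hf.memLp).2 hf.tendsto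
  have h2 := (Lp.tendsto_Lp_iff_tendsto_eLpNorm'' gn hg.memLp_seq g hg.memLp).2 hg.tendsto
  have e : ∀ {a b : ℝ → ℝ} (ha : MemLp a 2 μ) (hb : MemLp b 2 μ),
      inner ℝ (ha.toLp a) (hb.toLp b) = ∫ x, a x * b x ∂μ := by
    intro a b ha hb
    rw [L2.inner_def]
    refine integral_congr_ae ?_
    filter_upwards [ha.coeFn_toLp, hb.coeFn_toLp] with x hx hy
    rw [hx, hy]
    simp [mul_comm]
  have h := h1.inner (𝕜 := ℝ) h2
  rw [e] at h
  exact h.congr fun n => e _ _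

/-- Split fₙwₙ − fw as (fₙ − f)wₙ + f(wₙ − w). The first part is controlled by the bound M, the
second by dominated convergence with majorant f²(2M)². Pointwise convergence of the weights thus
suffices, which is how the exponentials of U enter. -/
lemma mul_bounded [IsFiniteMeasure μ] (hf : TendstoL2 μ fn f) {wn : ℕ → ℝ → ℝ} {w : ℝ → ℝ} {M : ℝ}
    (hwn : ∀ n, AEStronglyMeasurable (wn n) μ) (hM : ∀ n, ∀ᵐ x ∂μ, |wn n x| ≤ M)
    (hw : ∀ᵐ x ∂μ, Tendsto (fun n => wn n x) atTop (𝓝 (w x))) :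
    TendstoL2 μ (fun n x => fn n x * wn n x) (fun x => f x * w x) := by
  have hwm : AEStronglyMeasurable w μ := aestronglyMeasurable_of_tendsto_ae atTop hwn hw
  have hM' : ∀ᵐ x ∂μ, |w x| ≤ M := by
    filter_upwards [hw, ae_all_iff.2 hM] with x hx hx'
    exact le_of_tendsto hx.abs (Eventually.of_forall hx')
  have mem : ∀ {a v : ℝ → ℝ}, MemLp a 2 μ → AEStronglyMeasurable v μ → (∀ᵐ x ∂μ, |v x| ≤ M) →
      MemLp (fun x => a x * v x) 2 μ := by
    intro a v ha hv hvM
    refine ha.of_le_mul (c := M) (ha.aestronglyMeasurable.mul hv) ?_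
    filter_upwards [hvM] with x hx
    rw [norm_mul, mul_comm, Real.norm_eq_abs]
    gcongr
  refine ⟨fun n => mem (hf.memLp_seq n) (hwn n) (hM n), mem hf.memLp hwm hM', ?_⟩
  -- the part that comes from the convergence of the weights
  have hdm : ∀ n, MemLp (fun x => f x * (wn n x - w x)) 2 μ := fun n => by
    have := (mem hf.memLp (hwn n) (hM n)).sub (mem hf.memLp hwm hM')
    refine this.congr_norm (hf.memLp.aestronglyMeasurable.mul ((hwn n).sub hwm)) ?_
    refine Eventually.of_forall fun x => ?_
    simp [mul_sub]
  have hI : Tendsto (fun n => ∫ x, ‖f x * (wn n x - w x)‖ ^ (2 : ℝ) ∂μ) atTop (𝓝 0) := by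
    have : Tendsto (fun n => ∫ x, ‖f x * (wn n x - w x)‖ ^ (2 : ℝ) ∂μ) atTop
        (𝓝 (∫ _x, (0 : ℝ) ∂μ)) := by
      refine tendsto_integral_of_dominated_convergence (fun x => f x ^ 2 * (2 * M) ^ 2)
        (fun n => ?_) (hf.memLp.integrable_sq.mul_const _) (fun n => ?_) ?_
      · exact ((hdm n).aestronglyMeasurable.norm.aemeasurable.pow_const _).aestronglyMeasurable
      · filter_upwards [hM n, hM'] with x h1 h2
        have h3 : |wn n x - w x| ≤ 2 * M := by
          calc |wn n x - w x| ≤ |wn n x| + |w x| := abs_sub _ _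
            _ ≤ 2 * M := by linarith
        have h4 : (0 : ℝ) ≤ |wn n x - w x| := abs_nonneg _
        rw [Real.rpow_two, Real.norm_eq_abs, abs_of_nonneg (by positivity), Real.norm_eq_abs,
          sq_abs, mul_pow, ← sq_abs (wn n x - w x)]
        gcongr
      · filter_upwards [hw] with x hx
        have h : Tendsto (fun n => f x * (wn n x - w x)) atTop (𝓝 0) := by
          simpa using (hx.sub_const (w x)).const_mul (f x)
        simp only [Real.rpow_two]
        simpa using h.norm.pow 2
    simpa using this
  have h2 : Tendsto (fun n => eLpNorm (fun x => f x * (wn n x - w x)) 2 μ) atTop (𝓝 0) := by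
    have e : ∀ n, eLpNorm (fun x => f x * (wn n x - w x)) 2 μ
        = ENNReal.ofReal ((∫ x, ‖f x * (wn n x - w x)‖ ^ (2 : ℝ) ∂μ) ^ (2 : ℝ)⁻¹) := fun n => by
      simpa using (hdm n).eLpNorm_eq_integral_rpow_norm (by norm_num) (by norm_num)
    simp only [e]
    have := ENNReal.tendsto_ofReal (hI.rpow_const (p := (2 : ℝ)⁻¹) (Or.inr (by norm_num)))
    simpa using this
  have h1 : Tendsto (fun n => ENNReal.ofReal M * eLpNorm (fun x => fn n x - f x) 2 μ) atTop
      (𝓝 0) := by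
    simpa using ENNReal.Tendsto.const_mul hf.tendsto (Or.inr ENNReal.ofReal_ne_top)
  have h3 := h1.add h2
  rw [add_zero] at h3
  refine tendsto_of_tendsto_of_tendsto_of_le_of_le tendsto_const_nhds h3 (fun _ => zero_le) ?_
  intro n
  have e : (fun x => fn n x * wn n x - f x * w x)
      = (fun x => (fn n x - f x) * wn n x) + fun x => f x * (wn n x - w x) := by
    ext x
    simp only [Pi.add_apply]
    ring
  simp only
  rw [e]
  refine (eLpNorm_add_le ?_ (hdm n).aestronglyMeasurable (by norm_num)).trans ?_
  · exact ((hf.memLp_seq n).aestronglyMeasurable.sub hf.memLp.aestronglyMeasurable).mul (hwn n)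
  · gcongr
    refine eLpNorm_le_mul_eLpNorm_of_ae_le_mul ?_ 2
    filter_upwards [hM n] with x hx
    rw [norm_mul, mul_comm, Real.norm_eq_abs (wn n x)]
    gcongr

end TendstoL2

/-! ### Test functions on the interval -/

instance : IsFiniteMeasure intervalMeasure := by
  unfold intervalMeasure
  infer_instance

lemma interval_integral_eq (f : ℝ → ℝ) :
    ∫ x in (-1 : ℝ)..1, f x = ∫ x, f x ∂intervalMeasure := by
  rw [intervalIntegral.integral_of_le (by norm_num), integral_Ioc_eq_integral_Ioo, intervalMeasure]

lemma IsTestFunction.apply_neg_one {φ : ℝ → ℝ} (hφ : IsTestFunction φ) : φ (-1) = 0 :=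
  image_eq_zero_of_notMem_tsupport fun h => by simpa using hφ.2.2 h

lemma IsTestFunction.apply_one {φ : ℝ → ℝ} (hφ : IsTestFunction φ) : φ 1 = 0 :=
  image_eq_zero_of_notMem_tsupport fun h => by simpa using hφ.2.2 h

lemma IsTestFunction.contDiff_deriv {φ : ℝ → ℝ} (hφ : IsTestFunction φ) :
    ContDiff ℝ ∞ (deriv φ) :=
  (contDiff_infty_iff_deriv.1 hφ.1).2

lemma IsTestFunction.hasDerivAt {φ : ℝ → ℝ} (hφ : IsTestFunction φ) (x : ℝ) :
    HasDerivAt φ (deriv φ x) x :=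
  ((contDiff_infty_iff_deriv.1 hφ.1).1 x).hasDerivAt

lemma memLp_intervalMeasure_of_continuous {f : ℝ → ℝ} (hf : Continuous f) :
    MemLp f 2 intervalMeasure := by
  obtain ⟨C, hC⟩ := isCompact_Icc.exists_bound_of_continuousOn (s := Icc (-1 : ℝ) 1) hf.continuousOn
  refine MemLp.of_bound hf.aestronglyMeasurable C ?_
  unfold intervalMeasure
  refine (ae_restrict_mem measurableSet_Ioo).mono fun x hx => hC x (Ioo_subset_Icc_self hx)

/-- The one-dimensional Sobolev bound: integrate the derivative from −1, where φ vanishes, and use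
|φ'| ≤ 1 + φ'². The summand 2 is the length of the interval. -/
lemma IsTestFunction.abs_le {φ : ℝ → ℝ} (hφ : IsTestFunction φ) {x : ℝ} (hx : x ∈ Icc (-1) 1) :
    |φ x| ≤ 2 + ∫ x in (-1 : ℝ)..1, deriv φ x * deriv φ x := by
  have hc := hφ.contDiff_deriv.continuous
  have h1 : ∫ t in (-1 : ℝ)..x, deriv φ t = φ x := by
    rw [intervalIntegral.integral_eq_sub_of_hasDerivAt (fun t _ => hφ.hasDerivAt t)
      (hc.intervalIntegrable _ _), hφ.apply_neg_one, sub_zero]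
  have hi : ∀ a b : ℝ, IntervalIntegrable (fun t => 1 + deriv φ t * deriv φ t) volume a b :=
    fun a b => (by fun_prop : Continuous fun t => 1 + deriv φ t * deriv φ t).intervalIntegrable a b
  calc |φ x| = |∫ t in (-1 : ℝ)..x, deriv φ t| := by rw [h1]
    _ ≤ ∫ t in (-1 : ℝ)..x, |deriv φ t| := intervalIntegral.abs_integral_le_integral_abs hx.1
    _ ≤ ∫ t in (-1 : ℝ)..x, (1 + deriv φ t * deriv φ t) := by
        refine intervalIntegral.integral_mono_on hx.1 (hc.abs.intervalIntegrable _ _) (hi _ _) ?_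
        intro t _
        nlinarith [abs_nonneg (deriv φ t), abs_mul_abs_self (deriv φ t),
          sq_nonneg (|deriv φ t| - 1)]
    _ ≤ ∫ t in (-1 : ℝ)..1, (1 + deriv φ t * deriv φ t) := by
        refine intervalIntegral.integral_mono_interval le_rfl hx.1 hx.2 ?_ (hi _ _)
        refine Eventually.of_forall fun t => ?_
        simp only [Pi.zero_apply]
        nlinarith [mul_self_nonneg (deriv φ t)]
    _ = 2 + ∫ x in (-1 : ℝ)..1, deriv φ x * deriv φ x := by
        rw [intervalIntegral.integral_add (by simp)
          (show IntervalIntegrable (fun t => deriv φ t * deriv φ t) volume (-1) 1 from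
            (hc.mul hc).intervalIntegrable _ _)]
        norm_num

/-! ## The lower bound for the functional -/

lemma integral_comp_cos {F : ℝ → ℝ} (hF : Continuous F) :
    ∫ θ in (0 : ℝ)..Real.pi, F (Real.cos θ) * Real.sin θ = ∫ x in (-1 : ℝ)..1, F x := by
  have h := intervalIntegral.integral_comp_mul_deriv (a := 0) (b := Real.pi) (f := Real.cos)
    (f' := fun θ => -Real.sin θ) (g := F) (fun θ _ => Real.hasDerivAt_cos θ) (by fun_prop) hF
  rw [Real.cos_zero, Real.cos_pi, intervalIntegral.integral_symm (-1 : ℝ) 1] at h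
  simp only [Function.comp_apply, mul_neg, intervalIntegral.integral_neg, neg_inj] at h
  exact h

/-- The energy density contains quotients by sin θ, and is identified with a function continuous up
to the poles only on the open interval. Limits of integrals over [η, π − η] avoid its values at the
poles. -/
lemma tendsto_integral_symm {G : ℝ → ℝ} (hG : ContinuousOn G (Icc 0 Real.pi)) :
    Tendsto (fun η => ∫ θ in η..(Real.pi - η), G θ) (𝓝[>] 0)
      (𝓝 (∫ θ in (0 : ℝ)..Real.pi, G θ)) := by
  have hpi := Real.pi_pos
  have hc := continuousOn_primitive_Icc hpi.le hG
  have h0 : Tendsto (fun x => ∫ θ in (0 : ℝ)..x, G θ) (𝓝[>] 0) (𝓝 (∫ θ in (0 : ℝ)..0, G θ)) :=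
    (hc 0 ⟨le_rfl, hpi.le⟩).mono_left
      (nhdsWithin_le_of_mem (mem_of_superset Ioo_zero_pi_mem_nhdsGT Ioo_subset_Icc_self))
  have h1 : Tendsto (fun η => ∫ θ in (0 : ℝ)..(Real.pi - η), G θ) (𝓝[>] 0)
      (𝓝 (∫ θ in (0 : ℝ)..Real.pi, G θ)) :=
    ((hc Real.pi ⟨hpi.le, le_rfl⟩).mono_left (nhdsWithin_le_of_mem
      (mem_of_superset (Ioo_mem_nhdsLT hpi) Ioo_subset_Icc_self))).comp tendsto_pi_sub_nhdsGT
  have h := h1.sub h0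
  rw [intervalIntegral.integral_same, sub_zero] at h
  refine h.congr' ?_
  filter_upwards [Ioo_zero_pi_mem_nhdsGT] with η hη
  have hi : ∀ a ∈ Icc 0 Real.pi, IntervalIntegrable G volume 0 a := fun a ha =>
    (hG.mono (by rw [uIcc_of_le ha.1]; exact Icc_subset_Icc le_rfl ha.2)).intervalIntegrable
  exact intervalIntegral.integral_interval_sub_left
    (hi _ ⟨by linarith [hη.2], by linarith [hη.1]⟩) (hi _ ⟨hη.1.le, hη.2.le⟩)

lemma c1_pos {U : ℝ → ℝ} (hU : IntervalIntegrable (fun x => Real.exp (4 * U x) * (1 - x ^ 2))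
    volume (-1) 1) : 0 < c1 U := by
  refine Real.sqrt_pos.2 ?_
  refine intervalIntegral.intervalIntegral_pos_of_pos_on hU (fun x hx => ?_) (by norm_num)
  have : 0 < 1 - x ^ 2 := by nlinarith [hx.1, hx.2]
  positivity

/-- The energy bound is applied in the variable x = cos θ, with a twist field V chosen so that the
energy is 2I and the Heisenberg gauge of the end point is at least 16. Its logarithmic term is then
nonnegative. -/
lemma one_le_functionalI_of_smooth {S T U : ℝ → ℝ} (hS : Continuous S) (hT : IsTestFunction T)
    (hU : IsTestFunction U) : 1 ≤ functionalI S T (deriv T) U (deriv U) := by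
  have cU := hU.1.continuous
  have cT := hT.1.continuous
  have cU' := hU.contDiff_deriv.continuous
  have cT' := hT.contDiff_deriv.continuous
  have dU' : ∀ θ, HasDerivAt (fun θ => U (Real.cos θ)) (deriv U (Real.cos θ) * -Real.sin θ) θ :=
    fun θ => (hU.hasDerivAt _).comp θ (Real.hasDerivAt_cos θ)
  have dT' : ∀ θ, HasDerivAt (fun θ => T (Real.cos θ)) (deriv T (Real.cos θ) * -Real.sin θ) θ :=
    fun θ => (hT.hasDerivAt _).comp θ (Real.hasDerivAt_cos θ)
  have hce : Continuous fun x => Real.exp (4 * U x) * (1 - x ^ 2) := by fun_prop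
  have hc1 : 0 < c1 U := c1_pos (hce.intervalIntegrable _ _)
  have hc1sq : c1 U ^ 2 = ∫ x in (-1 : ℝ)..1, Real.exp (4 * U x) * (1 - x ^ 2) := by
    have : 0 < √(∫ x in (-1 : ℝ)..1, Real.exp (4 * U x) * (1 - x ^ 2)) := hc1
    exact Real.sq_sqrt (Real.sqrt_pos.1 this).le
  have hM2 : 0 ≤ M2 S T U := le_max_left _ _
  -- the twist potential, with the sign of `c2`
  obtain ⟨m, hm, hmK⟩ : ∃ m : ℝ, m ^ 2 = M2 S T U ^ 2 ∧
      |m * c1 U + 2 * c2 S T| = M2 S T U * c1 U + 2 * |c2 S T| := by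
    rcases le_total 0 (c2 S T) with h | h
    · refine ⟨M2 S T U, rfl, ?_⟩
      rw [abs_of_nonneg h, abs_of_nonneg (by positivity)]
    · refine ⟨-M2 S T U, by ring, ?_⟩
      have h2 : 0 ≤ M2 S T U * c1 U := by positivity
      rw [abs_of_nonpos h, abs_of_nonpos (by linarith)]
      ring
  -- Equality case of Cauchy–Schwarz: among fields with ∫ V e^{2U}(1 − x²) dx = m c₁, this one
  -- minimizes ∫ V²(1 − x²) dx, with value m².
  set V : ℝ → ℝ := fun θ => m / c1 U * Real.exp (2 * U (Real.cos θ)) with hV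
  have hψ : ∫ θ in (0 : ℝ)..Real.pi, S (Real.cos θ) * Real.sin θ = √2 * c3 S := by
    rw [integral_comp_cos hS, c3]
    field_simp
  have hK : ∫ θ in (0 : ℝ)..Real.pi, (V θ * Real.exp (2 * U (Real.cos θ)) * Real.sin θ ^ 2
      + 2 * S (Real.cos θ) * T (Real.cos θ)) * Real.sin θ = m * c1 U + 2 * c2 S T := by
    have h1 := integral_comp_cos (F := fun x => m / c1 U * (Real.exp (4 * U x) * (1 - x ^ 2))
      + 2 * (S x * T x)) (by fun_prop)
    rw [intervalIntegral.integral_add (by exact (hce.const_mul _).intervalIntegrable _ _)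
      (by exact ((hS.mul cT).const_mul _).intervalIntegrable _ _),
      intervalIntegral.integral_const_mul, intervalIntegral.integral_const_mul, ← hc1sq] at h1
    rw [show m * c1 U + 2 * c2 S T = m / c1 U * c1 U ^ 2 + 2 * ∫ x in (-1 : ℝ)..1, S x * T x by
      rw [c2]; field_simp, ← h1]
    refine intervalIntegral.integral_congr fun θ _ => ?_
    simp only [hV]
    rw [show 4 * U (Real.cos θ) = 2 * U (Real.cos θ) + 2 * U (Real.cos θ) by ring, Real.exp_add,
      Real.sin_sq]
    ring
  set D : ℝ := (∫ x in (-1 : ℝ)..1, (deriv U x ^ 2 * (1 - x ^ 2) - 2 * x * deriv U x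
        + (S x ^ 2 + deriv T x ^ 2) * Real.exp (-2 * U x))) + M2 S T U ^ 2 with hD
  have hlim : Tendsto (fun η => ∫ θ in η..(Real.pi - η), energyDensity (fun θ => U (Real.cos θ))
      (fun θ => deriv U (Real.cos θ) * -Real.sin θ) (fun θ => deriv T (Real.cos θ) * -Real.sin θ)
      (fun θ => S (Real.cos θ)) V θ) (𝓝[>] 0) (𝓝 D) := by
    set F : ℝ → ℝ := fun x => (deriv U x ^ 2 * (1 - x ^ 2) - 2 * x * deriv U x
        + (S x ^ 2 + deriv T x ^ 2) * Real.exp (-2 * U x))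
        + (m / c1 U) ^ 2 * (Real.exp (4 * U x) * (1 - x ^ 2)) with hF
    have cF : Continuous F := by fun_prop
    have hFD : ∫ θ in (0 : ℝ)..Real.pi, F (Real.cos θ) * Real.sin θ = D := by
      rw [integral_comp_cos cF, hF, hD, intervalIntegral.integral_add
        (by apply Continuous.intervalIntegrable; fun_prop)
        (by exact (hce.const_mul _).intervalIntegrable _ _),
        intervalIntegral.integral_const_mul, ← hc1sq, ← hm, div_pow,
        div_mul_cancel₀ _ (pow_pos hc1 2).ne']
    rw [← hFD]
    refine (tendsto_integral_symm (by fun_prop)).congr' ?_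
    filter_upwards [Ioo_mem_nhdsGT (half_pos Real.pi_pos)] with η hη
    have hη1 : η ≤ Real.pi - η := by linarith [hη.2]
    refine intervalIntegral.integral_congr fun θ hθ => ?_
    rw [uIcc_of_le hη1] at hθ
    have hs : 0 < Real.sin θ :=
      Real.sin_pos_of_pos_of_lt_pi (by linarith [hη.1, hθ.1]) (by linarith [hη.1, hθ.2])
    have hc : Real.cos θ ^ 2 = 1 - Real.sin θ ^ 2 := by
      have := Real.sin_sq_add_cos_sq θ
      linarith
    simp only [hF, energyDensity, hV]
    rw [show -2 * U (Real.cos θ) = -(2 * U (Real.cos θ)) by ring, Real.exp_neg,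
      show 4 * U (Real.cos θ) = 2 * U (Real.cos θ) + 2 * U (Real.cos θ) by ring, Real.exp_add, hc]
    have he := Real.exp_pos (2 * U (Real.cos θ))
    field_simp
    ring
  -- the Heisenberg gauge of the second ideal point
  have hN : 16 ≤ (√2 * c3 S) ^ 4 + 4 * (m * c1 U + 2 * c2 S T) ^ 2 := by
    have h2 : (√2 * c3 S) ^ 4 = 4 * c3 S ^ 4 := by
      have : √2 ^ 4 = 4 := by
        rw [show √2 ^ 4 = (√2 ^ 2) ^ 2 by ring, Real.sq_sqrt (by norm_num)]
        norm_num
      rw [mul_pow, this]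
    -- M₂ is the least nonnegative number for which M₂c₁ + 2|c₂| reaches √M₁. The sign of m was
    -- chosen so that the two contributions to the twist do not cancel.
    have h3 : √(M1 S) ≤ |m * c1 U + 2 * c2 S T| := by
      rw [hmK]
      have : (√(M1 S) - 2 * |c2 S T|) / c1 U ≤ M2 S T U := le_max_right _ _
      rw [div_le_iff₀ hc1] at this
      linarith
    have h4 : M1 S ≤ (m * c1 U + 2 * c2 S T) ^ 2 := by
      have h : √(M1 S) ^ 2 = M1 S := Real.sq_sqrt (le_max_left _ _)
      rw [← h, ← sq_abs (m * c1 U + 2 * c2 S T)]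
      gcongr
    have h5 : 4 - c3 S ^ 4 ≤ M1 S := le_max_right _ _
    rw [h2]
    linarith
  have key := two_add_log_le_energy (U := fun θ => U (Real.cos θ))
    (Uθ := fun θ => deriv U (Real.cos θ) * -Real.sin θ) (T := fun θ => T (Real.cos θ))
    (Tθ := fun θ => deriv T (Real.cos θ) * -Real.sin θ) (S := fun θ => S (Real.cos θ)) (V := V)
    (τ₀ := -deriv T 1) (D := D) (fun θ _ => dU' θ) (fun θ _ => dT' θ)
    (by fun_prop) (by fun_prop) (by fun_prop) (by fun_prop)
    (by simp [hU.apply_one]) (by simp [hU.apply_neg_one]) (by simp [hT.apply_one])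
    (by simp [hT.apply_neg_one]) ?_ ?_ hlim
  · rw [hψ, hK] at key
    have : 0 ≤ Real.log (((√2 * c3 S) ^ 4 + 4 * (m * c1 U + 2 * c2 S T) ^ 2) / 16) :=
      Real.log_nonneg (by linarith)
    rw [functionalI]
    linarith
  · have h : Continuous fun θ => -deriv T (Real.cos θ) := by fun_prop
    have h' := (h.tendsto 0).mono_left (nhdsWithin_le_nhds (s := Ioi 0))
    rw [Real.cos_zero] at h'
    refine h'.congr' ?_
    filter_upwards [Ioo_zero_pi_mem_nhdsGT] with θ hθ
    have := (Real.sin_pos_of_pos_of_lt_pi hθ.1 hθ.2).ne'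
    field_simp
  · rw [hψ, hK]
    linarith

lemma exists_continuous_tendstoL2 {S : ℝ → ℝ} (hS : MemLp S 2 intervalMeasure) :
    ∃ Sn : ℕ → ℝ → ℝ, (∀ n, Continuous (Sn n)) ∧ TendstoL2 intervalMeasure Sn S := by
  have : intervalMeasure.Regular := by unfold intervalMeasure; infer_instance
  have h := fun n : ℕ => hS.exists_hasCompactSupport_eLpNorm_sub_le (by norm_num)
    (ε := ((n : ℝ≥0∞) + 1)⁻¹) (by simp)
  choose g hg using h
  refine ⟨g, fun n => (hg n).2.2.1, fun n => (hg n).2.2.2, hS, ?_⟩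
  have h1 : Tendsto (fun n : ℕ => ((n : ℝ≥0∞) + 1)⁻¹) atTop (𝓝 0) := by
    have := (tendsto_add_atTop_iff_nat 1).2 ENNReal.tendsto_inv_nat_nhds_zero
    simpa using this
  refine tendsto_of_tendsto_of_tendsto_of_le_of_le tendsto_const_nhds h1 (fun _ => zero_le) ?_
  intro n
  have := (hg n).2.1
  rw [eLpNorm_sub_comm] at this
  exact this

/-- By continuity of the functional along approximating sequences: S by continuous functions in L²,
T and U by test functions. The exponential weights converge boundedly and almost everywhere along a
subsequence. -/
theorem one_le_functionalI {S T T' U U' : ℝ → ℝ} (hS : MemLp S 2 intervalMeasure)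
    (hT : MemW012 T T') (hU : MemW012 U U') : 1 ≤ functionalI S T T' U U' := by
  obtain ⟨Sn, cSn, hSn⟩ := exists_continuous_tendstoL2 hS
  obtain ⟨Tn, tTn, hTn, hTn'⟩ := hT.approx
  obtain ⟨φ, tφ, hφ, hφ'⟩ := hU.approx
  have lT : TendstoL2 intervalMeasure Tn T :=
    ⟨fun n => memLp_intervalMeasure_of_continuous (tTn n).1.continuous, hT.memLp, hTn⟩
  have lT' : TendstoL2 intervalMeasure (fun n => deriv (Tn n)) T' :=
    ⟨fun n => memLp_intervalMeasure_of_continuous (tTn n).contDiff_deriv.continuous,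
      hT.memLp_deriv, hTn'⟩
  have lφ' : TendstoL2 intervalMeasure (fun n => deriv (φ n)) U' :=
    ⟨fun n => memLp_intervalMeasure_of_continuous (tφ n).contDiff_deriv.continuous,
      hU.memLp_deriv, hφ'⟩
  obtain ⟨ns, hns, hae⟩ := (tendstoInMeasure_of_tendsto_eLpNorm (p := 2) (by norm_num)
    (fun n => (tφ n).1.continuous.aestronglyMeasurable) hU.memLp.aestronglyMeasurable
    hφ).exists_seq_tendsto_ae
  -- pass to the subsequence
  replace lφ' := lφ'.comp hns
  replace hSn := hSn.comp hns
  replace lT := lT.comp hns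
  replace lT' := lT'.comp hns
  set Un : ℕ → ℝ → ℝ := fun n => φ (ns n) with hUn
  have tUn : ∀ n, IsTestFunction (Un n) := fun n => tφ _
  -- The Dirichlet integrals of the approximations converge, hence are bounded; the Sobolev bound
  -- makes the functions uniformly bounded, so the exponentials are too.
  obtain ⟨M, hM⟩ : ∃ M : ℝ, ∀ n, ∀ x ∈ Icc (-1 : ℝ) 1, |Un n x| ≤ M := by
    have h := (lφ'.tendsto_integral_mul lφ').bddAbove_range
    obtain ⟨C, hC⟩ := h
    refine ⟨2 + C, fun n x hx => ((tUn n).abs_le hx).trans ?_⟩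
    rw [interval_integral_eq]
    have := hC (mem_range_self n)
    linarith
  have ae_mem : ∀ᵐ x ∂intervalMeasure, x ∈ Ioo (-1 : ℝ) 1 := by
    unfold intervalMeasure
    exact ae_restrict_mem measurableSet_Ioo
  -- One statement for all weights: k = 0 and k = 4 with w = 1 − x², and k = −2 with w = 1.
  have bound : ∀ (k C : ℝ) (w : ℝ → ℝ), Continuous w → (∀ x ∈ Ioo (-1 : ℝ) 1, |w x| ≤ C) →
      ∀ {an : ℕ → ℝ → ℝ} {a : ℝ → ℝ}, TendstoL2 intervalMeasure an a →
      TendstoL2 intervalMeasure (fun n x => an n x * (Real.exp (k * Un n x) * w x))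
        (fun x => a x * (Real.exp (k * U x) * w x)) := by
    intro k C w hw hC an a ha
    refine ha.mul_bounded (M := Real.exp (|k| * M) * C) (fun n => ?_) (fun n => ?_) ?_
    · have := (tUn n).1.continuous
      exact Continuous.aestronglyMeasurable (by fun_prop)
    · filter_upwards [ae_mem] with x hx
      have h1 := hM n x (Ioo_subset_Icc_self hx)
      rw [abs_mul, Real.abs_exp]
      refine mul_le_mul (Real.exp_le_exp.2 ?_) (hC x hx) (abs_nonneg _) (Real.exp_pos _).le
      calc k * Un n x ≤ |k * Un n x| := le_abs_self _
        _ = |k| * |Un n x| := abs_mul _ _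
        _ ≤ |k| * M := by gcongr
    · filter_upwards [hae] with x hx
      exact ((Real.continuous_exp.tendsto _).comp (hx.const_mul k)).mul_const _
  have one : TendstoL2 intervalMeasure (fun _ _ => (1 : ℝ)) (fun _ => 1) :=
    TendstoL2.const (memLp_const 1)
  have hpoly : ∀ x ∈ Ioo (-1 : ℝ) 1, |1 - x ^ 2| ≤ 1 := fun x hx => by
    rw [abs_le]
    constructor <;> nlinarith [hx.1, hx.2, sq_nonneg x]
  have hone : ∀ x ∈ Ioo (-1 : ℝ) 1, |(fun _ => (1 : ℝ)) x| ≤ 1 := fun x _ => by simp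
  have lx : TendstoL2 intervalMeasure (fun _ x => -2 * x) (fun x => -2 * x) :=
    TendstoL2.const (memLp_intervalMeasure_of_continuous (by fun_prop))
  -- the convergence of the individual terms
  have lA := lφ'.tendsto_integral_mul (bound 0 1 _ (by fun_prop) hpoly lφ')
  have lB := lφ'.tendsto_integral_mul lx
  have lC := hSn.tendsto_integral_mul (bound (-2) 1 _ continuous_const hone hSn)
  have lE := lT'.tendsto_integral_mul (bound (-2) 1 _ continuous_const hone lT')
  have l1 := one.tendsto_integral_mul (bound 4 1 _ (by fun_prop) hpoly one)
  have l2 := hSn.tendsto_integral_mul lT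
  have l3 := hSn.tendsto_integral_mul one
  -- Writes the integral in `functionalI` as a sum of L² pairings, in the form in which their limits
  -- were obtained above. It serves both the approximations and the limit.
  have hfirst : ∀ {a b c u : ℝ → ℝ}, MemLp a 2 intervalMeasure → MemLp c 2 intervalMeasure →
      MemLp b 2 intervalMeasure →
      MemLp (fun x => a x * (Real.exp (0 * u x) * (1 - x ^ 2))) 2 intervalMeasure →
      MemLp (fun x => b x * (Real.exp (-2 * u x) * 1)) 2 intervalMeasure →
      MemLp (fun x => c x * (Real.exp (-2 * u x) * 1)) 2 intervalMeasure →
      ∫ x in (-1 : ℝ)..1, (a x ^ 2 * (1 - x ^ 2) - 2 * x * a x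
        + (b x ^ 2 + c x ^ 2) * Real.exp (-2 * u x))
      = (∫ x, a x * (a x * (Real.exp (0 * u x) * (1 - x ^ 2))) ∂intervalMeasure)
        + (∫ x, a x * (-2 * x) ∂intervalMeasure)
        + ((∫ x, b x * (b x * (Real.exp (-2 * u x) * 1)) ∂intervalMeasure)
        + ∫ x, c x * (c x * (Real.exp (-2 * u x) * 1)) ∂intervalMeasure) := by
    intro a b c u ha hc hb h1 h2 h3
    have i1 := TendstoL2.integrable_mul ha h1
    have i2 := TendstoL2.integrable_mul ha lx.memLp
    have i3 := TendstoL2.integrable_mul hb h2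
    have i4 := TendstoL2.integrable_mul hc h3
    rw [interval_integral_eq, ← integral_add i1 i2, ← integral_add i3 i4]
    refine Eq.trans ?_ (integral_add (i1.add i2) (i3.add i4))
    refine integral_congr_ae (Eventually.of_forall fun x => ?_)
    simp only [zero_mul, Real.exp_zero]
    ring
  have lim1 : Tendsto (fun n => ∫ x in (-1 : ℝ)..1, (deriv (Un n) x ^ 2 * (1 - x ^ 2)
      - 2 * x * deriv (Un n) x
      + (Sn (ns n) x ^ 2 + deriv (Tn (ns n)) x ^ 2) * Real.exp (-2 * Un n x))) atTop
      (𝓝 (∫ x in (-1 : ℝ)..1, (U' x ^ 2 * (1 - x ^ 2) - 2 * x * U' x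
        + (S x ^ 2 + T' x ^ 2) * Real.exp (-2 * U x)))) := by
    rw [hfirst lφ'.memLp lT'.memLp hSn.memLp (bound 0 1 _ (by fun_prop) hpoly lφ').memLp
      (bound (-2) 1 _ continuous_const hone hSn).memLp
      (bound (-2) 1 _ continuous_const hone lT').memLp]
    refine ((lA.add lB).add (lC.add lE)).congr fun n => ?_
    exact (hfirst (lφ'.memLp_seq n) (lT'.memLp_seq n) (hSn.memLp_seq n)
      ((bound 0 1 _ (by fun_prop) hpoly lφ').memLp_seq n)
      ((bound (-2) 1 _ continuous_const hone hSn).memLp_seq n)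
      ((bound (-2) 1 _ continuous_const hone lT').memLp_seq n)).symm
  have limc1 : Tendsto (fun n => c1 (Un n)) atTop (𝓝 (c1 U)) := by
    simp only [c1, interval_integral_eq]
    simp only [one_mul] at l1
    exact (Real.continuous_sqrt.tendsto _).comp l1
  have limc2 : Tendsto (fun n => c2 (Sn (ns n)) (Tn (ns n))) atTop (𝓝 (c2 S T)) := by
    simpa only [c2, interval_integral_eq] using l2
  have limc3 : Tendsto (fun n => c3 (Sn (ns n))) atTop (𝓝 (c3 S)) := by
    simp only [c3, interval_integral_eq]
    simp only [mul_one] at l3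
    exact l3.const_mul _
  have hc1 : c1 U ≠ 0 := by
    refine (c1_pos ?_).ne'
    have := TendstoL2.integrable_mul one.memLp (bound 4 1 _ (by fun_prop) hpoly one).memLp
    simp only [one_mul] at this
    rw [intervalIntegrable_iff_integrableOn_Ioo_of_le (by norm_num)]
    exact this
  have limM1 : Tendsto (fun n => M1 (Sn (ns n))) atTop (𝓝 (M1 S)) :=
    tendsto_const_nhds.max (tendsto_const_nhds.sub (limc3.pow 4))
  have limM2 : Tendsto (fun n => M2 (Sn (ns n)) (Tn (ns n)) (Un n)) atTop (𝓝 (M2 S T U)) :=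
    tendsto_const_nhds.max (((((Real.continuous_sqrt.tendsto _).comp limM1)).sub
      (limc2.abs.const_mul 2)).div limc1 hc1)
  have lim : Tendsto (fun n => functionalI (Sn (ns n)) (Tn (ns n)) (deriv (Tn (ns n))) (Un n)
      (deriv (Un n))) atTop (𝓝 (functionalI S T T' U U')) :=
    (lim1.const_mul _).add ((limM2.pow 2).div_const 2)
  exact ge_of_tendsto' lim fun n => one_le_functionalI_of_smooth (cSn _) (tTn _) (tUn n)

/-! ## Calculus of partial derivatives -/

section PartialDerivatives

variable {f : ℝ → ℝ → ℝ} {O : Set (ℝ × ℝ)}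

lemma hasDerivAt_along (hf : ContDiffOn ℝ ∞ (fun p : ℝ × ℝ => f p.1 p.2) O) (hO : IsOpen O)
    {a b : ℝ → ℝ} {a' b' s : ℝ} (hab : (a s, b s) ∈ O) (ha : HasDerivAt a a' s)
    (hb : HasDerivAt b b' s) :
    HasDerivAt (fun s => f (a s) (b s)) (a' * dR f (a s) (b s) + b' * dθ f (a s) (b s)) s := by
  have hd : DifferentiableAt ℝ (fun p : ℝ × ℝ => f p.1 p.2) (a s, b s) :=
    (hf.contDiffAt (hO.mem_nhds hab)).differentiableAt (by simp)
  have hF := hd.hasFDerivAt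
  set L := fderiv ℝ (fun p : ℝ × ℝ => f p.1 p.2) (a s, b s) with hL
  have h1 : dR f (a s) (b s) = L (1, 0) := by
    have : HasDerivAt (fun r => f r (b s)) (L (1, 0)) (a s) :=
      hF.comp_hasDerivAt (a s) (f := fun r => (r, b s))
        ((hasDerivAt_id _).prodMk (hasDerivAt_const _ _))
    exact this.deriv
  have h2 : dθ f (a s) (b s) = L (0, 1) := by
    have : HasDerivAt (fun t => f (a s) t) (L (0, 1)) (b s) :=
      hF.comp_hasDerivAt (b s) (f := fun t => (a s, t))
        ((hasDerivAt_const _ _).prodMk (hasDerivAt_id _))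
    exact this.deriv
  have h : HasDerivAt (fun s => f (a s) (b s)) (L (a', b')) s :=
    hF.comp_hasDerivAt s (f := fun s => (a s, b s)) (ha.prodMk hb)
  refine h.congr_deriv ?_
  have e : ((a', b') : ℝ × ℝ) = a' • (1, 0) + b' • (0, 1) := by simp
  rw [e, map_add, map_smul, map_smul, h1, h2, smul_eq_mul, smul_eq_mul]

lemma hasDerivAt_dR (hf : ContDiffOn ℝ ∞ (fun p : ℝ × ℝ => f p.1 p.2) O) (hO : IsOpen O)
    {R θ : ℝ} (h : (R, θ) ∈ O) : HasDerivAt (fun r => f r θ) (dR f R θ) R := by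
  simpa using hasDerivAt_along hf hO (a := id) (b := fun _ => θ) h (hasDerivAt_id R)
    (hasDerivAt_const R θ)

lemma hasDerivAt_dθ (hf : ContDiffOn ℝ ∞ (fun p : ℝ × ℝ => f p.1 p.2) O) (hO : IsOpen O)
    {R θ : ℝ} (h : (R, θ) ∈ O) : HasDerivAt (fun t => f R t) (dθ f R θ) θ := by
  simpa using hasDerivAt_along hf hO (a := fun _ => R) (b := id) h (hasDerivAt_const θ R)
    (hasDerivAt_id θ)

lemma contDiffOn_partial (hf : ContDiffOn ℝ ∞ (fun p : ℝ × ℝ => f p.1 p.2) O) (hO : IsOpen O)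
    (v : ℝ × ℝ) : ContDiffOn ℝ ∞ (fun p => fderiv ℝ (fun p : ℝ × ℝ => f p.1 p.2) p v) O :=
  (hf.fderiv_of_isOpen hO (by simp)).clm_apply contDiffOn_const

lemma contDiffOn_dR (hf : ContDiffOn ℝ ∞ (fun p : ℝ × ℝ => f p.1 p.2) O) (hO : IsOpen O) :
    ContDiffOn ℝ ∞ (fun p : ℝ × ℝ => dR f p.1 p.2) O := by
  refine (contDiffOn_partial hf hO (1, 0)).congr fun p hp => ?_
  have hd : DifferentiableAt ℝ (fun p : ℝ × ℝ => f p.1 p.2) p :=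
    (hf.contDiffAt (hO.mem_nhds hp)).differentiableAt (by simp)
  have : HasDerivAt (fun r => f r p.2) (fderiv ℝ (fun p : ℝ × ℝ => f p.1 p.2) p (1, 0)) p.1 :=
    hd.hasFDerivAt.comp_hasDerivAt p.1 (f := fun r => (r, p.2))
      ((hasDerivAt_id _).prodMk (hasDerivAt_const _ _))
  exact this.deriv

lemma contDiffOn_dθ (hf : ContDiffOn ℝ ∞ (fun p : ℝ × ℝ => f p.1 p.2) O) (hO : IsOpen O) :
    ContDiffOn ℝ ∞ (fun p : ℝ × ℝ => dθ f p.1 p.2) O := by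
  refine (contDiffOn_partial hf hO (0, 1)).congr fun p hp => ?_
  have hd : DifferentiableAt ℝ (fun p : ℝ × ℝ => f p.1 p.2) p :=
    (hf.contDiffAt (hO.mem_nhds hp)).differentiableAt (by simp)
  have : HasDerivAt (fun t => f p.1 t) (fderiv ℝ (fun p : ℝ × ℝ => f p.1 p.2) p (0, 1)) p.2 :=
    hd.hasFDerivAt.comp_hasDerivAt p.2 (f := fun t => (p.1, t))
      ((hasDerivAt_const _ _).prodMk (hasDerivAt_id _))
  exact this.deriv

lemma continuousAt_slice_fst (hf : ContDiffOn ℝ ∞ (fun p : ℝ × ℝ => f p.1 p.2) O) (hO : IsOpen O)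
    {R θ : ℝ} (h : (R, θ) ∈ O) : ContinuousAt (fun r => f r θ) R :=
  (hasDerivAt_dR hf hO h).continuousAt

lemma continuousAt_slice_snd (hf : ContDiffOn ℝ ∞ (fun p : ℝ × ℝ => f p.1 p.2) O) (hO : IsOpen O)
    {R θ : ℝ} (h : (R, θ) ∈ O) : ContinuousAt (fun t => f R t) θ :=
  (hasDerivAt_dθ hf hO h).continuousAt

end PartialDerivatives

namespace HorizonData

/-! ## The field equations on the horizon -/

variable {B : HorizonData}

/-- The radial derivative of `rh log (μ u) / 2` on the horizon, whose mean is positive for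
sub-extremal black holes. -/
noncomputable def horizonRate (B : HorizonData) (θ : ℝ) : ℝ :=
  B.rh * (dR B.μt B.rh θ + dR B.ut B.rh θ)

/-- The vicinity of the horizon. -/
def vicinity (B : HorizonData) : Set (ℝ × ℝ) := Ioo (B.rh - B.δ) (B.rh + B.δ) ×ˢ univ

/-- The part of the vicinity of the horizon on which `u` and `μ` are positive. -/
def posVicinity (B : HorizonData) : Set (ℝ × ℝ) :=
  {p | p ∈ B.vicinity ∧ 0 < B.u p.1 p.2 ∧ 0 < B.μ p.1 p.2}

lemma isOpen_vicinity : IsOpen B.vicinity := isOpen_Ioo.prod isOpen_univ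

lemma IsBlackHole.isOpen_posVicinity (hB : B.IsBlackHole) : IsOpen B.posVicinity := by
  have h1 := hB.smooth_u.continuousOn.isOpen_inter_preimage isOpen_vicinity (isOpen_Ioi (a := 0))
  have h2 := hB.smooth_μ.continuousOn.isOpen_inter_preimage isOpen_vicinity (isOpen_Ioi (a := 0))
  have h := h1.inter h2
  have e : B.posVicinity = B.vicinity ∩ (fun p : ℝ × ℝ => B.u p.1 p.2) ⁻¹' Ioi 0
      ∩ (B.vicinity ∩ (fun p : ℝ × ℝ => B.μ p.1 p.2) ⁻¹' Ioi 0) := by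
    ext p
    constructor
    · rintro ⟨a, b, c⟩
      exact ⟨⟨a, b⟩, a, c⟩
    · rintro ⟨⟨a, b⟩, -, c⟩
      exact ⟨a, b, c⟩
  rw [e]
  exact h

end HorizonData

namespace HorizonData

variable {B : HorizonData}

lemma posVicinity_subset : B.posVicinity ⊆ B.vicinity := fun _ h => h.1

lemma mem_vicinity {R θ : ℝ} (hR : R ∈ Ioo (B.rh - B.δ) (B.rh + B.δ)) : (R, θ) ∈ B.vicinity :=
  ⟨hR, mem_univ _⟩

namespace IsBlackHole

lemma rh_mem (hB : B.IsBlackHole) : B.rh ∈ Ioo (B.rh - B.δ) (B.rh + B.δ) :=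
  ⟨by linarith [hB.δ_pos], by linarith [hB.δ_pos]⟩

lemma mem_posVicinity (hB : B.IsBlackHole) {R θ : ℝ} (hR : R ∈ Ioo (B.rh - B.δ) (B.rh + B.δ))
    (hθ : θ ∈ Icc 0 Real.pi) : (R, θ) ∈ B.posVicinity :=
  ⟨mem_vicinity hR, hB.u_pos R hR θ hθ, hB.μ_pos R hR θ hθ⟩

lemma eventually_gt (hB : B.IsBlackHole) : ∀ᶠ R in 𝓝[>] B.rh, R ∈ Ioo B.rh (B.rh + B.δ) :=
  Ioo_mem_nhdsGT (by linarith [hB.δ_pos])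

lemma uN_pos (hB : B.IsBlackHole) : 0 < B.uN :=
  hB.u_pos _ hB.rh_mem _ ⟨le_rfl, Real.pi_pos.le⟩

lemma κ_pos (hB : B.IsBlackHole) : 0 < B.κ := by
  have h0 : (0 : ℝ) ∈ Icc 0 Real.pi := ⟨le_rfl, Real.pi_pos.le⟩
  rw [← hB.horizon_κ 0 h0]
  have h1 := hB.u_pos _ hB.rh_mem _ h0
  have h2 := hB.μ_pos _ hB.rh_mem _ h0
  have h3 := hB.rh_pos
  positivity

lemma uN_eq (hB : B.IsBlackHole) : B.uN = 2 * (B.rh / B.κ) := by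
  rw [uN, hB.north_u]
  ring

lemma sqrt_μ_mul_u (hB : B.IsBlackHole) {θ : ℝ} (hθ : θ ∈ Icc 0 Real.pi) :
    √(B.μ B.rh θ * B.u B.rh θ) = B.uN := by
  have h1 := hB.u_pos _ hB.rh_mem _ hθ
  have h2 := hB.μ_pos _ hB.rh_mem _ hθ
  have h4 := hB.κ_pos
  have h5 : 0 < √(B.μ B.rh θ * B.u B.rh θ) := by positivity
  have h := hB.horizon_κ θ hθ
  rw [div_eq_iff h5.ne'] at h
  rw [uN, hB.north_u, h]
  field_simp

lemma μ_mul_u (hB : B.IsBlackHole) {θ : ℝ} (hθ : θ ∈ Icc 0 Real.pi) :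
    B.μ B.rh θ * B.u B.rh θ = B.uN ^ 2 := by
  have h1 := hB.u_pos _ hB.rh_mem _ hθ
  have h2 := hB.μ_pos _ hB.rh_mem _ hθ
  rw [← hB.sqrt_μ_mul_u hθ, Real.sq_sqrt (by positivity)]

/-- Constancy of the surface gravity makes √(μu) equal to `uN` on the whole horizon, so the area
element is that of a round sphere. -/
lemma area_eq (hB : B.IsBlackHole) : B.A = 4 * Real.pi * B.uN := by
  have : ∫ θ in (0 : ℝ)..Real.pi, √(B.μ B.rh θ * B.u B.rh θ) * Real.sin θ
      = ∫ θ in (0 : ℝ)..Real.pi, B.uN * Real.sin θ := by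
    refine intervalIntegral.integral_congr fun θ hθ => ?_
    rw [uIcc_of_le Real.pi_pos.le] at hθ
    simp only [hB.sqrt_μ_mul_u hθ]
  rw [A, this, intervalIntegral.integral_const_mul, integral_sin]
  norm_num
  ring

lemma smooth_ut (hB : B.IsBlackHole) :
    ContDiffOn ℝ ∞ (fun p : ℝ × ℝ => B.ut p.1 p.2) B.posVicinity := by
  have h : ContDiffOn ℝ ∞ (fun p : ℝ × ℝ => B.u p.1 p.2) B.posVicinity :=
    hB.smooth_u.mono posVicinity_subset
  exact contDiffOn_const.mul ((h.div_const _).log fun p hp => (div_pos hp.2.1 hB.uN_pos).ne')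

lemma smooth_μt (hB : B.IsBlackHole) :
    ContDiffOn ℝ ∞ (fun p : ℝ × ℝ => B.μt p.1 p.2) B.posVicinity := by
  have h : ContDiffOn ℝ ∞ (fun p : ℝ × ℝ => B.μ p.1 p.2) B.posVicinity :=
    hB.smooth_μ.mono posVicinity_subset
  exact contDiffOn_const.mul ((h.div_const _).log fun p hp => (div_pos hp.2.2 hB.uN_pos).ne')

lemma smooth_ER (hB : B.IsBlackHole) : B.SmoothNear B.ER :=
  (contDiffOn_dR hB.smooth_Φ isOpen_vicinity).sub
    (hB.smooth_A.mul (contDiffOn_dR hB.smooth_Ω isOpen_vicinity))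

lemma smooth_Eθ (hB : B.IsBlackHole) : B.SmoothNear B.Eθ :=
  (contDiffOn_dθ hB.smooth_Φ isOpen_vicinity).sub
    (hB.smooth_A.mul (contDiffOn_dθ hB.smooth_Ω isOpen_vicinity))

lemma exp_ut (hB : B.IsBlackHole) {θ : ℝ} (hθ : θ ∈ Icc 0 Real.pi) :
    Real.exp (2 * B.ut B.rh θ) = B.u B.rh θ / B.uN := by
  have h1 := hB.u_pos _ hB.rh_mem _ hθ
  rw [ut, ← mul_assoc, show (2 : ℝ) * (1 / 2) = 1 by norm_num, one_mul,
    Real.exp_log (div_pos h1 hB.uN_pos)]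

lemma ut_zero (hB : B.IsBlackHole) : B.ut B.rh 0 = 0 := by
  have h : B.u B.rh 0 = B.uN := rfl
  rw [ut, h, div_self hB.uN_pos.ne', Real.log_one, mul_zero]

lemma ut_pi (hB : B.IsBlackHole) : B.ut B.rh Real.pi = 0 := by
  have h : B.u B.rh Real.pi = B.uN := by rw [uN, hB.south_u, hB.north_u]
  rw [ut, h, div_self hB.uN_pos.ne', Real.log_one, mul_zero]

lemma tendsto_right (_hB : B.IsBlackHole) {f : ℝ → ℝ → ℝ} {O : Set (ℝ × ℝ)}
    (hf : ContDiffOn ℝ ∞ (fun p : ℝ × ℝ => f p.1 p.2) O) (hO : IsOpen O) {θ : ℝ}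
    (h : (B.rh, θ) ∈ O) : Tendsto (fun R => f R θ) (𝓝[>] B.rh) (𝓝 (f B.rh θ)) :=
  (continuousAt_slice_fst hf hO h).tendsto.mono_left nhdsWithin_le_nhds

/-- A function that vanishes on the horizon, squared and divided by `R² - rh²`, still vanishes. -/
lemma tendsto_sq_div (hB : B.IsBlackHole) {f : ℝ → ℝ → ℝ} (hf : B.SmoothNear f) {θ : ℝ}
    (h0 : f B.rh θ = 0) :
    Tendsto (fun R => f R θ ^ 2 / (R ^ 2 - B.rh ^ 2)) (𝓝[>] B.rh) (𝓝 0) := by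
  have hm := mem_vicinity (θ := θ) hB.rh_mem
  have h1 : Tendsto (slope (fun r => f r θ) B.rh) (𝓝[>] B.rh) (𝓝 (dR f B.rh θ)) :=
    (hasDerivAt_dR hf isOpen_vicinity hm).tendsto_slope.mono_left
      (nhdsWithin_mono _ (fun x (hx : B.rh < x) => hx.ne'))
  have h2 := hB.tendsto_right hf isOpen_vicinity hm
  have h3 : Tendsto (fun R => R + B.rh) (𝓝[>] B.rh) (𝓝 (B.rh + B.rh)) :=
    ((continuous_add_const B.rh).tendsto _).mono_left nhdsWithin_le_nhds
  have h4 := (h1.mul h2).div h3 (by linarith [hB.rh_pos] : (0 : ℝ) < B.rh + B.rh).ne'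
  rw [h0, mul_zero, zero_div] at h4
  refine h4.congr' ?_
  filter_upwards [hB.eventually_gt] with R hR
  have h5 : R - B.rh ≠ 0 := by linarith [hR.1] |> fun h : 0 < R - B.rh => h.ne'
  have h6 : R + B.rh ≠ 0 := (by linarith [hR.1, hB.rh_pos] : (0 : ℝ) < R + B.rh).ne'
  simp only [Pi.div_apply, slope_def_field, h0, sub_zero]
  rw [show R ^ 2 - B.rh ^ 2 = (R - B.rh) * (R + B.rh) by ring]
  field_simp

lemma dθ_eq_zero {f : ℝ → ℝ → ℝ} {R c θ : ℝ} (h : ∀ t ∈ Icc 0 Real.pi, f R t = c)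
    (hθ : θ ∈ Ioo 0 Real.pi) : dθ f R θ = 0 := by
  have : (fun t => f R t) =ᶠ[𝓝 θ] fun _ => c := by
    filter_upwards [Icc_mem_nhds hθ.1 hθ.2] with t ht using h t ht
  rw [dθ, this.deriv_eq, deriv_const]

lemma dθ_Ω (hB : B.IsBlackHole) {θ : ℝ} (hθ : θ ∈ Ioo 0 Real.pi) : dθ B.Ω B.rh θ = 0 :=
  dθ_eq_zero hB.horizon_Ω hθ

lemma Eθ_eq_zero (hB : B.IsBlackHole) {θ : ℝ} (hθ : θ ∈ Ioo 0 Real.pi) : B.Eθ B.rh θ = 0 := by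
  rw [Eθ, hB.dθ_Ω hθ, dθ_eq_zero hB.horizon_Φ hθ]
  ring

lemma μt_eq (hB : B.IsBlackHole) {θ : ℝ} (hθ : θ ∈ Icc 0 Real.pi) :
    B.μt B.rh θ = -B.ut B.rh θ := by
  have h1 := hB.u_pos _ hB.rh_mem _ hθ
  have h2 := hB.μ_pos _ hB.rh_mem _ hθ
  have h3 := hB.uN_pos
  have h4 := Real.log_mul (div_pos h2 h3).ne' (div_pos h1 h3).ne'
  have h5 : B.μ B.rh θ / B.uN * (B.u B.rh θ / B.uN) = 1 := by
    rw [div_mul_div_comm, hB.μ_mul_u hθ]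
    field_simp
  rw [h5, Real.log_one] at h4
  rw [μt, ut]
  linarith

lemma dθ_dθ_μt (hB : B.IsBlackHole) {θ : ℝ} (hθ : θ ∈ Ioo 0 Real.pi) :
    dθ (dθ B.μt) B.rh θ = -dθ (dθ B.ut) B.rh θ := by
  have h1 : ∀ t ∈ Ioo 0 Real.pi, dθ B.μt B.rh t = -dθ B.ut B.rh t := fun t ht => by
    have : (fun t => B.μt B.rh t) =ᶠ[𝓝 t] fun t => -B.ut B.rh t := by
      filter_upwards [Icc_mem_nhds ht.1 ht.2] with s hs using hB.μt_eq hs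
    rw [dθ, this.deriv_eq, deriv.fun_neg, dθ]
  have : (fun t => dθ B.μt B.rh t) =ᶠ[𝓝 θ] fun t => -dθ B.ut B.rh t := by
    filter_upwards [Ioo_mem_nhds hθ.1 hθ.2] with s hs using h1 s hs
  rw [dθ, this.deriv_eq, deriv.fun_neg, dθ]

/-- The field equations, in the limit at the horizon. -/
lemma horizonRate_eq (hB : B.IsBlackHole) {θ : ℝ} (hθ : θ ∈ Ioo 0 Real.pi) :
    B.horizonRate θ = 1 - B.u B.rh θ ^ 2 / 16 * Real.sin θ ^ 2 * dR B.Ω B.rh θ ^ 2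
      - dθ B.ut B.rh θ ^ 2 - 2 * Real.cot θ * dθ B.ut B.rh θ
      - dθ B.Aφ B.rh θ ^ 2 / (B.u B.rh θ * Real.sin θ ^ 2)
      - B.u B.rh θ * B.ER B.rh θ ^ 2 / 4 := by
  have hθ' := Ioo_subset_Icc_self hθ
  have hm := mem_vicinity (θ := θ) hB.rh_mem
  have hp := hB.mem_posVicinity hB.rh_mem hθ'
  have oV : IsOpen B.vicinity := isOpen_vicinity
  have oP := hB.isOpen_posVicinity
  have hu0 := hB.u_pos _ hB.rh_mem _ hθ'
  have hs0 := Real.sin_pos_of_pos_of_lt_pi hθ.1 hθ.2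
  have lR : Tendsto (fun R : ℝ => R) (𝓝[>] B.rh) (𝓝 B.rh) := nhdsWithin_le_nhds
  have lf : Tendsto (fun R : ℝ => R ^ 2 - B.rh ^ 2) (𝓝[>] B.rh) (𝓝 0) := by
    have := (lR.pow 2).sub_const (B.rh ^ 2)
    rwa [sub_self] at this
  have su := contDiffOn_dR hB.smooth_ut oP
  have sμ := contDiffOn_dR hB.smooth_μt oP
  have tu := contDiffOn_dθ hB.smooth_ut oP
  have tμ := contDiffOn_dθ hB.smooth_μt oP
  have luR := hB.tendsto_right su oP hp
  have luRR := hB.tendsto_right (contDiffOn_dR su oP) oP hp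
  have luθ := hB.tendsto_right tu oP hp
  have luθθ := hB.tendsto_right (contDiffOn_dθ tu oP) oP hp
  have lμR := hB.tendsto_right sμ oP hp
  have lμRR := hB.tendsto_right (contDiffOn_dR sμ oP) oP hp
  have lμθθ := hB.tendsto_right (contDiffOn_dθ tμ oP) oP hp
  have lu := hB.tendsto_right hB.smooth_u oV hm
  have lΩR := hB.tendsto_right (contDiffOn_dR hB.smooth_Ω oV) oV hm
  have lAR := hB.tendsto_right (contDiffOn_dR hB.smooth_A oV) oV hm
  have lAθ := hB.tendsto_right (contDiffOn_dθ hB.smooth_A oV) oV hm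
  have lE := hB.tendsto_right hB.smooth_ER oV hm
  have lΩθ := hB.tendsto_sq_div (contDiffOn_dθ hB.smooth_Ω oV) (hB.dθ_Ω hθ)
  have lEθ := hB.tendsto_sq_div hB.smooth_Eθ (hB.Eθ_eq_zero hθ)
  -- At the horizon every term carrying the factor R² − rₕ² drops out. The terms divided by that
  -- factor vanish as well, because Ω_θ and the tangential electric field are zero there.
  have e1 := tendsto_nhds_unique_of_eventuallyEq
    (((((lf.mul luRR).add ((lR.const_mul 2).mul luR)).add luθθ).add (luθ.const_mul (Real.cot θ))))
    (((tendsto_const_nhds (x := (1 : ℝ))).sub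
      ((((lu.pow 2).div_const 8).mul_const (Real.sin θ ^ 2)).mul ((lΩR.pow 2).add lΩθ))).sub
      (((tendsto_const_nhds (x := (1 : ℝ))).div (lu.mul_const (Real.sin θ ^ 2))
        (by positivity)).mul ((lf.mul (lAR.pow 2)).add (lAθ.pow 2)))
      |>.sub ((lu.div_const 4).mul ((lE.pow 2).add lEθ)))
    (by
      filter_upwards [hB.eventually_gt] with R hR
      exact (hB.field_eq R hR θ hθ).eq_u)
  have e2 := tendsto_nhds_unique_of_eventuallyEq
    (((lf.mul lμRR).add (lR.mul lμR)).add lμθθ)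
    ((((((lu.pow 2).div_const 16).mul_const (Real.sin θ ^ 2)).mul ((lΩR.pow 2).add lΩθ)).sub
      (lf.mul (luR.pow 2))).add (lR.mul luR) |>.sub
      (luθ.mul (luθ.add_const (Real.cot θ))))
    (by
      filter_upwards [hB.eventually_gt] with R hR
      exact (hB.field_eq R hR θ hθ).eq_μ)
  -- On the horizon `μt` = −`ut`, so the second θ-derivatives cancel in the sum of the two
  -- equations. The surviving radial derivatives are exactly `horizonRate`.
  rw [hB.dθ_dθ_μt hθ] at e2
  have e3 : 1 / (B.u B.rh θ * Real.sin θ ^ 2) * (0 * dR B.Aφ B.rh θ ^ 2 + dθ B.Aφ B.rh θ ^ 2)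
      = dθ B.Aφ B.rh θ ^ 2 / (B.u B.rh θ * Real.sin θ ^ 2) := by
    field_simp
    ring
  rw [e3] at e1
  rw [horizonRate]
  linear_combination e1 + e2

/-! ### Regularity of the magnetic potential on the axis -/

lemma dR_A_zero (hB : B.IsBlackHole) {R : ℝ} (hR : R ∈ Ioo B.rh (B.rh + B.δ)) :
    dR B.Aφ R 0 = 0 := by
  have : (fun r => B.Aφ r 0) =ᶠ[𝓝 R] fun _ => 0 := by
    filter_upwards [Ioo_mem_nhds hR.1 hR.2] with r hr using hB.axis_north r ⟨hr.1.le, hr.2⟩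
  rw [dR, this.deriv_eq, deriv_const]

/-- The field equations force the magnetic potential to be regular on the axis. -/
lemma dθ_A_zero (hB : B.IsBlackHole) : dθ B.Aφ B.rh 0 = 0 := by
  have oV : IsOpen B.vicinity := isOpen_vicinity
  have oP := hB.isOpen_posVicinity
  have key : ∀ R ∈ Ioo B.rh (B.rh + B.δ), dθ B.Aφ R 0 = 0 := by
    intro R hR
    have hR' : R ∈ Ioo (B.rh - B.δ) (B.rh + B.δ) := ⟨by linarith [hR.1, hB.δ_pos], hR.2⟩
    have hm := mem_vicinity (B := B) (θ := 0) hR'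
    have hp := hB.mem_posVicinity hR' (θ := 0) ⟨le_rfl, Real.pi_pos.le⟩
    have lim : ∀ {f : ℝ → ℝ → ℝ} {O : Set (ℝ × ℝ)},
        ContDiffOn ℝ ∞ (fun p : ℝ × ℝ => f p.1 p.2) O → IsOpen O → (R, (0 : ℝ)) ∈ O →
        Tendsto (fun θ => f R θ) (𝓝[>] 0) (𝓝 (f R 0)) := fun hf hO h =>
      (continuousAt_slice_snd hf hO h).tendsto.mono_left nhdsWithin_le_nhds
    have su := contDiffOn_dR hB.smooth_ut oP
    have tu := contDiffOn_dθ hB.smooth_ut oP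
    have luR := lim su oP hp
    have luRR := lim (contDiffOn_dR su oP) oP hp
    have luθ := lim tu oP hp
    have luθθ := lim (contDiffOn_dθ tu oP) oP hp
    have lu := lim hB.smooth_u oV hm
    have lΩR := lim (contDiffOn_dR hB.smooth_Ω oV) oV hm
    have lΩθ := lim (contDiffOn_dθ hB.smooth_Ω oV) oV hm
    have lAR := lim (contDiffOn_dR hB.smooth_A oV) oV hm
    have lAθ := lim (contDiffOn_dθ hB.smooth_A oV) oV hm
    have lE := lim hB.smooth_ER oV hm
    have lEθ := lim hB.smooth_Eθ oV hm
    have ls : Tendsto Real.sin (𝓝[>] 0) (𝓝 0) := by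
      simpa using (Real.continuous_sin.tendsto 0).mono_left (nhdsWithin_le_nhds (s := Ioi 0))
    have lc : Tendsto Real.cos (𝓝[>] 0) (𝓝 1) := by
      simpa using (Real.continuous_cos.tendsto 0).mono_left (nhdsWithin_le_nhds (s := Ioi 0))
    rw [hB.dR_A_zero hR] at lAR
    -- The equation for u multiplied by u sin²θ and solved for A_θ². As θ tends to 0 the right side
    -- tends to 0, since A_R vanishes on the axis.
    have l1 := ((lu.mul (ls.pow 2)).mul ((((tendsto_const_nhds (x := (1 : ℝ))).sub
      ((((lu.pow 2).div_const 8).mul (ls.pow 2)).mul ((lΩR.pow 2).add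
        ((lΩθ.pow 2).div_const (R ^ 2 - B.rh ^ 2))))).sub
      ((lu.div_const 4).mul ((lE.pow 2).add ((lEθ.pow 2).div_const (R ^ 2 - B.rh ^ 2))))).sub
      (((luRR.const_mul (R ^ 2 - B.rh ^ 2)).add (luR.const_mul (2 * R))).add luθθ))).sub
      ((lu.mul (ls.mul lc)).mul luθ) |>.sub ((lAR.pow 2).const_mul (R ^ 2 - B.rh ^ 2))
    have l2 := tendsto_nhds_unique_of_eventuallyEq (lAθ.pow 2) l1 (by
      filter_upwards [Ioo_zero_pi_mem_nhdsGT] with θ hθ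
      have h := (hB.field_eq R hR θ hθ).eq_u
      have hu := hB.u_pos R hR' θ (Ioo_subset_Icc_self hθ)
      have hs := Real.sin_pos_of_pos_of_lt_pi hθ.1 hθ.2
      have e : 1 / (B.u R θ * Real.sin θ ^ 2)
            * ((R ^ 2 - B.rh ^ 2) * dR B.Aφ R θ ^ 2 + dθ B.Aφ R θ ^ 2)
          = 1 - B.u R θ ^ 2 / 8 * Real.sin θ ^ 2
            * (dR B.Ω R θ ^ 2 + dθ B.Ω R θ ^ 2 / (R ^ 2 - B.rh ^ 2))
          - B.u R θ / 4 * (B.ER R θ ^ 2 + B.Eθ R θ ^ 2 / (R ^ 2 - B.rh ^ 2))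
          - ((R ^ 2 - B.rh ^ 2) * dR (dR B.ut) R θ + 2 * R * dR B.ut R θ + dθ (dθ B.ut) R θ)
          - Real.cot θ * dθ B.ut R θ := by linarith
      have hcot : Real.cot θ * Real.sin θ = Real.cos θ := by
        rw [Real.cot_eq_cos_div_sin, div_mul_cancel₀ _ hs.ne']
      rw [one_div, inv_mul_eq_div, div_eq_iff (by positivity)] at e
      linear_combination e - B.u R θ * Real.sin θ * dθ B.ut R θ * hcot)
    have l3 : dθ B.Aφ R 0 ^ 2 = 0 := by
      rw [l2]
      ring
    exact pow_eq_zero_iff (two_ne_zero) |>.1 l3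
  have h1 := hB.tendsto_right (contDiffOn_dθ hB.smooth_A oV) oV (mem_vicinity (θ := 0) hB.rh_mem)
  refine tendsto_nhds_unique_of_eventuallyEq h1 tendsto_const_nhds ?_
  filter_upwards [hB.eventually_gt] with R hR using key R hR

/-! ### The inequality between angular momentum, charge and area -/

lemma continuousOn_horizonRate (hB : B.IsBlackHole) :
    ContinuousOn B.horizonRate (Icc 0 Real.pi) := by
  intro θ hθ
  have oP := hB.isOpen_posVicinity
  have hp := hB.mem_posVicinity hB.rh_mem hθ
  have h1 := continuousAt_slice_snd (contDiffOn_dR hB.smooth_ut oP) oP hp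
  have h2 := continuousAt_slice_snd (contDiffOn_dR hB.smooth_μt oP) oP hp
  exact (continuousAt_const.mul (h2.add h1)).continuousWithinAt

/-- A black hole with positive mean horizon rate satisfies the universal inequality. -/
theorem pJ_sq_add_pQ_sq_lt_one (hB : B.IsBlackHole)
    (hpos : 0 < ∫ θ in (0 : ℝ)..Real.pi, B.horizonRate θ * Real.sin θ) :
    B.pJ ^ 2 + B.pQ ^ 2 < 1 := by
  have hpi := Real.pi_pos
  have oV : IsOpen B.vicinity := isOpen_vicinity
  have oP := hB.isOpen_posVicinity
  have huN := hB.uN_pos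
  have hsq : 0 < √B.uN := Real.sqrt_pos.2 huN
  have hsq2 : √B.uN ^ 2 = B.uN := Real.sq_sqrt huN.le
  have cu : Continuous fun θ => B.u B.rh θ := continuous_iff_continuousAt.2 fun θ =>
    continuousAt_slice_snd hB.smooth_u oV (mem_vicinity hB.rh_mem)
  have cE : Continuous fun θ => B.ER B.rh θ := continuous_iff_continuousAt.2 fun θ =>
    continuousAt_slice_snd hB.smooth_ER oV (mem_vicinity hB.rh_mem)
  have cΩ : Continuous fun θ => dR B.Ω B.rh θ := continuous_iff_continuousAt.2 fun θ =>
    continuousAt_slice_snd (contDiffOn_dR hB.smooth_Ω oV) oV (mem_vicinity hB.rh_mem)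
  have cA : Continuous fun θ => B.Aφ B.rh θ := continuous_iff_continuousAt.2 fun θ =>
    continuousAt_slice_snd hB.smooth_A oV (mem_vicinity hB.rh_mem)
  have cAθ : Continuous fun θ => dθ B.Aφ B.rh θ := continuous_iff_continuousAt.2 fun θ =>
    continuousAt_slice_snd (contDiffOn_dθ hB.smooth_A oV) oV (mem_vicinity hB.rh_mem)
  have cuθ : ContinuousOn (fun θ => dθ B.ut B.rh θ) (Icc 0 Real.pi) := fun θ hθ =>
    (continuousAt_slice_snd (contDiffOn_dθ hB.smooth_ut oP) oP
      (hB.mem_posVicinity hB.rh_mem hθ)).continuousWithinAt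
  -- With T = A_φ/√`uN`, these scalings turn the field terms of `horizonRate_eq` into those of
  -- `energyDensity`. The end point of the curve becomes ψ(π) = −2Q/√`uN` and K(π) = 4J/`uN`.
  set S : ℝ → ℝ := fun θ => B.u B.rh θ * B.ER B.rh θ / (2 * √B.uN) with hS
  set V : ℝ → ℝ := fun θ => -(B.u B.rh θ * dR B.Ω B.rh θ / 4) with hV
  have hψ : ∫ θ in (0 : ℝ)..Real.pi, S θ * Real.sin θ = -2 * B.Q / √B.uN := by
    have e : ∀ θ, S θ * Real.sin θ
        = (2 * √B.uN)⁻¹ * (B.u B.rh θ * B.ER B.rh θ * Real.sin θ) := fun θ => by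
      simp only [hS]
      field_simp
    simp only [e]
    rw [intervalIntegral.integral_const_mul, Q]
    field_simp
    ring
  have hK : ∫ θ in (0 : ℝ)..Real.pi, (V θ * Real.exp (2 * B.ut B.rh θ) * Real.sin θ ^ 2
      + 2 * S θ * (B.Aφ B.rh θ / √B.uN)) * Real.sin θ = 4 * B.J / B.uN := by
    have e : ∫ θ in (0 : ℝ)..Real.pi, (V θ * Real.exp (2 * B.ut B.rh θ) * Real.sin θ ^ 2
        + 2 * S θ * (B.Aφ B.rh θ / √B.uN)) * Real.sin θ
        = ∫ θ in (0 : ℝ)..Real.pi, -(B.uN)⁻¹ * (B.u B.rh θ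
          * (B.u B.rh θ / 4 * dR B.Ω B.rh θ * Real.sin θ ^ 2 - B.Aφ B.rh θ * B.ER B.rh θ)
          * Real.sin θ) := by
      refine intervalIntegral.integral_congr fun θ hθ => ?_
      rw [uIcc_of_le hpi.le] at hθ
      simp only [hS, hV]
      rw [hB.exp_ut hθ]
      have : 2 * (B.u B.rh θ * B.ER B.rh θ / (2 * √B.uN)) * (B.Aφ B.rh θ / √B.uN)
          = B.u B.rh θ * B.ER B.rh θ * B.Aφ B.rh θ / √B.uN ^ 2 := by
        field_simp
      rw [this, hsq2]
      field_simp
      ring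
    rw [e, intervalIntegral.integral_const_mul, J]
    field_simp
  have hsum : B.pJ ^ 2 + B.pQ ^ 2
      = ((-2 * B.Q / √B.uN) ^ 4 + 4 * (4 * B.J / B.uN) ^ 2) / 16 := by
    have e : (-2 * B.Q / √B.uN) ^ 4 = 16 * B.Q ^ 4 / B.uN ^ 2 := by
      rw [div_pow, show √B.uN ^ 4 = (√B.uN ^ 2) ^ 2 by ring, hsq2]
      ring
    rw [e, pJ, pQ, hB.area_eq]
    field_simp
    ring
  -- Assuming pJ² + pQ² ≥ 1 also provides the positive gauge required by the energy bound, so the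
  -- case J = Q = 0 needs no separate treatment.
  by_contra hcon
  rw [not_lt] at hcon
  have hD : Tendsto (fun η => ∫ θ in η..(Real.pi - η), energyDensity (fun θ => B.ut B.rh θ)
      (fun θ => dθ B.ut B.rh θ) (fun θ => dθ B.Aφ B.rh θ / √B.uN) S V θ) (𝓝[>] 0)
      (𝓝 (∫ θ in (0 : ℝ)..Real.pi, (Real.sin θ - B.horizonRate θ * Real.sin θ))) := by
    have hc := hB.continuousOn_horizonRate
    refine (tendsto_integral_symm (by fun_prop)).congr' ?_
    filter_upwards [Ioo_mem_nhdsGT (half_pos hpi)] with η hη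
    have hη1 : η ≤ Real.pi - η := by linarith [hη.2]
    refine intervalIntegral.integral_congr fun θ hθ => ?_
    rw [uIcc_of_le hη1] at hθ
    have hθ' : θ ∈ Ioo 0 Real.pi := ⟨by linarith [hη.1, hθ.1], by linarith [hη.1, hθ.2]⟩
    have hs : 0 < Real.sin θ := Real.sin_pos_of_pos_of_lt_pi hθ'.1 hθ'.2
    have hu := hB.u_pos _ hB.rh_mem _ (Ioo_subset_Icc_self hθ')
    simp only [hS, hV, energyDensity]
    rw [hB.horizonRate_eq hθ', hB.exp_ut (Ioo_subset_Icc_self hθ'), Real.cot_eq_cos_div_sin,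
      div_pow _ (2 * √B.uN), mul_pow 2 √B.uN, div_pow (dθ B.Aφ B.rh θ), hsq2]
    field_simp
    ring
  have key := two_add_log_le_energy (U := fun θ => B.ut B.rh θ) (Uθ := fun θ => dθ B.ut B.rh θ)
    (T := fun θ => B.Aφ B.rh θ / √B.uN) (Tθ := fun θ => dθ B.Aφ B.rh θ / √B.uN) (S := S) (V := V)
    (τ₀ := dθ (dθ B.Aφ) B.rh 0 / √B.uN)
    (fun θ hθ => hasDerivAt_dθ hB.smooth_ut oP (hB.mem_posVicinity hB.rh_mem hθ))
    (fun θ hθ => (hasDerivAt_dθ hB.smooth_A oV (mem_vicinity hB.rh_mem)).div_const _)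
    cuθ (by fun_prop) (by fun_prop) (by fun_prop) hB.ut_zero hB.ut_pi
    (by simp [hB.axis_north B.rh ⟨le_rfl, by linarith [hB.δ_pos]⟩])
    (by simp [hB.axis_south B.rh ⟨le_rfl, by linarith [hB.δ_pos]⟩]) ?_ ?_ hD
  · rw [hψ, hK, ← hsum] at key
    have h1 := Real.log_nonneg hcon
    rw [intervalIntegral.integral_sub (Real.continuous_sin.intervalIntegrable _ _)
      (by
        have hc := hB.continuousOn_horizonRate
        refine ContinuousOn.intervalIntegrable ?_
        rw [uIcc_of_le hpi.le]
        fun_prop), integral_sin] at key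
    norm_num at key
    linarith
  -- A_θ/sin θ has a limit at the pole as a quotient of two difference quotients, because A_θ
  -- vanishes on the axis.
  · have h := ((hasDerivAt_dθ (contDiffOn_dθ hB.smooth_A oV) oV
      (mem_vicinity (θ := 0) hB.rh_mem)).tendsto_slope.mono_left
      (nhdsWithin_mono _ (fun x (hx : 0 < x) => hx.ne')))
    have h2 := (Real.hasDerivAt_sin 0).tendsto_slope.mono_left
      (nhdsWithin_mono _ (fun x (hx : 0 < x) => hx.ne'))
    have h3 := (h.div h2 (by simp)).div_const √B.uN
    rw [Real.cos_zero, div_one] at h3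
    refine h3.congr' ?_
    filter_upwards [Ioo_zero_pi_mem_nhdsGT] with θ hθ
    have hs := Real.sin_pos_of_pos_of_lt_pi hθ.1 hθ.2
    have hθ0 := hθ.1
    simp only [Pi.div_apply, slope_def_field, hB.dθ_A_zero, Real.sin_zero, sub_zero]
    field_simp
  · rw [hψ, hK]
    have : 0 < B.pJ ^ 2 + B.pQ ^ 2 := by linarith
    rw [hsum] at this
    linarith

end IsBlackHole

end HorizonData

/-! ## The metric in horizon-penetrating coordinates -/

/-- The coefficients of a metric of the form
`P dR² + μ dθ² + 2 β dv dR - q dv² + ν (dχ - ζ dv + ρ dR)²`. -/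
structure MetricCoeffs where
  P : ℝ
  μ : ℝ
  β : ℝ
  q : ℝ
  ν : ℝ
  ζ : ℝ
  ρ : ℝ

namespace MetricCoeffs

/-- The twist form `dχ - ζ dv + ρ dR`. -/
def twist (c : MetricCoeffs) (X : Fin 4 → ℝ) : ℝ := X 3 - c.ζ * X 0 + c.ρ * X 1

/-- The metric as a bilinear form. -/
def form (c : MetricCoeffs) (X Y : Fin 4 → ℝ) : ℝ :=
  c.P * X 1 * Y 1 + c.μ * X 2 * Y 2 + c.β * (X 0 * Y 1 + X 1 * Y 0) - c.q * X 0 * Y 0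
    + c.ν * c.twist X * c.twist Y

/-- The derivative of the twist form. -/
def twistDeriv (c c' : MetricCoeffs) (X X' : Fin 4 → ℝ) : ℝ :=
  X' 3 - c'.ζ * X 0 - c.ζ * X' 0 + c'.ρ * X 1 + c.ρ * X' 1

/-- The derivative of the bilinear form. -/
def formDeriv (c c' : MetricCoeffs) (X X' Y Y' : Fin 4 → ℝ) : ℝ :=
  c'.P * X 1 * Y 1 + c.P * (X' 1 * Y 1 + X 1 * Y' 1)
    + c'.μ * X 2 * Y 2 + c.μ * (X' 2 * Y 2 + X 2 * Y' 2)
    + c'.β * (X 0 * Y 1 + X 1 * Y 0) + c.β * (X' 0 * Y 1 + X 0 * Y' 1 + X' 1 * Y 0 + X 1 * Y' 0)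
    - c'.q * X 0 * Y 0 - c.q * (X' 0 * Y 0 + X 0 * Y' 0)
    + c'.ν * c.twist X * c.twist Y
    + c.ν * (c.twistDeriv c' X X' * c.twist Y + c.twist X * c.twistDeriv c' Y Y')

lemma hasDerivAt_form {c : ℝ → MetricCoeffs} {c' : MetricCoeffs} {X Y : ℝ → Fin 4 → ℝ}
    {X' Y' : Fin 4 → ℝ} {s : ℝ}
    (hP : HasDerivAt (fun s => (c s).P) c'.P s) (hμ : HasDerivAt (fun s => (c s).μ) c'.μ s)
    (hβ : HasDerivAt (fun s => (c s).β) c'.β s) (hq : HasDerivAt (fun s => (c s).q) c'.q s)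
    (hν : HasDerivAt (fun s => (c s).ν) c'.ν s) (hζ : HasDerivAt (fun s => (c s).ζ) c'.ζ s)
    (hρ : HasDerivAt (fun s => (c s).ρ) c'.ρ s)
    (hX : ∀ i, HasDerivAt (fun s => X s i) (X' i) s)
    (hY : ∀ i, HasDerivAt (fun s => Y s i) (Y' i) s) :
    HasDerivAt (fun s => (c s).form (X s) (Y s)) ((c s).formDeriv c' (X s) X' (Y s) Y') s := by
  have t : ∀ {Z : ℝ → Fin 4 → ℝ} {Z' : Fin 4 → ℝ}, (∀ i, HasDerivAt (fun s => Z s i) (Z' i) s) →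
      HasDerivAt (fun s => (c s).twist (Z s)) ((c s).twistDeriv c' (Z s) Z') s := by
    intro Z Z' hZ
    refine (((hZ 3).sub (hζ.mul (hZ 0))).add (hρ.mul (hZ 1))).congr_deriv ?_
    simp only [twistDeriv]
    ring
  refine ((((((hP.mul (hX 1)).mul (hY 1)).add ((hμ.mul (hX 2)).mul (hY 2))).add
    (hβ.mul (((hX 0).mul (hY 1)).add ((hX 1).mul (hY 0))))).sub ((hq.mul (hX 0)).mul (hY 0))).add
    ((hν.mul (t hX)).mul (t hY))).congr_deriv ?_
  simp only [formDeriv, Pi.mul_apply, Pi.add_apply]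
  ring

section Limits

/-- The coefficients, along a curve that approaches the horizon as `ε` tends to `0`. -/
structure Approach (c : ℝ → MetricCoeffs) (P₀ μ₀ β₀ q₁ ν₀ ζ₁ ρ₀ : ℝ) : Prop where
  P : Tendsto (fun ε => (c ε).P) (𝓝[>] 0) (𝓝 P₀)
  μ : Tendsto (fun ε => (c ε).μ) (𝓝[>] 0) (𝓝 μ₀)
  β : Tendsto (fun ε => (c ε).β) (𝓝[>] 0) (𝓝 β₀)
  q : Tendsto (fun ε => (c ε).q / ε) (𝓝[>] 0) (𝓝 q₁)
  ν : Tendsto (fun ε => (c ε).ν) (𝓝[>] 0) (𝓝 ν₀)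
  ζ : Tendsto (fun ε => (c ε).ζ / ε) (𝓝[>] 0) (𝓝 ζ₁)
  ρ : Tendsto (fun ε => (c ε).ρ) (𝓝[>] 0) (𝓝 ρ₀)

/-- The derivatives of the coefficients along vectors that become tangential to the horizon as `ε`
tends to `0`. -/
structure ApproachDeriv (c' : ℝ → MetricCoeffs) (μ₁ β₁ q₁ ν₁ ζ₁ : ℝ) : Prop where
  P : Tendsto (fun ε => (c' ε).P) (𝓝[>] 0) (𝓝 0)
  μ : Tendsto (fun ε => (c' ε).μ / ε) (𝓝[>] 0) (𝓝 μ₁)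
  β : Tendsto (fun ε => (c' ε).β / ε) (𝓝[>] 0) (𝓝 β₁)
  q : Tendsto (fun ε => (c' ε).q / ε) (𝓝[>] 0) (𝓝 q₁)
  ν : Tendsto (fun ε => (c' ε).ν / ε) (𝓝[>] 0) (𝓝 ν₁)
  ζ : Tendsto (fun ε => (c' ε).ζ / ε) (𝓝[>] 0) (𝓝 ζ₁)
  ρ : Tendsto (fun ε => (c' ε).ρ) (𝓝[>] 0) (𝓝 0)

lemma tendsto_zero_of_div {f : ℝ → ℝ} {d : ℝ}
    (hf : Tendsto (fun ε => f ε / ε) (𝓝[>] 0) (𝓝 d)) : Tendsto f (𝓝[>] 0) (𝓝 0) := by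
  have h : Tendsto (fun ε : ℝ => ε) (𝓝[>] 0) (𝓝 0) := nhdsWithin_le_nhds
  have h2 := hf.mul h
  rw [mul_zero] at h2
  refine h2.congr' ?_
  filter_upwards [self_mem_nhdsWithin] with ε hε
  exact div_mul_cancel₀ _ (ne_of_gt hε)

variable {c c' : ℝ → MetricCoeffs} {P₀ μ₀ β₀ q₁ ν₀ ζ₁ ρ₀ μ₁ β₁ q₂ ν₁ ζ₂ : ℝ}

/-- The vectors `X ε` are constant up to a first-order radial component. -/
structure Tangential (X : ℝ → Fin 4 → ℝ) (X₀ x₁ X₂ X₃ : ℝ) : Prop where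
  v : ∀ ε, X ε 0 = X₀
  R : Tendsto (fun ε => X ε 1 / ε) (𝓝[>] 0) (𝓝 x₁)
  θ : ∀ ε, X ε 2 = X₂
  χ : ∀ ε, X ε 3 = X₃

/-- The vectors `X ε` are of first order, with vanishing `v` component. -/
structure FirstOrder (X : ℝ → Fin 4 → ℝ) (x₁ x₂ x₃ : ℝ) : Prop where
  v : ∀ᶠ ε in 𝓝[>] 0, X ε 0 = 0
  R : Tendsto (fun ε => X ε 1 / ε) (𝓝[>] 0) (𝓝 x₁)
  θ : Tendsto (fun ε => X ε 2 / ε) (𝓝[>] 0) (𝓝 x₂)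
  χ : Tendsto (fun ε => X ε 3 / ε) (𝓝[>] 0) (𝓝 x₃)

variable {X Y L X' Y' : ℝ → Fin 4 → ℝ} {X₀ x₁ X₂ X₃ Y₀ y₁ Y₂ Y₃ r a b x₁' x₂' x₃' y₁' y₂' y₃' : ℝ}

lemma Approach.tendsto_twist (hc : Approach c P₀ μ₀ β₀ q₁ ν₀ ζ₁ ρ₀)
    (hX : Tangential X X₀ x₁ X₂ X₃) :
    Tendsto (fun ε => (c ε).twist (X ε)) (𝓝[>] 0) (𝓝 X₃) := by
  have h := ((tendsto_const_nhds (x := X₃)).sub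
    ((tendsto_zero_of_div hc.ζ).mul_const X₀)).add (hc.ρ.mul (tendsto_zero_of_div hX.R))
  have e : X₃ - 0 * X₀ + ρ₀ * 0 = X₃ := by ring
  rw [e] at h
  refine h.congr fun ε => ?_
  simp only [twist, hX.v, hX.χ]

lemma Approach.tendsto_form (hc : Approach c P₀ μ₀ β₀ q₁ ν₀ ζ₁ ρ₀)
    (hX : Tangential X X₀ x₁ X₂ X₃) (hY : Tangential Y Y₀ y₁ Y₂ Y₃) :
    Tendsto (fun ε => (c ε).form (X ε) (Y ε)) (𝓝[>] 0) (𝓝 (μ₀ * X₂ * Y₂ + ν₀ * X₃ * Y₃)) := by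
  have x := tendsto_zero_of_div hX.R
  have y := tendsto_zero_of_div hY.R
  have h := (((((hc.P.mul x).mul y).add ((hc.μ.mul_const X₂).mul_const Y₂)).add
    (hc.β.mul ((y.const_mul X₀).add (x.mul_const Y₀)))).sub
    (((tendsto_zero_of_div hc.q).mul_const X₀).mul_const Y₀)).add
    ((hc.ν.mul (hc.tendsto_twist hX)).mul (hc.tendsto_twist hY))
  have e : P₀ * 0 * 0 + μ₀ * X₂ * Y₂ + β₀ * (X₀ * 0 + 0 * Y₀) - 0 * X₀ * Y₀ + ν₀ * X₃ * Y₃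
      = μ₀ * X₂ * Y₂ + ν₀ * X₃ * Y₃ := by ring
  rw [e] at h
  refine h.congr fun ε => ?_
  simp only [form, hX.v, hX.θ, hY.v, hY.θ]

/-- The displacement `L ε` agrees with `∂_v` up to terms of first order. -/
structure NearGenerator (L : ℝ → Fin 4 → ℝ) (r a b : ℝ) : Prop where
  v : ∀ᶠ ε in 𝓝[>] 0, L ε 0 = 1
  R : Tendsto (fun ε => L ε 1 / ε) (𝓝[>] 0) (𝓝 r)
  θ : Tendsto (fun ε => L ε 2 / ε) (𝓝[>] 0) (𝓝 a)
  χ : Tendsto (fun ε => L ε 3 / ε) (𝓝[>] 0) (𝓝 b)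

lemma Approach.tendsto_twist_div (hc : Approach c P₀ μ₀ β₀ q₁ ν₀ ζ₁ ρ₀)
    (hL : NearGenerator L r a b) :
    Tendsto (fun ε => (c ε).twist (L ε) / ε) (𝓝[>] 0) (𝓝 (b - ζ₁ + ρ₀ * r)) := by
  refine ((hL.χ.sub hc.ζ).add (hc.ρ.mul hL.R)).congr' ?_
  filter_upwards [hL.v] with ε hε
  simp only [twist, hε]
  ring

/-- All components of L except the v-component are of order ε, so their mutual products are of order
ε². At order ε only the dv dR cross term and −q dv² remain. -/
lemma Approach.tendsto_form_self_div (hc : Approach c P₀ μ₀ β₀ q₁ ν₀ ζ₁ ρ₀)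
    (hL : NearGenerator L r a b) :
    Tendsto (fun ε => (c ε).form (L ε) (L ε) / ε) (𝓝[>] 0) (𝓝 (2 * β₀ * r - q₁)) := by
  have t := hc.tendsto_twist_div hL
  have h := (((((hc.P.mul hL.R).mul (tendsto_zero_of_div hL.R)).add
    ((hc.μ.mul hL.θ).mul (tendsto_zero_of_div hL.θ))).add
    ((hc.β.const_mul 2).mul hL.R)).sub hc.q).add ((hc.ν.mul t).mul (tendsto_zero_of_div t))
  have e : P₀ * r * 0 + μ₀ * a * 0 + 2 * β₀ * r - q₁ + ν₀ * (b - ζ₁ + ρ₀ * r) * 0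
      = 2 * β₀ * r - q₁ := by ring
  rw [e] at h
  refine h.congr' ?_
  filter_upwards [hL.v] with ε hε
  simp only [form, hε]
  ring

lemma Approach.tendsto_form_div (hc : Approach c P₀ μ₀ β₀ q₁ ν₀ ζ₁ ρ₀)
    (hL : NearGenerator L r a b) (hX : Tangential X X₀ x₁ X₂ X₃) :
    Tendsto (fun ε => (c ε).form (L ε) (X ε) / ε) (𝓝[>] 0)
      (𝓝 (μ₀ * a * X₂ + β₀ * (x₁ + r * X₀) - q₁ * X₀ + ν₀ * (b - ζ₁ + ρ₀ * r) * X₃)) := by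
  have t := hc.tendsto_twist_div hL
  have h := (((((hc.P.mul hL.R).mul (tendsto_zero_of_div hX.R)).add
    ((hc.μ.mul hL.θ).mul_const X₂)).add
    (hc.β.mul (hX.R.add (hL.R.mul_const X₀)))).sub (hc.q.mul_const X₀)).add
    ((hc.ν.mul t).mul (hc.tendsto_twist hX))
  have e : P₀ * r * 0 + μ₀ * a * X₂ + β₀ * (x₁ + r * X₀) - q₁ * X₀
      + ν₀ * (b - ζ₁ + ρ₀ * r) * X₃
      = μ₀ * a * X₂ + β₀ * (x₁ + r * X₀) - q₁ * X₀ + ν₀ * (b - ζ₁ + ρ₀ * r) * X₃ := by ring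
  rw [e] at h
  refine h.congr' ?_
  filter_upwards [hL.v] with ε hε
  simp only [form, hε, hX.v, hX.θ]
  ring

lemma Approach.tendsto_twistDeriv_div (hc : Approach c P₀ μ₀ β₀ q₁ ν₀ ζ₁ ρ₀)
    (hc' : ApproachDeriv c' μ₁ β₁ q₂ ν₁ ζ₂)
    (hX : Tangential X X₀ x₁ X₂ X₃) (hX' : FirstOrder X' x₁' x₂' x₃') :
    Tendsto (fun ε => (c ε).twistDeriv (c' ε) (X ε) (X' ε) / ε) (𝓝[>] 0)
      (𝓝 (x₃' - ζ₂ * X₀ + ρ₀ * x₁')) := by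
  have h := ((hX'.χ.sub (hc'.ζ.mul_const X₀)).add (hc'.ρ.mul hX.R)).add (hc.ρ.mul hX'.R)
  have e : x₃' - ζ₂ * X₀ + 0 * x₁ + ρ₀ * x₁' = x₃' - ζ₂ * X₀ + ρ₀ * x₁' := by ring
  rw [e] at h
  refine h.congr' ?_
  filter_upwards [hX'.v] with ε hε
  simp only [twistDeriv, hε, hX.v]
  ring

/-- The derivatives of P, β and ρ do not appear in the limit: each comes with a radial component of
order ε. It is therefore enough that those of P and ρ tend to 0, while that of β need only be of
order ε. -/
lemma Approach.tendsto_formDeriv_div (hc : Approach c P₀ μ₀ β₀ q₁ ν₀ ζ₁ ρ₀)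
    (hc' : ApproachDeriv c' μ₁ β₁ q₂ ν₁ ζ₂)
    (hX : Tangential X X₀ x₁ X₂ X₃) (hY : Tangential Y Y₀ y₁ Y₂ Y₃)
    (hX' : FirstOrder X' x₁' x₂' x₃') (hY' : FirstOrder Y' y₁' y₂' y₃') :
    Tendsto (fun ε => (c ε).formDeriv (c' ε) (X ε) (X' ε) (Y ε) (Y' ε) / ε) (𝓝[>] 0)
      (𝓝 (μ₁ * X₂ * Y₂ + μ₀ * (x₂' * Y₂ + X₂ * y₂') + β₀ * (X₀ * y₁' + x₁' * Y₀) - q₂ * X₀ * Y₀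
        + ν₁ * X₃ * Y₃ + ν₀ * ((x₃' - ζ₂ * X₀ + ρ₀ * x₁') * Y₃
          + X₃ * (y₃' - ζ₂ * Y₀ + ρ₀ * y₁')))) := by
  have x := tendsto_zero_of_div hX.R
  have y := tendsto_zero_of_div hY.R
  have tX := hc.tendsto_twist hX
  have tY := hc.tendsto_twist hY
  have tX' := hc.tendsto_twistDeriv_div hc' hX hX'
  have tY' := hc.tendsto_twistDeriv_div hc' hY hY'
  have h := ((((((((hc'.P.mul hX.R).mul y).add
    (hc.P.mul ((hX'.R.mul y).add (x.mul hY'.R)))).add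
    ((hc'.μ.mul_const X₂).mul_const Y₂)).add
    (hc.μ.mul ((hX'.θ.mul_const Y₂).add (hY'.θ.const_mul X₂)))).add
    (hc'.β.mul ((y.const_mul X₀).add (x.mul_const Y₀)))).add
    (hc.β.mul ((hY'.R.const_mul X₀).add (hX'.R.mul_const Y₀)))).sub
    ((hc'.q.mul_const X₀).mul_const Y₀)).add ((hc'.ν.mul tX).mul tY) |>.add
    (hc.ν.mul ((tX'.mul tY).add (tX.mul tY')))
  have e : 0 * x₁ * 0 + P₀ * (x₁' * 0 + 0 * y₁') + μ₁ * X₂ * Y₂ + μ₀ * (x₂' * Y₂ + X₂ * y₂')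
      + β₁ * (X₀ * 0 + 0 * Y₀) + β₀ * (X₀ * y₁' + x₁' * Y₀) - q₂ * X₀ * Y₀ + ν₁ * X₃ * Y₃
      + ν₀ * ((x₃' - ζ₂ * X₀ + ρ₀ * x₁') * Y₃ + X₃ * (y₃' - ζ₂ * Y₀ + ρ₀ * y₁'))
      = μ₁ * X₂ * Y₂ + μ₀ * (x₂' * Y₂ + X₂ * y₂') + β₀ * (X₀ * y₁' + x₁' * Y₀) - q₂ * X₀ * Y₀
        + ν₁ * X₃ * Y₃ + ν₀ * ((x₃' - ζ₂ * X₀ + ρ₀ * x₁') * Y₃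
          + X₃ * (y₃' - ζ₂ * Y₀ + ρ₀ * y₁')) := by ring
  rw [e] at h
  refine h.congr' ?_
  filter_upwards [hX'.v, hY'.v] with ε h1 h2
  simp only [formDeriv, h1, h2, hX.v, hX.θ, hY.v, hY.θ]
  ring

end Limits

end MetricCoeffs

/-- The first-order expansion in terms of the logarithm of the rescaled displacement. -/
lemma first_order_expansion_eq {k u s c rh h hθ hχ hθθ hχχ τθ τχ τθθ τχχ μR uR uθ ΩR : ℝ}
    (hk : k ≠ 0) (hu : u ≠ 0) (hs : s ≠ 0) (hh : h ≠ 0) (hrh : rh ≠ 0) :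
    let κ := rh / k
    let μ := 4 * k ^ 2 / u
    let ν := u * s ^ 2
    let β := 4 * k / u
    let r := -κ * h
    let a := (hθ - κ * h * τθ) / k
    let zθ := hθ / h - κ * τθ
    let zχ := hχ / h - κ * τχ
    k / h * ((r * μR + a * (-(μ * uθ / u)) + 2 * μ * ((hθθ - κ * hθ * τθ - κ * h * τθθ) / k)
            + 2 * β * τθ * (-κ * hθ) - r * (8 * rh / u) * τθ ^ 2) / (2 * μ)
          + (2 * β * τχ * (-κ * hχ) - r * (8 * rh / u) * τχ ^ 2
            + (r * (uR * s ^ 2) + a * (uθ * s ^ 2 + u * (2 * s * c)))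
            + 2 * ν * (4 * k / (ν * u) * (hχχ - κ * hχ * τχ - κ * h * τχχ) - hχ * ΩR / 2
              - r * ΩR * τχ + k * ΩR / (2 * rh) * (-κ * hχ))) / (2 * ν))
      = (hθθ / h - hθ ^ 2 / h ^ 2 - κ * τθθ) + zθ ^ 2 + c / s * zθ
        + 4 * k ^ 2 / (u * ν) * ((hχχ / h - hχ ^ 2 / h ^ 2 - κ * τχχ) + zχ ^ 2)
        - k * ΩR * zχ - rh / 2 * (μR / μ + uR / u) := by
  intro κ μ ν β r a zθ zχ
  simp only [κ, μ, ν, β, r, a, zθ, zχ]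
  field_simp
  ring

/-! ### Metric coefficients near the horizon -/

namespace HorizonData

variable {B : HorizonData}

/-- Half the horizon value of the norm of the axial Killing vector at the poles. -/
noncomputable def k (B : HorizonData) : ℝ := B.rh / B.κ

/-- The function `R² - rh²`. -/
def horizonFun (B : HorizonData) (R : ℝ) : ℝ := R ^ 2 - B.rh ^ 2

/-- The coefficient of `dR²`, multiplied by `R² - rh²`. -/
noncomputable def Pnum (B : HorizonData) (R θ : ℝ) : ℝ := B.μ R θ - 4 * B.k ^ 2 / B.u R θ

/-- The coefficient of `dv dR`. -/
noncomputable def βcoeff (B : HorizonData) (R θ : ℝ) : ℝ := 4 * B.k / B.u R θ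

/-- The coefficient of `-dv²`. -/
noncomputable def qcoeff (B : HorizonData) (R θ : ℝ) : ℝ := 4 * B.horizonFun R / B.u R θ

/-- The norm of the axial Killing vector. -/
noncomputable def νcoeff (B : HorizonData) (R θ : ℝ) : ℝ := B.u R θ * Real.sin θ ^ 2

/-- The angular velocity relative to the horizon. -/
def ζcoeff (B : HorizonData) (R θ : ℝ) : ℝ := B.Ω R θ - B.Ωh

/-- The coefficients of the metric in horizon-penetrating coordinates. -/
noncomputable def coeffs (B : HorizonData) (R θ : ℝ) : MetricCoeffs where
  P := B.Pnum R θ / B.horizonFun R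
  μ := B.μ R θ
  β := B.βcoeff R θ
  q := B.qcoeff R θ
  ν := B.νcoeff R θ
  ζ := B.ζcoeff R θ
  ρ := B.k * (B.ζcoeff R θ / B.horizonFun R)

/-- The derivative of a function of `(R, θ)` in the direction `(r, a)`. -/
noncomputable def along (f : ℝ → ℝ → ℝ) (R θ r a : ℝ) : ℝ := r * dR f R θ + a * dθ f R θ

/-- The derivative of `f / (R² - rh²)` in the direction `(r, a)`. -/
noncomputable def quotAlong (B : HorizonData) (f : ℝ → ℝ → ℝ) (R θ r a : ℝ) : ℝ :=
  (along f R θ r a * B.horizonFun R - f R θ * (2 * R * r)) / B.horizonFun R ^ 2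

/-- The derivatives of the coefficients in the direction `(r, a)`. -/
noncomputable def coeffsAlong (B : HorizonData) (R θ r a : ℝ) : MetricCoeffs where
  P := B.quotAlong B.Pnum R θ r a
  μ := along B.μ R θ r a
  β := along B.βcoeff R θ r a
  q := along B.qcoeff R θ r a
  ν := along B.νcoeff R θ r a
  ζ := along B.ζcoeff R θ r a
  ρ := B.k * B.quotAlong B.ζcoeff R θ r a

/-- Substituting dt = dv − k dR/(R² − rₕ²) with k = rₕ/κ and collecting terms: the singular part of
dR² combines with the dt² term into P, and the rotation term contributes ρ. Off the horizon this is
plain algebra; its purpose is that P and ρ have removable singularities. -/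
lemma metric_eq_form {p : Fin 4 → ℝ} (hu : B.u (p 1) (p 2) ≠ 0) (hf : B.horizonFun (p 1) ≠ 0)
    (X Y : Fin 4 → ℝ) :
    B.metric p X Y = (B.coeffs (p 1) (p 2)).form X Y := by
  have h1 : (B.toBL (p 1) X) 0 = X 0 - B.k / B.horizonFun (p 1) * X 1 := by
    simp [toBL, k, horizonFun, div_div]
  have h2 : (B.toBL (p 1) Y) 0 = Y 0 - B.k / B.horizonFun (p 1) * Y 1 := by
    simp [toBL, k, horizonFun, div_div]
  have h3 : (B.toBL (p 1) X) 3 = X 3 + B.Ωh * (X 0 - B.k / B.horizonFun (p 1) * X 1) := by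
    simp [toBL, k, horizonFun, div_div]
  have h4 : (B.toBL (p 1) Y) 3 = Y 3 + B.Ωh * (Y 0 - B.k / B.horizonFun (p 1) * Y 1) := by
    simp [toBL, k, horizonFun, div_div]
  have h5 : ∀ Z, (B.toBL (p 1) Z) 1 = Z 1 := fun Z => by simp [toBL]
  have h6 : ∀ Z, (B.toBL (p 1) Z) 2 = Z 2 := fun Z => by simp [toBL]
  rw [metric, metricBL, h1, h2, h3, h4, h5, h5, h6, h6, MetricCoeffs.form, MetricCoeffs.twist,
    MetricCoeffs.twist, coeffs]
  change _ * (X 1 * Y 1 / B.horizonFun (p 1) + _) + _ - _ * B.horizonFun (p 1) * _ * _ = _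
  simp only [Pnum, βcoeff, qcoeff, νcoeff, ζcoeff]
  field_simp
  ring

lemma hasDerivAt_quotient {f : ℝ → ℝ → ℝ} {O : Set (ℝ × ℝ)}
    (hf : ContDiffOn ℝ ∞ (fun p : ℝ × ℝ => f p.1 p.2) O) (hO : IsOpen O) {R θ : ℝ → ℝ}
    {r a s : ℝ} (h : (R s, θ s) ∈ O) (hR : HasDerivAt R r s) (hθ : HasDerivAt θ a s)
    (h0 : B.horizonFun (R s) ≠ 0) :
    HasDerivAt (fun s => f (R s) (θ s) / B.horizonFun (R s))
      (B.quotAlong f (R s) (θ s) r a) s := by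
  have h2 : HasDerivAt (fun s => B.horizonFun (R s)) (2 * R s * r) s := by
    refine ((hR.pow 2).sub_const (B.rh ^ 2)).congr_deriv ?_
    norm_num
  exact (hasDerivAt_along hf hO h hR hθ).div h2 h0

section NearHorizon

variable {f : ℝ → ℝ → ℝ} {O : Set (ℝ × ℝ)} {θ h r a : ℝ} {lR lθ : ℝ → ℝ}

lemma tendsto_radius (x h : ℝ) : Tendsto (fun ε => x - ε * h) (𝓝[>] 0) (𝓝 x) := by
  have : Continuous fun ε : ℝ => x - ε * h := by fun_prop
  simpa using (this.tendsto 0).mono_left (nhdsWithin_le_nhds (s := Ioi 0))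

lemma tendsto_horizonFun_div (B : HorizonData) (h : ℝ) :
    Tendsto (fun ε => B.horizonFun (B.rh - ε * h) / ε) (𝓝[>] 0) (𝓝 (-(2 * B.rh * h))) := by
  have h1 := (tendsto_radius (2 * B.rh) h).const_mul (-h)
  rw [show -h * (2 * B.rh) = -(2 * B.rh * h) by ring] at h1
  refine h1.congr' ?_
  filter_upwards [self_mem_nhdsWithin] with ε hε
  have : ε ≠ 0 := ne_of_gt hε
  rw [horizonFun]
  field_simp
  ring

lemma horizonFun_ne_zero (hrh : 0 < B.rh) (hh : 0 < h) :
    ∀ᶠ ε in 𝓝[>] 0, B.horizonFun (B.rh - ε * h) ≠ 0 := by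
  have h2 : -(2 * B.rh * h) ≠ 0 := by
    have := mul_pos hrh hh
    exact (by linarith : -(2 * B.rh * h) < 0).ne
  filter_upwards [(tendsto_horizonFun_div B h).eventually_ne h2] with ε hε h0
  exact hε (by rw [h0, zero_div])

lemma tendsto_val (hf : ContDiffOn ℝ ∞ (fun p : ℝ × ℝ => f p.1 p.2) O) (hO : IsOpen O)
    (hm : (B.rh, θ) ∈ O) :
    Tendsto (fun ε => f (B.rh - ε * h) θ) (𝓝[>] 0) (𝓝 (f B.rh θ)) :=
  (continuousAt_slice_fst hf hO hm).tendsto.comp (tendsto_radius B.rh h)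

lemma tendsto_val_div (hf : ContDiffOn ℝ ∞ (fun p : ℝ × ℝ => f p.1 p.2) O) (hO : IsOpen O)
    (hm : (B.rh, θ) ∈ O) (h0 : f B.rh θ = 0) :
    Tendsto (fun ε => f (B.rh - ε * h) θ / ε) (𝓝[>] 0) (𝓝 (-h * dR f B.rh θ)) := by
  have h1 : HasDerivAt (fun ε : ℝ => B.rh - ε * h) (-h) 0 := by
    simpa using ((hasDerivAt_id (0 : ℝ)).mul_const h).const_sub B.rh
  have h2 := hasDerivAt_along hf hO (a := fun ε => B.rh - ε * h) (b := fun _ => θ) (s := 0)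
    (by simpa using hm) h1 (hasDerivAt_const _ _)
  simp only [zero_mul, sub_zero, add_zero] at h2
  have h3 := h2.tendsto_slope.mono_left
    (nhdsWithin_mono (t := {0}ᶜ) _ (fun x (hx : x ∈ Ioi (0 : ℝ)) => (mem_Ioi.1 hx).ne'))
  refine h3.congr fun ε => ?_
  simp [slope_def_field, h0]

lemma tendsto_along_div (hf : ContDiffOn ℝ ∞ (fun p : ℝ × ℝ => f p.1 p.2) O) (hO : IsOpen O)
    (hm : (B.rh, θ) ∈ O) (hr : Tendsto (fun ε => lR ε / ε) (𝓝[>] 0) (𝓝 r))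
    (ha : Tendsto (fun ε => lθ ε / ε) (𝓝[>] 0) (𝓝 a)) :
    Tendsto (fun ε => along f (B.rh - ε * h) θ (lR ε) (lθ ε) / ε) (𝓝[>] 0)
      (𝓝 (along f B.rh θ r a)) := by
  refine ((hr.mul (tendsto_val (h := h) (contDiffOn_dR hf hO) hO hm)).add
    (ha.mul (tendsto_val (h := h) (contDiffOn_dθ hf hO) hO hm))).congr fun ε => ?_
  rw [along]
  ring

lemma tendsto_quot (hrh : 0 < B.rh) (hh : 0 < h)
    (hf : ContDiffOn ℝ ∞ (fun p : ℝ × ℝ => f p.1 p.2) O) (hO : IsOpen O)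
    (hm : (B.rh, θ) ∈ O) (h0 : f B.rh θ = 0) :
    Tendsto (fun ε => f (B.rh - ε * h) θ / B.horizonFun (B.rh - ε * h)) (𝓝[>] 0)
      (𝓝 (dR f B.rh θ / (2 * B.rh))) := by
  have h2 : -(2 * B.rh * h) ≠ 0 := by
    have := mul_pos hrh hh
    exact (by linarith : -(2 * B.rh * h) < 0).ne
  have h3 := (tendsto_val_div (h := h) hf hO hm h0).div (tendsto_horizonFun_div B h) h2
  have e : -h * dR f B.rh θ / -(2 * B.rh * h) = dR f B.rh θ / (2 * B.rh) := by
    field_simp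
  rw [e] at h3
  refine h3.congr' ?_
  filter_upwards [self_mem_nhdsWithin] with ε hε
  exact div_div_div_cancel_right₀ (ne_of_gt hε) _ _

/-- The regular part of a quotient by `R² - rh²` does not change, to first order, under
displacements that are tangential to the horizon. -/
lemma tendsto_quotAlong (hrh : 0 < B.rh) (hh : 0 < h)
    (hf : ContDiffOn ℝ ∞ (fun p : ℝ × ℝ => f p.1 p.2) O) (hO : IsOpen O)
    (hm : (B.rh, θ) ∈ O) (h0 : f B.rh θ = 0) (h0' : dθ f B.rh θ = 0)
    (hr : Tendsto (fun ε => lR ε / ε) (𝓝[>] 0) (𝓝 r))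
    (ha : Tendsto (fun ε => lθ ε / ε) (𝓝[>] 0) (𝓝 a)) :
    Tendsto (fun ε => B.quotAlong f (B.rh - ε * h) θ (lR ε) (lθ ε)) (𝓝[>] 0) (𝓝 0) := by
  have h2 : -(2 * B.rh * h) ≠ 0 := by
    have := mul_pos hrh hh
    exact (by linarith : -(2 * B.rh * h) < 0).ne
  have h3 := ((tendsto_along_div (h := h) hf hO hm hr ha).sub
    ((tendsto_quot hrh hh hf hO hm h0).mul
      (((tendsto_radius B.rh h).const_mul 2).mul hr))).div (tendsto_horizonFun_div B h) h2
  have e : (along f B.rh θ r a - dR f B.rh θ / (2 * B.rh) * (2 * B.rh * r)) / -(2 * B.rh * h)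
      = 0 := by
    rw [along, h0']
    field_simp
    ring
  rw [e] at h3
  refine h3.congr' ?_
  filter_upwards [self_mem_nhdsWithin, horizonFun_ne_zero hrh hh] with ε hε hf0
  have : ε ≠ 0 := ne_of_gt hε
  simp only [Pi.div_apply, quotAlong]
  field_simp

end NearHorizon

namespace IsBlackHole

lemma k_pos (hB : B.IsBlackHole) : 0 < B.k := div_pos hB.rh_pos hB.κ_pos

lemma μ_eq (hB : B.IsBlackHole) {θ : ℝ} (hθ : θ ∈ Icc 0 Real.pi) :
    B.μ B.rh θ = 4 * B.k ^ 2 / B.u B.rh θ := by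
  have h := hB.μ_mul_u hθ
  have hu := hB.u_pos _ hB.rh_mem _ hθ
  rw [hB.uN_eq] at h
  rw [eq_div_iff hu.ne', h, k]
  ring

lemma smooth_Pnum (hB : B.IsBlackHole) :
    ContDiffOn ℝ ∞ (fun p : ℝ × ℝ => B.Pnum p.1 p.2) B.posVicinity :=
  (hB.smooth_μ.mono posVicinity_subset).sub
    (contDiffOn_const.div (hB.smooth_u.mono posVicinity_subset) fun _ hp => hp.2.1.ne')

lemma smooth_βcoeff (hB : B.IsBlackHole) :
    ContDiffOn ℝ ∞ (fun p : ℝ × ℝ => B.βcoeff p.1 p.2) B.posVicinity :=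
  contDiffOn_const.div (hB.smooth_u.mono posVicinity_subset) fun _ hp => hp.2.1.ne'

lemma smooth_qcoeff (hB : B.IsBlackHole) :
    ContDiffOn ℝ ∞ (fun p : ℝ × ℝ => B.qcoeff p.1 p.2) B.posVicinity := by
  have h : ContDiffOn ℝ ∞ (fun p : ℝ × ℝ => 4 * B.horizonFun p.1) B.posVicinity := by
    unfold horizonFun
    fun_prop
  exact h.div (hB.smooth_u.mono posVicinity_subset) fun _ hp => hp.2.1.ne'

lemma smooth_νcoeff (hB : B.IsBlackHole) :
    ContDiffOn ℝ ∞ (fun p : ℝ × ℝ => B.νcoeff p.1 p.2) B.posVicinity := by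
  have h : ContDiffOn ℝ ∞ (fun p : ℝ × ℝ => Real.sin p.2 ^ 2) B.posVicinity := by
    have : ContDiff ℝ ∞ fun p : ℝ × ℝ => Real.sin p.2 ^ 2 := by fun_prop
    exact this.contDiffOn
  exact (hB.smooth_u.mono posVicinity_subset).mul h

lemma smooth_ζcoeff (hB : B.IsBlackHole) :
    ContDiffOn ℝ ∞ (fun p : ℝ × ℝ => B.ζcoeff p.1 p.2) B.posVicinity :=
  (hB.smooth_Ω.mono posVicinity_subset).sub contDiffOn_const

section

variable {θ h r a : ℝ} {lR lθ : ℝ → ℝ}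

lemma Pnum_eq_zero (hB : B.IsBlackHole) (hθ : θ ∈ Icc 0 Real.pi) : B.Pnum B.rh θ = 0 := by
  rw [Pnum, hB.μ_eq hθ, sub_self]

lemma ζcoeff_eq_zero (hB : B.IsBlackHole) (hθ : θ ∈ Icc 0 Real.pi) : B.ζcoeff B.rh θ = 0 := by
  rw [ζcoeff, hB.horizon_Ω θ hθ, sub_self]

lemma dR_ζcoeff (B : HorizonData) (R θ : ℝ) : dR B.ζcoeff R θ = dR B.Ω R θ := by
  simp [dR, ζcoeff]

lemma dR_qcoeff (hB : B.IsBlackHole) (hθ : θ ∈ Icc 0 Real.pi) :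
    dR B.qcoeff B.rh θ = 8 * B.rh / B.u B.rh θ := by
  have hu := hB.u_pos _ hB.rh_mem _ hθ
  have h1 := hasDerivAt_dR hB.smooth_u isOpen_vicinity (mem_vicinity (θ := θ) hB.rh_mem)
  have h2 : HasDerivAt (fun R => 4 * B.horizonFun R) (4 * (2 * B.rh)) B.rh := by
    have := (((hasDerivAt_id B.rh).pow 2).sub_const (B.rh ^ 2)).const_mul 4
    refine this.congr_deriv ?_
    simp
  have h3 := h2.div h1 hu.ne'
  refine h3.deriv.trans ?_
  rw [horizonFun]
  field_simp
  ring

lemma dθ_qcoeff (B : HorizonData) (hθ : θ ∈ Ioo 0 Real.pi) : dθ B.qcoeff B.rh θ = 0 :=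
  dθ_eq_zero (c := 0) (fun t _ => by simp [qcoeff, horizonFun]) hθ

lemma qcoeff_eq_zero (B : HorizonData) (θ : ℝ) : B.qcoeff B.rh θ = 0 := by
  simp [qcoeff, horizonFun]

lemma dR_νcoeff (B : HorizonData) (R θ : ℝ) : dR B.νcoeff R θ = dR B.u R θ * Real.sin θ ^ 2 := by
  simp [dR, νcoeff]

lemma dθ_νcoeff (hB : B.IsBlackHole) :
    dθ B.νcoeff B.rh θ = dθ B.u B.rh θ * Real.sin θ ^ 2
      + B.u B.rh θ * (2 * Real.sin θ * Real.cos θ) := by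
  have h1 := hasDerivAt_dθ hB.smooth_u isOpen_vicinity (mem_vicinity (θ := θ) hB.rh_mem)
  have h3 := h1.mul ((Real.hasDerivAt_sin θ).pow 2)
  refine h3.deriv.trans ?_
  simp

/-- Differentiate μu = 4k², which holds along the whole horizon. -/
lemma dθ_μ (hB : B.IsBlackHole) (hθ : θ ∈ Ioo 0 Real.pi) :
    dθ B.μ B.rh θ = -(4 * B.k ^ 2 / B.u B.rh θ * dθ B.u B.rh θ / B.u B.rh θ) := by
  have hu := hB.u_pos _ hB.rh_mem _ (Ioo_subset_Icc_self hθ)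
  have h1 := hasDerivAt_dθ hB.smooth_u isOpen_vicinity (mem_vicinity (θ := θ) hB.rh_mem)
  have h2 : (fun t => B.μ B.rh t) =ᶠ[𝓝 θ] fun t => 4 * B.k ^ 2 / B.u B.rh t := by
    filter_upwards [Icc_mem_nhds hθ.1 hθ.2] with t ht using hB.μ_eq ht
  rw [dθ, h2.deriv_eq]
  refine ((hasDerivAt_const θ (4 * B.k ^ 2)).div h1 hu.ne').deriv.trans ?_
  field_simp
  ring

/-- P and ρ have finite limits because their numerators vanish on the horizon: μu = 4k² there, and Ω
is constant. The coefficients q and ζ vanish themselves, and their rates are recorded. -/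
lemma approach (hB : B.IsBlackHole) (hθ : θ ∈ Ioo 0 Real.pi) (hh : 0 < h) :
    MetricCoeffs.Approach (fun ε => B.coeffs (B.rh - ε * h) θ)
      (dR B.Pnum B.rh θ / (2 * B.rh)) (4 * B.k ^ 2 / B.u B.rh θ) (4 * B.k / B.u B.rh θ)
      (-h * (8 * B.rh / B.u B.rh θ)) (B.u B.rh θ * Real.sin θ ^ 2) (-h * dR B.Ω B.rh θ)
      (B.k * dR B.Ω B.rh θ / (2 * B.rh)) := by
  have hθ' := Ioo_subset_Icc_self hθ
  have hp := hB.mem_posVicinity hB.rh_mem hθ'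
  have oP := hB.isOpen_posVicinity
  refine ⟨tendsto_quot hB.rh_pos hh hB.smooth_Pnum oP hp (hB.Pnum_eq_zero hθ'), ?_,
    tendsto_val hB.smooth_βcoeff oP hp, ?_, tendsto_val hB.smooth_νcoeff oP hp, ?_, ?_⟩
  · rw [← hB.μ_eq hθ']
    exact tendsto_val hB.smooth_μ isOpen_vicinity (mem_vicinity hB.rh_mem)
  · rw [← hB.dR_qcoeff hθ']
    exact tendsto_val_div hB.smooth_qcoeff oP hp (qcoeff_eq_zero B θ)
  · rw [← dR_ζcoeff]
    exact tendsto_val_div hB.smooth_ζcoeff oP hp (hB.ζcoeff_eq_zero hθ')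
  · rw [← dR_ζcoeff, mul_div_assoc]
    exact (tendsto_quot hB.rh_pos hh hB.smooth_ζcoeff oP hp (hB.ζcoeff_eq_zero hθ')).const_mul _

/-- The direction of differentiation has radial and polar components of order ε. For q and ζ only
the radial derivative contributes, since both vanish along the horizon. For P and ρ the leading
terms of the quotient rule cancel. -/
lemma approachDeriv (hB : B.IsBlackHole) (hθ : θ ∈ Ioo 0 Real.pi) (hh : 0 < h)
    (hr : Tendsto (fun ε => lR ε / ε) (𝓝[>] 0) (𝓝 r))
    (ha : Tendsto (fun ε => lθ ε / ε) (𝓝[>] 0) (𝓝 a)) :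
    MetricCoeffs.ApproachDeriv (fun ε => B.coeffsAlong (B.rh - ε * h) θ (lR ε) (lθ ε))
      (r * dR B.μ B.rh θ + a * -(4 * B.k ^ 2 / B.u B.rh θ * dθ B.u B.rh θ / B.u B.rh θ))
      (along B.βcoeff B.rh θ r a) (r * (8 * B.rh / B.u B.rh θ))
      (r * (dR B.u B.rh θ * Real.sin θ ^ 2) + a * (dθ B.u B.rh θ * Real.sin θ ^ 2
        + B.u B.rh θ * (2 * Real.sin θ * Real.cos θ)))
      (r * dR B.Ω B.rh θ) := by
  have hθ' := Ioo_subset_Icc_self hθ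
  have hp := hB.mem_posVicinity hB.rh_mem hθ'
  have oP := hB.isOpen_posVicinity
  have zP : dθ B.Pnum B.rh θ = 0 := dθ_eq_zero (fun t ht => hB.Pnum_eq_zero ht) hθ
  have zζ : dθ B.ζcoeff B.rh θ = 0 := dθ_eq_zero (fun t ht => hB.ζcoeff_eq_zero ht) hθ
  refine ⟨tendsto_quotAlong hB.rh_pos hh hB.smooth_Pnum oP hp (hB.Pnum_eq_zero hθ') zP hr ha, ?_,
    tendsto_along_div hB.smooth_βcoeff oP hp hr ha, ?_, ?_, ?_, ?_⟩
  · rw [← hB.dθ_μ hθ]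
    exact tendsto_along_div hB.smooth_μ isOpen_vicinity (mem_vicinity hB.rh_mem) hr ha
  · have h1 := tendsto_along_div (h := h) hB.smooth_qcoeff oP hp hr ha
    rwa [along, hB.dR_qcoeff hθ', dθ_qcoeff B hθ, mul_zero, add_zero] at h1
  · have h1 := tendsto_along_div (h := h) hB.smooth_νcoeff oP hp hr ha
    rwa [along, dR_νcoeff, hB.dθ_νcoeff] at h1
  · have h1 := tendsto_along_div (h := h) hB.smooth_ζcoeff oP hp hr ha
    rwa [along, dR_ζcoeff, zζ, mul_zero, add_zero] at h1
  · have h1 := (tendsto_quotAlong hB.rh_pos hh hB.smooth_ζcoeff oP hp (hB.ζcoeff_eq_zero hθ') zζ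
      hr ha).const_mul B.k
    rwa [mul_zero] at h1

end

end IsBlackHole

end HorizonData

/-! ## First-order behaviour of families of vector fields -/

section MixedPartials

variable {ε₀ : ℝ}

/-- The parameter domain of the null normals. -/
def normalDomain (ε₀ : ℝ) : Set (ℝ × ℝ × ℝ) := Ico 0 ε₀ ×ˢ Ioo 0 Real.pi ×ˢ univ

lemma uniqueDiffOn_normalDomain : UniqueDiffOn ℝ (normalDomain ε₀) :=
  (uniqueDiffOn_Ico 0 ε₀).prod ((uniqueDiffOn_Ioo 0 Real.pi).prod uniqueDiffOn_univ)

lemma zero_mem_normalDomain (hε : 0 < ε₀) {θ χ : ℝ} (hθ : θ ∈ Ioo 0 Real.pi) :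
    ((0 : ℝ), θ, χ) ∈ normalDomain ε₀ :=
  ⟨⟨le_rfl, hε⟩, hθ, mem_univ _⟩

/-- The normals are smooth only up to the boundary ε = 0 of the domain. Symmetry of the second
derivative within the domain at such a boundary point requires it to be a limit of interior points.
-/
lemma zero_mem_closure_interior (hε : 0 < ε₀) {θ χ : ℝ} (hθ : θ ∈ Ioo 0 Real.pi) :
    ((0 : ℝ), θ, χ) ∈ closure (interior (normalDomain ε₀)) := by
  rw [normalDomain, interior_prod_eq, interior_prod_eq, interior_Ico, interior_Ioo, interior_univ,
    closure_prod_eq, closure_prod_eq, closure_Ioo hε.ne, closure_univ]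
  exact ⟨⟨le_rfl, hε.le⟩, subset_closure hθ, mem_univ _⟩

variable {E : Type*} [NormedAddCommGroup E] [NormedSpace ℝ E] {G : ℝ × ℝ × ℝ → E}

lemma tendsto_slope_normalDomain (hε : 0 < ε₀) {θ χ : ℝ} (hθ : θ ∈ Ioo 0 Real.pi)
    (hG : DifferentiableWithinAt ℝ G (normalDomain ε₀) (0, θ, χ)) :
    Tendsto (fun ε => ε⁻¹ • (G (ε, θ, χ) - G (0, θ, χ))) (𝓝[>] 0)
      (𝓝 (fderivWithin ℝ G (normalDomain ε₀) (0, θ, χ) (1, 0, 0))) := by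
  have h1 : HasDerivWithinAt (fun ε : ℝ => (ε, θ, χ)) ((1 : ℝ), (0 : ℝ), (0 : ℝ)) (Ico 0 ε₀) 0 :=
    ((hasDerivAt_id (0 : ℝ)).prodMk
      ((hasDerivAt_const (0 : ℝ) θ).prodMk (hasDerivAt_const (0 : ℝ) χ))).hasDerivWithinAt
  have h2 := hG.hasFDerivWithinAt.comp_hasDerivWithinAt (x := (0 : ℝ))
    (f := fun ε : ℝ => (ε, θ, χ)) h1 (fun ε hε => ⟨hε, hθ, mem_univ _⟩)
  rw [hasDerivWithinAt_iff_tendsto_slope] at h2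
  have h3 := h2.mono_left (nhdsWithin_le_of_mem (t := Ioi (0 : ℝ)) (by
    filter_upwards [Ioo_mem_nhdsGT hε] with ε hε
    exact ⟨⟨hε.1.le, hε.2⟩, hε.1.ne'⟩))
  refine h3.congr fun ε => ?_
  simp [slope, Function.comp]

lemma hasDerivAt_normalDomain_θ {ε θ χ : ℝ} (hε : ε ∈ Ico 0 ε₀) (hθ : θ ∈ Ioo 0 Real.pi)
    (hG : DifferentiableWithinAt ℝ G (normalDomain ε₀) (ε, θ, χ)) :
    HasDerivAt (fun s => G (ε, s, χ)) (fderivWithin ℝ G (normalDomain ε₀) (ε, θ, χ) (0, 1, 0))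
      θ := by
  have h1 : HasDerivWithinAt (fun s : ℝ => (ε, s, χ)) ((0 : ℝ), (1 : ℝ), (0 : ℝ))
      (Ioo 0 Real.pi) θ :=
    ((hasDerivAt_const θ ε).prodMk
      ((hasDerivAt_id θ).prodMk (hasDerivAt_const θ χ))).hasDerivWithinAt
  exact (hG.hasFDerivWithinAt.comp_hasDerivWithinAt (x := θ)
    (f := fun s : ℝ => (ε, s, χ)) h1 (fun s hs => ⟨hε, hs, mem_univ _⟩)).hasDerivAt
    (Ioo_mem_nhds hθ.1 hθ.2)

lemma hasDerivAt_normalDomain_χ {ε θ χ : ℝ} (hε : ε ∈ Ico 0 ε₀) (hθ : θ ∈ Ioo 0 Real.pi)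
    (hG : DifferentiableWithinAt ℝ G (normalDomain ε₀) (ε, θ, χ)) :
    HasDerivAt (fun s => G (ε, θ, s)) (fderivWithin ℝ G (normalDomain ε₀) (ε, θ, χ) (0, 0, 1))
      χ := by
  have h1 : HasDerivWithinAt (fun s : ℝ => (ε, θ, s)) ((0 : ℝ), (0 : ℝ), (1 : ℝ)) univ χ :=
    ((hasDerivAt_const χ ε).prodMk
      ((hasDerivAt_const χ θ).prodMk (hasDerivAt_id χ))).hasDerivWithinAt
  exact (hG.hasFDerivWithinAt.comp_hasDerivWithinAt (x := χ)
    (f := fun s : ℝ => (ε, θ, s)) h1 (fun s _ => ⟨hε, hθ, mem_univ _⟩)).hasDerivAt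
    Filter.univ_mem

/-- A smooth family of functions that is constant for `ε = 0` is of first order in `ε`, and so are
its partial derivatives. -/
lemma exists_first_order {φ : ℝ → ℝ → ℝ → ℝ} (hε : 0 < ε₀)
    (hφ : ContDiffOn ℝ ∞ (fun p : ℝ × ℝ × ℝ => φ p.1 p.2.1 p.2.2) (normalDomain ε₀)) {c : ℝ}
    (h0 : ∀ θ ∈ Ioo 0 Real.pi, ∀ χ, φ 0 θ χ = c) :
    ∃ ψ : ℝ → ℝ → ℝ, ∀ θ ∈ Ioo 0 Real.pi, ∀ χ,
      Tendsto (fun ε => (φ ε θ χ - c) / ε) (𝓝[>] 0) (𝓝 (ψ θ χ)) ∧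
      Tendsto (fun ε => deriv (fun s => φ ε s χ) θ / ε) (𝓝[>] 0)
        (𝓝 (deriv (fun s => ψ s χ) θ)) ∧
      Tendsto (fun ε => deriv (fun s => φ ε θ s) χ / ε) (𝓝[>] 0)
        (𝓝 (deriv (fun s => ψ θ s) χ)) := by
  set D := normalDomain ε₀ with hD
  set Φ : ℝ × ℝ × ℝ → ℝ := fun p => φ p.1 p.2.1 p.2.2 with hΦ
  set F : ℝ × ℝ × ℝ → ℝ × ℝ × ℝ →L[ℝ] ℝ := fderivWithin ℝ Φ D with hF
  have dF : DifferentiableOn ℝ F D :=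
    (hφ.fderivWithin uniqueDiffOn_normalDomain (m := 1) (by norm_cast)).differentiableOn
      one_ne_zero
  have dΦ : DifferentiableOn ℝ Φ D := hφ.differentiableOn (by simp)
  refine ⟨fun θ χ => F (0, θ, χ) (1, 0, 0), fun θ hθ χ => ?_⟩
  have hm := zero_mem_normalDomain hε (χ := χ) hθ
  have hz : (0 : ℝ) ∈ Ico 0 ε₀ := ⟨le_rfl, hε⟩
  have symm : IsSymmSndFDerivWithinAt ℝ Φ D (0, θ, χ) :=
    (hφ _ hm).isSymmSndFDerivWithinAt
      (by
        rw [minSmoothness_of_isRCLikeNormedField]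
        exact WithTop.coe_le_coe.2 (le_top : (2 : ℕ∞) ≤ ⊤))
      uniqueDiffOn_normalDomain (zero_mem_closure_interior hε hθ) hm
  -- Symmetry of the second derivative exchanges the one-sided ε-derivative with the angular one, so
  -- the first-order coefficient of the angular derivative is the angular derivative of the
  -- first-order coefficient.
  have lim : ∀ v : ℝ × ℝ × ℝ, F (0, θ, χ) v = 0 →
      Tendsto (fun ε => F (ε, θ, χ) v / ε) (𝓝[>] 0) (𝓝 (fderivWithin ℝ F D (0, θ, χ) v
        (1, 0, 0))) := by
    intro v hv
    rw [symm v (1, 0, 0)]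
    have h := tendsto_slope_normalDomain hε hθ (dF _ hm)
    have h2 := ((ContinuousLinearMap.apply ℝ ℝ v).continuous.tendsto _).comp h
    refine h2.congr fun ε => ?_
    simp [hv, div_eq_inv_mul]
  refine ⟨?_, ?_, ?_⟩
  · have h := tendsto_slope_normalDomain hε hθ (dΦ _ hm)
    refine h.congr fun ε => ?_
    simp [hΦ, h0 θ hθ χ, div_eq_inv_mul]
  · have hd : ∀ ε ∈ Ico 0 ε₀, deriv (fun s => φ ε s χ) θ = F (ε, θ, χ) (0, 1, 0) := fun ε hε =>
      (hasDerivAt_normalDomain_θ hε hθ (dΦ _ ⟨hε, hθ, mem_univ _⟩)).deriv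
    have hv : F (0, θ, χ) (0, 1, 0) = 0 := by
      rw [← hd 0 hz]
      have : (fun s => φ 0 s χ) =ᶠ[𝓝 θ] fun _ => c := by
        filter_upwards [Ioo_mem_nhds hθ.1 hθ.2] with s hs using h0 s hs χ
      rw [this.deriv_eq, deriv_const]
    have h2 := (hasDerivAt_normalDomain_θ hz hθ (dF _ hm)).clm_apply
      (hasDerivAt_const θ ((1 : ℝ), (0 : ℝ), (0 : ℝ)))
    rw [h2.deriv]
    simp only [map_zero, add_zero]
    refine (lim _ hv).congr' ?_
    filter_upwards [Ioo_mem_nhdsGT hε] with ε hε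
    rw [hd ε ⟨hε.1.le, hε.2⟩]
  · have hd : ∀ ε ∈ Ico 0 ε₀, deriv (fun s => φ ε θ s) χ = F (ε, θ, χ) (0, 0, 1) := fun ε hε =>
      (hasDerivAt_normalDomain_χ hε hθ (dΦ _ ⟨hε, hθ, mem_univ _⟩)).deriv
    have hv : F (0, θ, χ) (0, 0, 1) = 0 := by
      rw [← hd 0 hz]
      have : (fun s => φ 0 θ s) = fun _ => c := funext fun s => h0 θ hθ s
      rw [this, deriv_const]
    have h2 := (hasDerivAt_normalDomain_χ hz hθ (dF _ hm)).clm_apply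
      (hasDerivAt_const χ ((1 : ℝ), (0 : ℝ), (0 : ℝ)))
    rw [h2.deriv]
    simp only [map_zero, add_zero]
    refine (lim _ hv).congr' ?_
    filter_upwards [Ioo_mem_nhdsGT hε] with ε hε
    rw [hd ε ⟨hε.1.le, hε.2⟩]

end MixedPartials

namespace HorizonData

variable {B : HorizonData}

/-! ## Trapped surfaces near the horizon -/

/-- A function on the sphere, in terms of the angles. -/
noncomputable def onSphere (f : (Fin 3 → ℝ) → ℝ) (θ χ : ℝ) : ℝ := f (spherePoint θ χ)

lemma contDiff_spherePoint : ContDiff ℝ ∞ fun p : ℝ × ℝ => spherePoint p.1 p.2 := by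
  rw [contDiff_pi]
  intro i
  fin_cases i <;> simp [spherePoint] <;> fun_prop

lemma contDiff_onSphere {f : (Fin 3 → ℝ) → ℝ} (hf : ContDiff ℝ ∞ f) :
    ContDiffOn ℝ ∞ (fun p : ℝ × ℝ => onSphere f p.1 p.2) univ :=
  (hf.comp contDiff_spherePoint).contDiffOn

/-- The family of surfaces `v = τ`, `R = rh - ε h` is trapped to first order. -/
structure IsTrappedFamily (B : HorizonData) (τ h : (Fin 3 → ℝ) → ℝ) (ε₀ c : ℝ)
    (l : ℝ → ℝ → ℝ → Fin 4 → ℝ) : Prop where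
  smooth_τ : ContDiff ℝ ∞ τ
  smooth_h : ContDiff ℝ ∞ h
  h_pos : ∀ θ χ : ℝ, 0 < h (spherePoint θ χ)
  ε₀_pos : 0 < ε₀
  c_pos : 0 < c
  smooth_l : ContDiffOn ℝ ∞ (fun p : ℝ × ℝ × ℝ => l p.1 p.2.1 p.2.2) (normalDomain ε₀)
  l_zero : ∀ θ ∈ Ioo 0 Real.pi, ∀ χ : ℝ, l 0 θ χ = ![1, 0, 0, 0]
  l_v : ∀ ε ∈ Ioo 0 ε₀, ∀ θ ∈ Ioo 0 Real.pi, ∀ χ : ℝ, l ε θ χ 0 = 1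
  normal : ∀ ε ∈ Ioo 0 ε₀, ∀ θ ∈ Ioo 0 Real.pi, ∀ χ : ℝ,
    B.IsNullNormal (B.surface τ h ε) (l ε) θ χ
  expansion_le : ∀ ε ∈ Ioo 0 ε₀, ∀ θ ∈ Ioo 0 Real.pi, ∀ χ : ℝ,
    B.expansion (B.surface τ h ε) (l ε) θ χ ≤ -(c * ε)

lemma SubExtremal.exists_trappedFamily (hs : B.SubExtremal) :
    ∃ τ h ε₀ c l, B.IsTrappedFamily τ h ε₀ c l := by
  obtain ⟨τ, h, ε₀, c, l, h1, h2, h3, h4, h5, h6, h7, h8⟩ := hs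
  exact ⟨τ, h, ε₀, c, l, h1, h2, h3, h4, h5, h6, h7, fun ε hε θ hθ χ => (h8 ε hε θ hθ χ).1,
    fun ε hε θ hθ χ => (h8 ε hε θ hθ χ).2.1, fun ε hε θ hθ χ => (h8 ε hε θ hθ χ).2.2⟩

/-- The first tangent vector of the surface `v = τ`, `R = rh - ε h`. -/
noncomputable def surfTangent₁ (τ h : (Fin 3 → ℝ) → ℝ) (θ χ ε : ℝ) : Fin 4 → ℝ :=
  ![dR (onSphere τ) θ χ, -(ε * dR (onSphere h) θ χ), 1, 0]

/-- The second tangent vector of the surface `v = τ`, `R = rh - ε h`. -/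
noncomputable def surfTangent₂ (τ h : (Fin 3 → ℝ) → ℝ) (θ χ ε : ℝ) : Fin 4 → ℝ :=
  ![dθ (onSphere τ) θ χ, -(ε * dθ (onSphere h) θ χ), 0, 1]

section

variable {τ h : (Fin 3 → ℝ) → ℝ} {ε₀ c : ℝ} {l : ℝ → ℝ → ℝ → Fin 4 → ℝ}

/-- For functions on the sphere, `dR` and `dθ` differentiate in the first and second argument, that
is, in the polar angle and the azimuth. -/
lemma hasDerivAt_surface_θ (hτ : ContDiff ℝ ∞ τ) (hh : ContDiff ℝ ∞ h) (ε θ χ : ℝ) :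
    HasDerivAt (fun s => B.surface τ h ε s χ) (surfTangent₁ τ h θ χ ε) θ := by
  rw [hasDerivAt_pi]
  have h1 := hasDerivAt_dR (contDiff_onSphere hτ) isOpen_univ (mem_univ (θ, χ))
  have h2 := hasDerivAt_dR (contDiff_onSphere hh) isOpen_univ (mem_univ (θ, χ))
  intro i
  fin_cases i
  · exact h1
  · exact (h2.const_mul ε).const_sub B.rh
  · exact hasDerivAt_id θ
  · exact hasDerivAt_const θ χ

lemma hasDerivAt_surface_χ (hτ : ContDiff ℝ ∞ τ) (hh : ContDiff ℝ ∞ h) (ε θ χ : ℝ) :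
    HasDerivAt (fun s => B.surface τ h ε θ s) (surfTangent₂ τ h θ χ ε) χ := by
  rw [hasDerivAt_pi]
  have h1 := hasDerivAt_dθ (contDiff_onSphere hτ) isOpen_univ (mem_univ (θ, χ))
  have h2 := hasDerivAt_dθ (contDiff_onSphere hh) isOpen_univ (mem_univ (θ, χ))
  intro i
  fin_cases i
  · exact h1
  · exact (h2.const_mul ε).const_sub B.rh
  · exact hasDerivAt_const χ θ
  · exact hasDerivAt_id χ

lemma tendsto_neg_mul_div (x : ℝ) : Tendsto (fun ε : ℝ => -(ε * x) / ε) (𝓝[>] 0) (𝓝 (-x)) := by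
  refine (tendsto_const_nhds (x := -x)).congr' ?_
  filter_upwards [self_mem_nhdsWithin] with ε hε
  have : ε ≠ 0 := ne_of_gt hε
  field_simp

lemma tangential_surfTangent₁ (τ h : (Fin 3 → ℝ) → ℝ) (θ χ : ℝ) :
    MetricCoeffs.Tangential (surfTangent₁ τ h θ χ) (dR (onSphere τ) θ χ) (-dR (onSphere h) θ χ)
      1 0 :=
  ⟨fun _ => rfl, tendsto_neg_mul_div _, fun _ => rfl, fun _ => rfl⟩

lemma tangential_surfTangent₂ (τ h : (Fin 3 → ℝ) → ℝ) (θ χ : ℝ) :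
    MetricCoeffs.Tangential (surfTangent₂ τ h θ χ) (dθ (onSphere τ) θ χ) (-dθ (onSphere h) θ χ)
      0 1 :=
  ⟨fun _ => rfl, tendsto_neg_mul_div _, fun _ => rfl, fun _ => rfl⟩

end

end HorizonData

/-! ### Null normals and expansion to first order -/

namespace HorizonData

variable {B : HorizonData} {τ h : (Fin 3 → ℝ) → ℝ} {ε₀ c : ℝ} {l : ℝ → ℝ → ℝ → Fin 4 → ℝ}

/-- The parameters `ε` for which the surface at `(θ, χ)` lies in the vicinity, off the horizon. -/
lemma IsBlackHole.eventually_regular (hB : B.IsBlackHole) (hl : B.IsTrappedFamily τ h ε₀ c l)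
    (θ χ : ℝ) : ∀ᶠ ε in 𝓝[>] 0, ε ∈ Ioo 0 ε₀ ∧
      B.rh - ε * onSphere h θ χ ∈ Ioo (B.rh - B.δ) (B.rh + B.δ) ∧
      B.horizonFun (B.rh - ε * onSphere h θ χ) ≠ 0 := by
  filter_upwards [Ioo_mem_nhdsGT hl.ε₀_pos, (tendsto_radius B.rh (onSphere h θ χ)).eventually
    (Ioo_mem_nhds hB.rh_mem.1 hB.rh_mem.2), horizonFun_ne_zero hB.rh_pos (hl.h_pos θ χ)]
    with ε h1 h2 h3 using ⟨h1, h2, h3⟩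

namespace IsTrappedFamily

lemma smooth_comp (hl : B.IsTrappedFamily τ h ε₀ c l) (i : Fin 4) :
    ContDiffOn ℝ ∞ (fun p : ℝ × ℝ × ℝ => l p.1 p.2.1 p.2.2 i) (normalDomain ε₀) :=
  (contDiffOn_pi.1 hl.smooth_l) i

lemma hasDerivAt_l_θ (hl : B.IsTrappedFamily τ h ε₀ c l) {ε θ : ℝ} (hε : ε ∈ Ioo 0 ε₀)
    (hθ : θ ∈ Ioo 0 Real.pi) (χ : ℝ) :
    HasDerivAt (fun s => l ε s χ) (tangent₁ (l ε) θ χ) θ :=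
  (hasDerivAt_normalDomain_θ (χ := χ) ⟨hε.1.le, hε.2⟩ hθ
    (hl.smooth_l.differentiableOn (by simp) _
      ⟨⟨hε.1.le, hε.2⟩, hθ, mem_univ _⟩)).differentiableAt.hasDerivAt

lemma hasDerivAt_l_χ (hl : B.IsTrappedFamily τ h ε₀ c l) {ε θ : ℝ} (hε : ε ∈ Ioo 0 ε₀)
    (hθ : θ ∈ Ioo 0 Real.pi) (χ : ℝ) :
    HasDerivAt (fun s => l ε θ s) (tangent₂ (l ε) θ χ) χ :=
  (hasDerivAt_normalDomain_χ (χ := χ) ⟨hε.1.le, hε.2⟩ hθ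
    (hl.smooth_l.differentiableOn (by simp) _
      ⟨⟨hε.1.le, hε.2⟩, hθ, mem_univ _⟩)).differentiableAt.hasDerivAt

lemma tangent₁_displaced (hl : B.IsTrappedFamily τ h ε₀ c l) {ε θ : ℝ} (hε : ε ∈ Ioo 0 ε₀)
    (hθ : θ ∈ Ioo 0 Real.pi) (χ s : ℝ) :
    tangent₁ (fun a b => B.surface τ h ε a b + s • l ε a b) θ χ
      = surfTangent₁ τ h θ χ ε + s • tangent₁ (l ε) θ χ :=
  ((hasDerivAt_surface_θ hl.smooth_τ hl.smooth_h ε θ χ).add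
    ((hl.hasDerivAt_l_θ hε hθ χ).const_smul s)).deriv

lemma tangent₂_displaced (hl : B.IsTrappedFamily τ h ε₀ c l) {ε θ : ℝ} (hε : ε ∈ Ioo 0 ε₀)
    (hθ : θ ∈ Ioo 0 Real.pi) (χ s : ℝ) :
    tangent₂ (fun a b => B.surface τ h ε a b + s • l ε a b) θ χ
      = surfTangent₂ τ h θ χ ε + s • tangent₂ (l ε) θ χ :=
  ((hasDerivAt_surface_χ hl.smooth_τ hl.smooth_h ε θ χ).add
    ((hl.hasDerivAt_l_χ hε hθ χ).const_smul s)).deriv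

lemma tangent₁_l_apply (hl : B.IsTrappedFamily τ h ε₀ c l) {ε θ : ℝ} (hε : ε ∈ Ioo 0 ε₀)
    (hθ : θ ∈ Ioo 0 Real.pi) (χ : ℝ) (i : Fin 4) :
    tangent₁ (l ε) θ χ i = deriv (fun s => l ε s χ i) θ :=
  ((hasDerivAt_pi.1 (hl.hasDerivAt_l_θ hε hθ χ)) i).deriv.symm

lemma tangent₂_l_apply (hl : B.IsTrappedFamily τ h ε₀ c l) {ε θ : ℝ} (hε : ε ∈ Ioo 0 ε₀)
    (hθ : θ ∈ Ioo 0 Real.pi) (χ : ℝ) (i : Fin 4) :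
    tangent₂ (l ε) θ χ i = deriv (fun s => l ε θ s i) χ :=
  ((hasDerivAt_pi.1 (hl.hasDerivAt_l_χ hε hθ χ)) i).deriv.symm

/-- The null normals and their derivatives, to first order in `ε`. -/
lemma exists_first_order (hl : B.IsTrappedFamily τ h ε₀ c l) :
    ∃ r a b : ℝ → ℝ → ℝ, ∀ θ ∈ Ioo 0 Real.pi, ∀ χ,
      MetricCoeffs.NearGenerator (fun ε => l ε θ χ) (r θ χ) (a θ χ) (b θ χ) ∧
      MetricCoeffs.FirstOrder (fun ε => tangent₁ (l ε) θ χ) (dR r θ χ) (dR a θ χ) (dR b θ χ) ∧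
      MetricCoeffs.FirstOrder (fun ε => tangent₂ (l ε) θ χ) (dθ r θ χ) (dθ a θ χ)
        (dθ b θ χ) := by
  have hz : ∀ (i : Fin 4), i ≠ 0 → ∀ θ ∈ Ioo 0 Real.pi, ∀ χ, l 0 θ χ i = 0 := by
    intro i hi θ hθ χ
    rw [hl.l_zero θ hθ χ]
    fin_cases i
    · exact absurd rfl hi
    all_goals rfl
  obtain ⟨r, hr⟩ := _root_.exists_first_order (φ := fun ε θ χ => l ε θ χ 1) (c := 0) hl.ε₀_pos
    (hl.smooth_comp 1) (hz 1 (by decide))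
  obtain ⟨a, ha⟩ := _root_.exists_first_order (φ := fun ε θ χ => l ε θ χ 2) (c := 0) hl.ε₀_pos
    (hl.smooth_comp 2) (hz 2 (by decide))
  obtain ⟨b, hb⟩ := _root_.exists_first_order (φ := fun ε θ χ => l ε θ χ 3) (c := 0) hl.ε₀_pos
    (hl.smooth_comp 3) (hz 3 (by decide))
  refine ⟨r, a, b, fun θ hθ χ => ?_⟩
  have hev : ∀ᶠ ε in 𝓝[>] 0, ε ∈ Ioo 0 ε₀ := Ioo_mem_nhdsGT hl.ε₀_pos
  obtain ⟨r1, r2, r3⟩ := hr θ hθ χ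
  obtain ⟨a1, a2, a3⟩ := ha θ hθ χ
  obtain ⟨b1, b2, b3⟩ := hb θ hθ χ
  simp only [sub_zero] at r1 a1 b1
  have t1 : ∀ {i : Fin 4} {d : ℝ}, Tendsto (fun ε => deriv (fun s => l ε s χ i) θ / ε) (𝓝[>] 0)
      (𝓝 d) → Tendsto (fun ε => tangent₁ (l ε) θ χ i / ε) (𝓝[>] 0) (𝓝 d) := fun hd =>
    hd.congr' (by filter_upwards [hev] with ε hε; rw [hl.tangent₁_l_apply hε hθ])
  have t2 : ∀ {i : Fin 4} {d : ℝ}, Tendsto (fun ε => deriv (fun s => l ε θ s i) χ / ε) (𝓝[>] 0)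
      (𝓝 d) → Tendsto (fun ε => tangent₂ (l ε) θ χ i / ε) (𝓝[>] 0) (𝓝 d) := fun hd =>
    hd.congr' (by filter_upwards [hev] with ε hε; rw [hl.tangent₂_l_apply hε hθ])
  refine ⟨⟨?_, r1, a1, b1⟩, ⟨?_, t1 r2, t1 a2, t1 b2⟩, ⟨?_, t2 r3, t2 a3, t2 b3⟩⟩
  · filter_upwards [hev] with ε hε using hl.l_v ε hε θ hθ χ
  · filter_upwards [hev] with ε hε
    rw [hl.tangent₁_l_apply hε hθ]
    have : (fun s => l ε s χ 0) =ᶠ[𝓝 θ] fun _ => 1 := by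
      filter_upwards [Ioo_mem_nhds hθ.1 hθ.2] with s hs using hl.l_v ε hε s hs χ
    rw [this.deriv_eq, deriv_const]
  · filter_upwards [hev] with ε hε
    rw [hl.tangent₂_l_apply hε hθ]
    have : (fun s => l ε θ s 0) = fun _ => 1 := funext fun s => hl.l_v ε hε θ hθ s
    rw [this, deriv_const]

/-- The null and orthogonality conditions determine the null normals to first order. -/
lemma first_order_eq (hl : B.IsTrappedFamily τ h ε₀ c l) (hB : B.IsBlackHole) {θ χ r a b : ℝ}
    (hθ : θ ∈ Ioo 0 Real.pi)
    (hL : MetricCoeffs.NearGenerator (fun ε => l ε θ χ) r a b) :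
    r = -(B.rh / B.k) * onSphere h θ χ ∧
    a = (dR (onSphere h) θ χ - B.rh / B.k * onSphere h θ χ * dR (onSphere τ) θ χ) / B.k ∧
    b = 4 * B.k / (B.u B.rh θ * Real.sin θ ^ 2 * B.u B.rh θ)
        * (dθ (onSphere h) θ χ - B.rh / B.k * onSphere h θ χ * dθ (onSphere τ) θ χ)
      - onSphere h θ χ * dR B.Ω B.rh θ / 2 := by
  have hθ' := Ioo_subset_Icc_self hθ
  have hh : 0 < onSphere h θ χ := hl.h_pos θ χ
  have hk := hB.k_pos
  have hrh := hB.rh_pos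
  have hu := hB.u_pos _ hB.rh_mem _ hθ'
  have hs := Real.sin_pos_of_pos_of_lt_pi hθ.1 hθ.2
  have hc := hB.approach hθ hh
  have ev := hB.eventually_regular hl θ χ
  have metric_eq : ∀ ε, B.rh - ε * onSphere h θ χ ∈ Ioo (B.rh - B.δ) (B.rh + B.δ) →
      B.horizonFun (B.rh - ε * onSphere h θ χ) ≠ 0 → ∀ X Y,
      B.metric (B.surface τ h ε θ χ) X Y = (B.coeffs (B.rh - ε * onSphere h θ χ) θ).form X Y :=
    fun ε h1 h2 X Y => metric_eq_form (p := B.surface τ h ε θ χ) (hB.u_pos _ h1 _ hθ').ne' h2 X Y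
  -- Divided by ε, the null condition and the two orthogonality conditions become in the limit a
  -- triangular linear system: the first determines r, the others then determine a and b.
  have n0 := tendsto_nhds_unique_of_eventuallyEq (hc.tendsto_form_self_div hL)
    (tendsto_const_nhds (x := (0 : ℝ))) (by
      filter_upwards [ev] with ε hε
      rw [← metric_eq ε hε.2.1 hε.2.2, (hl.normal ε hε.1 θ hθ χ).null, zero_div])
  have n1 := tendsto_nhds_unique_of_eventuallyEq
    (hc.tendsto_form_div hL (tangential_surfTangent₁ τ h θ χ))
    (tendsto_const_nhds (x := (0 : ℝ))) (by
      filter_upwards [ev] with ε hε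
      have := (hl.normal ε hε.1 θ hθ χ).normal₁
      rw [tangent₁, (hasDerivAt_surface_θ hl.smooth_τ hl.smooth_h ε θ χ).deriv] at this
      rw [← metric_eq ε hε.2.1 hε.2.2, this, zero_div])
  have n2 := tendsto_nhds_unique_of_eventuallyEq
    (hc.tendsto_form_div hL (tangential_surfTangent₂ τ h θ χ))
    (tendsto_const_nhds (x := (0 : ℝ))) (by
      filter_upwards [ev] with ε hε
      have := (hl.normal ε hε.1 θ hθ χ).normal₂
      rw [tangent₂, (hasDerivAt_surface_χ hl.smooth_τ hl.smooth_h ε θ χ).deriv] at this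
      rw [← metric_eq ε hε.2.1 hε.2.2, this, zero_div])
  have er : r = -(B.rh / B.k) * onSphere h θ χ := by
    field_simp at n0 ⊢
    linarith
  refine ⟨er, ?_, ?_⟩
  · rw [er] at n1
    simp only [mul_zero, add_zero, mul_one] at n1
    field_simp at n1 ⊢
    linarith
  · rw [er] at n2
    field_simp at n2 ⊢
    linear_combination n2

/-- The expansion in terms of the metric coefficients. -/
lemma expansion_eq (hl : B.IsTrappedFamily τ h ε₀ c l) (hB : B.IsBlackHole) {θ χ ε : ℝ}
    (hθ : θ ∈ Ioo 0 Real.pi) (hε : ε ∈ Ioo 0 ε₀)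
    (h1 : B.rh - ε * onSphere h θ χ ∈ Ioo (B.rh - B.δ) (B.rh + B.δ))
    (h2 : B.horizonFun (B.rh - ε * onSphere h θ χ) ≠ 0) {C C' : MetricCoeffs}
    {X X' Y Y' : Fin 4 → ℝ} (hC : C = B.coeffs (B.rh - ε * onSphere h θ χ) θ)
    (hC' : C' = B.coeffsAlong (B.rh - ε * onSphere h θ χ) θ (l ε θ χ 1) (l ε θ χ 2))
    (hX : X = surfTangent₁ τ h θ χ ε) (hX' : X' = tangent₁ (l ε) θ χ)
    (hY : Y = surfTangent₂ τ h θ χ ε) (hY' : Y' = tangent₂ (l ε) θ χ)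
    (hpos : 0 < C.form X X * C.form Y Y - C.form X Y ^ 2) :
    B.expansion (B.surface τ h ε) (l ε) θ χ
      = (C.formDeriv C' X X' X X' * C.form Y Y + C.form X X * C.formDeriv C' Y Y' Y Y'
          - 2 * C.form X Y * C.formDeriv C' X X' Y Y')
        / (2 * (C.form X X * C.form Y Y - C.form X Y ^ 2)) := by
  have hθ' := Ioo_subset_Icc_self hθ
  -- The coefficients are independent of v and χ, so only the motion of R and θ matters when the
  -- surface is displaced.
  set R : ℝ → ℝ := fun s => B.rh - ε * onSphere h θ χ + s * l ε θ χ 1 with hR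
  set Θ : ℝ → ℝ := fun s => θ + s * l ε θ χ 2 with hΘ
  have R0 : R 0 = B.rh - ε * onSphere h θ χ := by simp [hR]
  have Θ0 : Θ 0 = θ := by simp [hΘ]
  have dRs : HasDerivAt R (l ε θ χ 1) 0 := by
    exact (((hasDerivAt_id (0 : ℝ)).mul_const (l ε θ χ 1)).const_add
      (B.rh - ε * onSphere h θ χ)).congr_deriv (one_mul _)
  have dΘ : HasDerivAt Θ (l ε θ χ 2) 0 := by
    exact (((hasDerivAt_id (0 : ℝ)).mul_const (l ε θ χ 2)).const_add θ).congr_deriv (one_mul _)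
  have oP := hB.isOpen_posVicinity
  have hp : (R 0, Θ 0) ∈ B.posVicinity := by
    rw [R0, Θ0]
    exact hB.mem_posVicinity h1 hθ'
  have hf0 : B.horizonFun (R 0) ≠ 0 := by rwa [R0]
  -- the derivatives of the coefficients
  have al : ∀ {f : ℝ → ℝ → ℝ}, ContDiffOn ℝ ∞ (fun p : ℝ × ℝ => f p.1 p.2) B.posVicinity →
      HasDerivAt (fun s => f (R s) (Θ s)) (along f (B.rh - ε * onSphere h θ χ) θ (l ε θ χ 1)
        (l ε θ χ 2)) 0 := fun {f} hf => by
    have := hasDerivAt_along hf oP hp dRs dΘ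
    rw [R0, Θ0] at this
    exact this
  have qu : ∀ {f : ℝ → ℝ → ℝ}, ContDiffOn ℝ ∞ (fun p : ℝ × ℝ => f p.1 p.2) B.posVicinity →
      HasDerivAt (fun s => f (R s) (Θ s) / B.horizonFun (R s))
        (B.quotAlong f (B.rh - ε * onSphere h θ χ) θ (l ε θ χ 1) (l ε θ χ 2)) 0 :=
      fun {f} hf => by
    have := hasDerivAt_quotient hf oP hp dRs dΘ hf0
    rw [R0, Θ0] at this
    exact this
  have df : ∀ Z Z' T T' : Fin 4 → ℝ, HasDerivAt
      (fun s => (B.coeffs (R s) (Θ s)).form (Z + s • Z') (T + s • T'))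
      (C.formDeriv C' Z Z' T T') 0 := by
    intro Z Z' T T'
    have hlin : ∀ (Z Z' : Fin 4 → ℝ) (i : Fin 4),
        HasDerivAt (fun s : ℝ => (Z + s • Z') i) (Z' i) 0 := fun Z Z' i => by
      simpa using ((hasDerivAt_id (0 : ℝ)).mul_const (Z' i)).const_add (Z i)
    have h := MetricCoeffs.hasDerivAt_form (c := fun s => B.coeffs (R s) (Θ s)) (c' := C')
      (X := fun s => Z + s • Z') (Y := fun s => T + s • T') (X' := Z') (Y' := T') (s := 0)
      (by rw [hC']; exact qu hB.smooth_Pnum) (by rw [hC']; exact al (hB.smooth_μ.mono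
        posVicinity_subset)) (by rw [hC']; exact al hB.smooth_βcoeff)
      (by rw [hC']; exact al hB.smooth_qcoeff) (by rw [hC']; exact al hB.smooth_νcoeff)
      (by rw [hC']; exact al hB.smooth_ζcoeff)
      (by rw [hC']; exact (qu hB.smooth_ζcoeff).const_mul _) (hlin Z Z') (hlin T T')
    rw [R0, Θ0, ← hC] at h
    simpa using h
  -- the area density near `s = 0`
  have ev : (fun s : ℝ => B.areaDensity (fun a b => B.surface τ h ε a b + s • l ε a b) θ χ)
      =ᶠ[𝓝 0] fun s => √((B.coeffs (R s) (Θ s)).form (X + s • X') (X + s • X')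
        * (B.coeffs (R s) (Θ s)).form (Y + s • Y') (Y + s • Y')
        - (B.coeffs (R s) (Θ s)).form (X + s • X') (Y + s • Y') ^ 2) := by
    have c1 : ∀ᶠ s in 𝓝 0, R s ∈ Ioo (B.rh - B.δ) (B.rh + B.δ) :=
      dRs.continuousAt.eventually (by rw [R0]; exact Ioo_mem_nhds h1.1 h1.2)
    have c2 : ∀ᶠ s in 𝓝 0, Θ s ∈ Ioo 0 Real.pi :=
      dΘ.continuousAt.eventually (by rw [Θ0]; exact Ioo_mem_nhds hθ.1 hθ.2)
    have c3 : ∀ᶠ s in 𝓝 0, B.horizonFun (R s) ≠ 0 := by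
      have : ContinuousAt (fun s => B.horizonFun (R s)) 0 :=
        (dRs.continuousAt.pow 2).sub continuousAt_const
      exact this.eventually_ne hf0
    filter_upwards [c1, c2, c3] with s s1 s2 s3
    have e : ∀ Z T, B.metric (B.surface τ h ε θ χ + s • l ε θ χ) Z T
        = (B.coeffs (R s) (Θ s)).form Z T := fun Z T =>
      metric_eq_form (p := B.surface τ h ε θ χ + s • l ε θ χ)
        (hB.u_pos _ s1 _ (Ioo_subset_Icc_self s2)).ne' s3 Z T
    rw [areaDensity, hl.tangent₁_displaced hε hθ, hl.tangent₂_displaced hε hθ, e, e, e, hX, hX',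
      hY, hY']
  -- G is the Gram determinant of the displaced tangent vectors. The expansion is the logarithmic
  -- derivative of √G, namely G'/(2G).
  have dG := ((df X X' X X').mul (df Y Y' Y Y')).sub ((df X X' Y Y').pow 2)
  have G0 : ∀ Z Z' T T' : Fin 4 → ℝ, (B.coeffs (R 0) (Θ 0)).form (Z + (0 : ℝ) • Z')
      (T + (0 : ℝ) • T') = C.form Z T := fun Z Z' T T' => by
    rw [R0, Θ0, ← hC, zero_smul, zero_smul, add_zero, add_zero]
  have dS := dG.sqrt (by
    simp only [Pi.sub_apply, Pi.mul_apply, Pi.pow_apply, G0]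
    exact hpos.ne')
  rw [expansion, logDeriv_apply, ev.deriv_eq, ev.eq_of_nhds]
  have hder := dS.deriv
  simp only [Pi.sub_apply, Pi.mul_apply, Pi.pow_apply, G0] at hder
  have hsq : √(C.form X X * C.form Y Y - C.form X Y ^ 2) ^ 2
      = C.form X X * C.form Y Y - C.form X Y ^ 2 := Real.sq_sqrt hpos.le
  have hsp : 0 < √(C.form X X * C.form Y Y - C.form X Y ^ 2) := Real.sqrt_pos.2 hpos
  simp only [G0]
  refine (congrArg (· / _) hder).trans ?_
  rw [div_div, mul_assoc (2 : ℝ) (√_), ← sq, hsq]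
  congr 1
  norm_num

/-- The expansion of the trapped surfaces, to first order in `ε`. -/
lemma first_order_expansion_le (hl : B.IsTrappedFamily τ h ε₀ c l) (hB : B.IsBlackHole)
    {θ χ r a b rθ aθ bθ rχ aχ bχ : ℝ} (hθ : θ ∈ Ioo 0 Real.pi)
    (hL : MetricCoeffs.NearGenerator (fun ε => l ε θ χ) r a b)
    (hL₁ : MetricCoeffs.FirstOrder (fun ε => tangent₁ (l ε) θ χ) rθ aθ bθ)
    (hL₂ : MetricCoeffs.FirstOrder (fun ε => tangent₂ (l ε) θ χ) rχ aχ bχ) :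
    (r * dR B.μ B.rh θ + a * -(4 * B.k ^ 2 / B.u B.rh θ * dθ B.u B.rh θ / B.u B.rh θ)
        + 2 * (4 * B.k ^ 2 / B.u B.rh θ) * aθ
        + 2 * (4 * B.k / B.u B.rh θ) * dR (onSphere τ) θ χ * rθ
        - r * (8 * B.rh / B.u B.rh θ) * dR (onSphere τ) θ χ ^ 2)
        / (2 * (4 * B.k ^ 2 / B.u B.rh θ))
      + (2 * (4 * B.k / B.u B.rh θ) * dθ (onSphere τ) θ χ * rχ
        - r * (8 * B.rh / B.u B.rh θ) * dθ (onSphere τ) θ χ ^ 2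
        + (r * (dR B.u B.rh θ * Real.sin θ ^ 2) + a * (dθ B.u B.rh θ * Real.sin θ ^ 2
          + B.u B.rh θ * (2 * Real.sin θ * Real.cos θ)))
        + 2 * (B.u B.rh θ * Real.sin θ ^ 2) * (bχ - r * dR B.Ω B.rh θ * dθ (onSphere τ) θ χ
          + B.k * dR B.Ω B.rh θ / (2 * B.rh) * rχ))
        / (2 * (B.u B.rh θ * Real.sin θ ^ 2)) ≤ -c := by
  have hθ' := Ioo_subset_Icc_self hθ
  have hh : 0 < onSphere h θ χ := hl.h_pos θ χ
  have hk := hB.k_pos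
  have hu := hB.u_pos _ hB.rh_mem _ hθ'
  have hs := Real.sin_pos_of_pos_of_lt_pi hθ.1 hθ.2
  have hc := hB.approach hθ hh
  have hc' := hB.approachDeriv hθ hh hL.R hL.θ
  have ev := hB.eventually_regular hl θ χ
  have tX := tangential_surfTangent₁ τ h θ χ
  have tY := tangential_surfTangent₂ τ h θ χ
  have gXX := hc.tendsto_form tX tX
  have gXY := hc.tendsto_form tX tY
  have gYY := hc.tendsto_form tY tY
  have dXX := hc.tendsto_formDeriv_div hc' tX tX hL₁ hL₁
  have dXY := hc.tendsto_formDeriv_div hc' tX tY hL₁ hL₂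
  have dYY := hc.tendsto_formDeriv_div hc' tY tY hL₂ hL₂
  have gdet := (gXX.mul gYY).sub (gXY.pow 2)
  have hdet : 0 < (4 * B.k ^ 2 / B.u B.rh θ * 1 * 1 + B.u B.rh θ * Real.sin θ ^ 2 * 0 * 0)
      * (4 * B.k ^ 2 / B.u B.rh θ * 0 * 0 + B.u B.rh θ * Real.sin θ ^ 2 * 1 * 1)
      - (4 * B.k ^ 2 / B.u B.rh θ * 1 * 0 + B.u B.rh θ * Real.sin θ ^ 2 * 0 * 1) ^ 2 := by
    have : 0 < 4 * B.k ^ 2 / B.u B.rh θ * (B.u B.rh θ * Real.sin θ ^ 2) := by positivity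
    nlinarith
  have lim := (((dXX.mul gYY).add (gXX.mul dYY)).sub ((gXY.const_mul 2).mul dXY)).div
    (gdet.const_mul 2) (by positivity)
  have le := le_of_tendsto lim (b := -c) (by
    filter_upwards [ev, gdet.eventually_const_lt hdet] with ε hε hpos
    have h1 := hl.expansion_eq hB hθ hε.1 hε.2.1 hε.2.2 rfl rfl rfl rfl rfl rfl hpos
    have h2 := hl.expansion_le ε hε.1 θ hθ χ
    rw [h1] at h2
    have h3 : 0 < ε := hε.1.1
    have h4 := div_le_div_of_nonneg_right h2 h3.le
    rw [show -(c * ε) / ε = -c by field_simp] at h4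
    refine le_trans (le_of_eq ?_) h4
    simp only [Pi.div_apply]
    rw [div_right_comm]
    congr 1
    ring)
  refine le_trans (le_of_eq ?_) le
  field_simp
  ring

end IsTrappedFamily

end HorizonData

/-! ### Integration of the Riccati inequality over the sphere -/

/-- A smooth function on the sphere that satisfies a strict differential inequality of Riccati type
bounds the mean of the potential from below. -/
theorem integral_mul_sin_pos_of_riccati {z : ℝ → ℝ → ℝ} {ρ C D : ℝ → ℝ} {d : ℝ}
    (sz : ContDiffOn ℝ ∞ (fun p : ℝ × ℝ => z p.1 p.2) univ)
    (per : ∀ θ χ, z θ (χ + 2 * Real.pi) = z θ χ) (hd : 0 < d)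
    (hC : ∀ θ ∈ Ioo 0 Real.pi, 0 ≤ C θ) (hρ : ContinuousOn ρ (Icc 0 Real.pi))
    (hz : ∀ θ ∈ Ioo 0 Real.pi, ∀ χ ∈ Icc 0 (2 * Real.pi),
      dR (dR z) θ χ + dR z θ χ ^ 2 + Real.cos θ / Real.sin θ * dR z θ χ
        + C θ * (dθ (dθ z) θ χ + dθ z θ χ ^ 2) - D θ * dθ z θ χ - ρ θ ≤ -d) :
    0 < ∫ θ in (0 : ℝ)..Real.pi, ρ θ * Real.sin θ := by
  have hpi := Real.pi_pos
  have hU : IsOpen (univ : Set (ℝ × ℝ)) := isOpen_univ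
  have sz1 := contDiffOn_dR sz hU
  have sz2 := contDiffOn_dθ sz hU
  have sz11 := contDiffOn_dR sz1 hU
  have sz22 := contDiffOn_dθ sz2 hU
  have c1 := (contDiffOn_univ.1 sz1).continuous
  have c2 := (contDiffOn_univ.1 sz2).continuous
  have c11 := (contDiffOn_univ.1 sz11).continuous
  have c22 := (contDiffOn_univ.1 sz22).continuous
  have per2 : ∀ θ, dθ z θ (2 * Real.pi) = dθ z θ 0 := fun θ => by
    have h1 : deriv (fun s => z θ (s + 2 * Real.pi)) 0 = deriv (fun s => z θ s) (0 + 2 * Real.pi) :=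
      deriv_comp_add_const _ _ _
    rw [zero_add] at h1
    rw [dθ, ← h1, dθ]
    simp only [per]
  have z1 : ∀ θ χ, HasDerivAt (fun s => dR z s χ) (dR (dR z) θ χ) θ := fun θ χ =>
    hasDerivAt_dR sz1 hU (mem_univ (θ, χ))
  have z2 : ∀ θ χ, HasDerivAt (fun s => z θ s) (dθ z θ χ) χ := fun θ χ =>
    hasDerivAt_dθ sz hU (mem_univ (θ, χ))
  have z22 : ∀ θ χ, HasDerivAt (fun s => dθ z θ s) (dθ (dθ z) θ χ) χ := fun θ χ =>
    hasDerivAt_dθ sz2 hU (mem_univ (θ, χ))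
  generalize dR (dR z) = zθθ at *
  generalize dR z = zθ at *
  generalize dθ (dθ z) = zχχ at *
  generalize dθ z = zχ at *
  -- The integrand is ∂_θ(sin θ z_θ), which is sin θ times the polar part of the round Laplacian; it
  -- integrates to zero because sin θ vanishes at both poles.
  have cg : Continuous fun p : ℝ × ℝ => Real.cos p.1 * zθ p.1 p.2 + Real.sin p.1 * zθθ p.1 p.2 := by
    fun_prop
  -- integration over the azimuth
  have hχ : ∀ θ ∈ Ioo 0 Real.pi,
      (∫ χ in (0 : ℝ)..(2 * Real.pi), (Real.cos θ * zθ θ χ + Real.sin θ * zθθ θ χ))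
        ≤ 2 * Real.pi * (ρ θ * Real.sin θ) - 2 * Real.pi * d * Real.sin θ := by
    intro θ hθ
    have hs := Real.sin_pos_of_pos_of_lt_pi hθ.1 hθ.2
    have cθ : Continuous fun χ => Real.cos θ * zθ θ χ + Real.sin θ * zθθ θ χ := by fun_prop
    have cχ : Continuous fun χ => zχ θ χ := by fun_prop
    have cχχ : Continuous fun χ => zχχ θ χ := by fun_prop
    have e1 : ∫ χ in (0 : ℝ)..(2 * Real.pi), zχχ θ χ = 0 := by
      rw [intervalIntegral.integral_eq_sub_of_hasDerivAt (fun χ _ => z22 θ χ)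
        (cχχ.intervalIntegrable _ _), per2, sub_self]
    have e2 : ∫ χ in (0 : ℝ)..(2 * Real.pi), zχ θ χ = 0 := by
      have := per θ 0
      rw [zero_add] at this
      rw [intervalIntegral.integral_eq_sub_of_hasDerivAt (fun χ _ => z2 θ χ)
        (cχ.intervalIntegrable _ _), this, sub_self]
    have i1 : IntervalIntegrable (fun χ => Real.sin θ * C θ * zχχ θ χ) volume 0 (2 * Real.pi) :=
      (cχχ.intervalIntegrable _ _).const_mul _
    have i2 : IntervalIntegrable (fun χ => Real.sin θ * D θ * zχ θ χ) volume 0 (2 * Real.pi) :=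
      (cχ.intervalIntegrable _ _).const_mul _
    have i3 : IntervalIntegrable (fun _ : ℝ => ρ θ * Real.sin θ - d * Real.sin θ)
        volume 0 (2 * Real.pi) := continuous_const.intervalIntegrable _ _
    have e3 : ∫ χ in (0 : ℝ)..(2 * Real.pi), ((ρ θ * Real.sin θ - d * Real.sin θ)
        - Real.sin θ * C θ * zχχ θ χ + Real.sin θ * D θ * zχ θ χ)
        = 2 * Real.pi * (ρ θ * Real.sin θ) - 2 * Real.pi * d * Real.sin θ := by
      rw [intervalIntegral.integral_add (i3.sub i1) i2, intervalIntegral.integral_sub i3 i1,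
        intervalIntegral.integral_const_mul, intervalIntegral.integral_const_mul, e1, e2,
        intervalIntegral.integral_const, smul_eq_mul]
      ring
    rw [← e3]
    refine intervalIntegral.integral_mono_on (by positivity) (cθ.intervalIntegrable _ _)
      ((i3.sub i1).add i2) fun χ hχ => ?_
    have h1 := hz θ hθ χ hχ
    -- The squared first derivatives have the favourable sign and are discarded. The terms linear in
    -- z_χχ and z_χ have coefficients independent of χ and integrate to zero over a period.
    have h3 : 0 ≤ zθ θ χ ^ 2 := sq_nonneg _
    have h4 : 0 ≤ C θ * zχ θ χ ^ 2 := mul_nonneg (hC θ hθ) (sq_nonneg _)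
    have h5 : zθθ θ χ + Real.cos θ / Real.sin θ * zθ θ χ
        ≤ ρ θ - d - C θ * zχχ θ χ + D θ * zχ θ χ := by
      linarith
    have h6 := mul_le_mul_of_nonneg_left h5 hs.le
    have h7 : Real.sin θ * (zθθ θ χ + Real.cos θ / Real.sin θ * zθ θ χ)
        = Real.cos θ * zθ θ χ + Real.sin θ * zθθ θ χ := by
      field_simp
      ring
    rw [h7] at h6
    linarith
  -- integration over the polar angle
  have hzero : ∫ θ in (0 : ℝ)..Real.pi, ∫ χ in (0 : ℝ)..(2 * Real.pi),
      (Real.cos θ * zθ θ χ + Real.sin θ * zθθ θ χ) = 0 := by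
    rw [intervalIntegral_intervalIntegral_swap
      (F := fun θ χ => Real.cos θ * zθ θ χ + Real.sin θ * zθθ θ χ)
      ((cg.continuousOn.integrableOn_compact (isCompact_uIcc.prod isCompact_uIcc)).mono_set
        (prod_mono uIoc_subset_uIcc uIoc_subset_uIcc))]
    have : ∀ χ, ∫ θ in (0 : ℝ)..Real.pi, (Real.cos θ * zθ θ χ + Real.sin θ * zθθ θ χ) = 0 :=
      fun χ => by
        have cθ : Continuous fun θ => Real.cos θ * zθ θ χ + Real.sin θ * zθθ θ χ := by fun_prop
        rw [intervalIntegral.integral_eq_sub_of_hasDerivAt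
          (fun θ _ => (Real.hasDerivAt_sin θ).mul (z1 θ χ)) (cθ.intervalIntegrable _ _)]
        simp
    simp [this]
  have iR : IntervalIntegrable (fun θ => 2 * Real.pi * (ρ θ * Real.sin θ)) volume 0 Real.pi := by
    refine ContinuousOn.intervalIntegrable ?_
    rw [uIcc_of_le hpi.le]
    fun_prop
  have iS : IntervalIntegrable (fun θ => 2 * Real.pi * d * Real.sin θ) volume 0 Real.pi :=
    (by fun_prop : Continuous fun θ => 2 * Real.pi * d * Real.sin θ).intervalIntegrable _ _
  have cI : Continuous fun θ => ∫ χ in (0 : ℝ)..(2 * Real.pi),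
      (Real.cos θ * zθ θ χ + Real.sin θ * zθθ θ χ) :=
    intervalIntegral.continuous_parametric_intervalIntegral_of_continuous' (by exact cg) _ _
  have hmono := intervalIntegral.integral_mono_on_of_le_Ioo hpi.le
    (cI.intervalIntegrable 0 Real.pi) (iR.sub iS) hχ
  rw [hzero, intervalIntegral.integral_sub iR iS, intervalIntegral.integral_const_mul,
    intervalIntegral.integral_const_mul, integral_sin, Real.cos_zero, Real.cos_pi] at hmono
  have h1 : 0 < 2 * Real.pi * d := by positivity
  refine pos_of_mul_pos_right (a := 2 * Real.pi) ?_ (by positivity)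
  linarith

/-! ### Trapping as a Riccati inequality, and positivity of the mean rate -/

namespace HorizonData

variable {B : HorizonData} {τ h : (Fin 3 → ℝ) → ℝ} {ε₀ c : ℝ} {l : ℝ → ℝ → ℝ → Fin 4 → ℝ}

/-- The logarithm of the displacement, rescaled along the generators of the horizon. -/
noncomputable def logDisplacement (B : HorizonData) (τ h : (Fin 3 → ℝ) → ℝ) (θ χ : ℝ) : ℝ :=
  Real.log (onSphere h θ χ) - B.rh / B.k * onSphere τ θ χ

/-- The normalization by `uN` disappears from logarithmic derivatives. This connects the quantity in
the field equations with the one produced by the area density. -/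
lemma IsBlackHole.horizonRate_eq_logDeriv (hB : B.IsBlackHole) {θ : ℝ} (hθ : θ ∈ Icc 0 Real.pi) :
    B.horizonRate θ = B.rh / 2 * (dR B.μ B.rh θ / (4 * B.k ^ 2 / B.u B.rh θ)
      + dR B.u B.rh θ / B.u B.rh θ) := by
  have hm := mem_vicinity (θ := θ) hB.rh_mem
  have hu := hB.u_pos _ hB.rh_mem _ hθ
  have hμ := hB.μ_pos _ hB.rh_mem _ hθ
  have hN := hB.uN_pos
  have h1 : dR B.ut B.rh θ = 1 / 2 * (dR B.u B.rh θ / B.uN / (B.u B.rh θ / B.uN)) :=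
    ((((hasDerivAt_dR hB.smooth_u isOpen_vicinity hm).div_const B.uN).log
      (div_pos hu hN).ne').const_mul (1 / 2)).deriv
  have h2 : dR B.μt B.rh θ = 1 / 2 * (dR B.μ B.rh θ / B.uN / (B.μ B.rh θ / B.uN)) :=
    ((((hasDerivAt_dR hB.smooth_μ isOpen_vicinity hm).div_const B.uN).log
      (div_pos hμ hN).ne').const_mul (1 / 2)).deriv
  rw [horizonRate, h1, h2, ← hB.μ_eq hθ]
  field_simp

lemma onSphere_periodic (f : (Fin 3 → ℝ) → ℝ) (θ χ : ℝ) :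
    onSphere f θ (χ + 2 * Real.pi) = onSphere f θ χ := by
  simp [onSphere, spherePoint]

namespace IsTrappedFamily

lemma smooth_logDisplacement (hl : B.IsTrappedFamily τ h ε₀ c l) :
    ContDiffOn ℝ ∞ (fun p : ℝ × ℝ => B.logDisplacement τ h p.1 p.2) univ :=
  ((contDiff_onSphere hl.smooth_h).log fun p _ => (hl.h_pos p.1 p.2).ne').sub
    (contDiffOn_const.mul (contDiff_onSphere hl.smooth_τ))

/-- The first-order condition for trapped surfaces, in terms of the logarithm of the displacement. -/
lemma logDisplacement_inequality (hl : B.IsTrappedFamily τ h ε₀ c l) (hB : B.IsBlackHole)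
    {θ : ℝ} (hθ : θ ∈ Ioo 0 Real.pi) (χ : ℝ) :
    dR (dR (B.logDisplacement τ h)) θ χ + dR (B.logDisplacement τ h) θ χ ^ 2
      + Real.cos θ / Real.sin θ * dR (B.logDisplacement τ h) θ χ
      + 4 * B.k ^ 2 / (B.u B.rh θ * (B.u B.rh θ * Real.sin θ ^ 2))
        * (dθ (dθ (B.logDisplacement τ h)) θ χ + dθ (B.logDisplacement τ h) θ χ ^ 2)
      - B.k * dR B.Ω B.rh θ * dθ (B.logDisplacement τ h) θ χ - B.horizonRate θ
      ≤ -(c * B.k / onSphere h θ χ) := by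
  have hθ' := Ioo_subset_Icc_self hθ
  have hk := hB.k_pos
  have hrh := hB.rh_pos
  have hu := hB.u_pos _ hB.rh_mem _ hθ'
  have hs := Real.sin_pos_of_pos_of_lt_pi hθ.1 hθ.2
  have hh : ∀ θ χ, 0 < onSphere h θ χ := hl.h_pos
  have sh := contDiff_onSphere hl.smooth_h
  have sτ := contDiff_onSphere hl.smooth_τ
  have hU : IsOpen (univ : Set (ℝ × ℝ)) := isOpen_univ
  have h1 : ∀ θ χ, HasDerivAt (fun s => onSphere h s χ) (dR (onSphere h) θ χ) θ := fun θ χ =>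
    hasDerivAt_dR sh hU (mem_univ (θ, χ))
  have h2 : ∀ θ χ, HasDerivAt (fun s => onSphere h θ s) (dθ (onSphere h) θ χ) χ := fun θ χ =>
    hasDerivAt_dθ sh hU (mem_univ (θ, χ))
  have τ1 : ∀ θ χ, HasDerivAt (fun s => onSphere τ s χ) (dR (onSphere τ) θ χ) θ := fun θ χ =>
    hasDerivAt_dR sτ hU (mem_univ (θ, χ))
  have τ2 : ∀ θ χ, HasDerivAt (fun s => onSphere τ θ s) (dθ (onSphere τ) θ χ) χ := fun θ χ =>
    hasDerivAt_dθ sτ hU (mem_univ (θ, χ))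
  have h11 := hasDerivAt_dR (contDiffOn_dR sh hU) hU (mem_univ (θ, χ))
  have h22 := hasDerivAt_dθ (contDiffOn_dθ sh hU) hU (mem_univ (θ, χ))
  have τ11 := hasDerivAt_dR (contDiffOn_dR sτ hU) hU (mem_univ (θ, χ))
  have τ22 := hasDerivAt_dθ (contDiffOn_dθ sτ hU) hU (mem_univ (θ, χ))
  -- the derivatives of the logarithmic displacement
  have z1 : ∀ θ χ, dR (B.logDisplacement τ h) θ χ
      = dR (onSphere h) θ χ / onSphere h θ χ - B.rh / B.k * dR (onSphere τ) θ χ := fun θ χ =>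
    (((h1 θ χ).log (hh θ χ).ne').sub ((τ1 θ χ).const_mul _)).deriv
  have z2 : ∀ θ χ, dθ (B.logDisplacement τ h) θ χ
      = dθ (onSphere h) θ χ / onSphere h θ χ - B.rh / B.k * dθ (onSphere τ) θ χ := fun θ χ =>
    (((h2 θ χ).log (hh θ χ).ne').sub ((τ2 θ χ).const_mul _)).deriv
  have z11 : dR (dR (B.logDisplacement τ h)) θ χ = dR (dR (onSphere h)) θ χ / onSphere h θ χ
      - dR (onSphere h) θ χ ^ 2 / onSphere h θ χ ^ 2 - B.rh / B.k * dR (dR (onSphere τ)) θ χ := by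
    rw [dR]
    simp only [z1]
    refine ((h11.div (h1 θ χ) (hh θ χ).ne').sub (τ11.const_mul _)).deriv.trans ?_
    have := (hh θ χ).ne'
    field_simp
  have z22 : dθ (dθ (B.logDisplacement τ h)) θ χ = dθ (dθ (onSphere h)) θ χ / onSphere h θ χ
      - dθ (onSphere h) θ χ ^ 2 / onSphere h θ χ ^ 2 - B.rh / B.k * dθ (dθ (onSphere τ)) θ χ := by
    rw [dθ]
    simp only [z2]
    refine ((h22.div (h2 θ χ) (hh θ χ).ne').sub (τ22.const_mul _)).deriv.trans ?_
    have := (hh θ χ).ne'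
    field_simp
  -- the first-order null normals
  obtain ⟨r, a, b, hrab⟩ := hl.exists_first_order
  have er : ∀ θ ∈ Ioo 0 Real.pi, ∀ χ, r θ χ = -(B.rh / B.k) * onSphere h θ χ := fun θ hθ χ =>
    (hl.first_order_eq hB hθ (hrab θ hθ χ).1).1
  have ea : ∀ θ ∈ Ioo 0 Real.pi, ∀ χ, a θ χ = (dR (onSphere h) θ χ
      - B.rh / B.k * onSphere h θ χ * dR (onSphere τ) θ χ) / B.k := fun θ hθ χ =>
    (hl.first_order_eq hB hθ (hrab θ hθ χ).1).2.1
  have eb : ∀ θ ∈ Ioo 0 Real.pi, ∀ χ, b θ χ = 4 * B.k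
        / (B.u B.rh θ * Real.sin θ ^ 2 * B.u B.rh θ)
        * (dθ (onSphere h) θ χ - B.rh / B.k * onSphere h θ χ * dθ (onSphere τ) θ χ)
      - onSphere h θ χ * dR B.Ω B.rh θ / 2 := fun θ hθ χ =>
    (hl.first_order_eq hB hθ (hrab θ hθ χ).1).2.2
  have near : ∀ {f g : ℝ → ℝ → ℝ}, (∀ θ ∈ Ioo 0 Real.pi, ∀ χ, f θ χ = g θ χ) →
      dR f θ χ = deriv (fun s => g s χ) θ := fun {f g} hfg => by
    have : (fun s => f s χ) =ᶠ[𝓝 θ] fun s => g s χ := by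
      filter_upwards [Ioo_mem_nhds hθ.1 hθ.2] with s hs using hfg s hs χ
    rw [dR, this.deriv_eq]
  have rθ : dR r θ χ = -(B.rh / B.k) * dR (onSphere h) θ χ :=
    (near er).trans ((h1 θ χ).const_mul _).deriv
  have rχ : dθ r θ χ = -(B.rh / B.k) * dθ (onSphere h) θ χ := by
    rw [dθ, funext (er θ hθ)]
    exact ((h2 θ χ).const_mul _).deriv
  have aθ : dR a θ χ = (dR (dR (onSphere h)) θ χ
      - B.rh / B.k * dR (onSphere h) θ χ * dR (onSphere τ) θ χ
      - B.rh / B.k * onSphere h θ χ * dR (dR (onSphere τ)) θ χ) / B.k := by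
    refine (near ea).trans
      (((h11.sub (((h1 θ χ).const_mul _).mul τ11)).div_const _).deriv.trans ?_)
    ring
  have bχ : dθ b θ χ = 4 * B.k / (B.u B.rh θ * Real.sin θ ^ 2 * B.u B.rh θ)
        * (dθ (dθ (onSphere h)) θ χ - B.rh / B.k * dθ (onSphere h) θ χ * dθ (onSphere τ) θ χ
          - B.rh / B.k * onSphere h θ χ * dθ (dθ (onSphere τ)) θ χ)
      - dθ (onSphere h) θ χ * dR B.Ω B.rh θ / 2 := by
    rw [dθ, funext (eb θ hθ)]
    refine (((h22.sub (((h2 θ χ).const_mul _).mul τ22)).const_mul _).sub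
      (((h2 θ χ).mul_const _).div_const _)).deriv.trans ?_
    ring
  obtain ⟨hL, hL₁, hL₂⟩ := hrab θ hθ χ
  have le := hl.first_order_expansion_le hB hθ hL hL₁ hL₂
  rw [rθ, rχ, aθ, bχ, er θ hθ χ, ea θ hθ χ] at le
  have key := first_order_expansion_eq (k := B.k) (u := B.u B.rh θ) (s := Real.sin θ)
    (c := Real.cos θ) (rh := B.rh) (h := onSphere h θ χ) (hθ := dR (onSphere h) θ χ)
    (hχ := dθ (onSphere h) θ χ) (hθθ := dR (dR (onSphere h)) θ χ)
    (hχχ := dθ (dθ (onSphere h)) θ χ) (τθ := dR (onSphere τ) θ χ) (τχ := dθ (onSphere τ) θ χ)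
    (τθθ := dR (dR (onSphere τ)) θ χ) (τχχ := dθ (dθ (onSphere τ)) θ χ) (μR := dR B.μ B.rh θ)
    (uR := dR B.u B.rh θ) (uθ := dθ B.u B.rh θ) (ΩR := dR B.Ω B.rh θ) hk.ne' hu.ne' hs.ne'
    (hh θ χ).ne' hrh.ne'
  simp only at key
  rw [z11, z22, z1, z2, hB.horizonRate_eq_logDeriv hθ', ← key]
  -- Multiplying the first-order trapping inequality by k/h is what makes it an inequality for log h
  -- − κτ alone, without separate dependence on h and τ on the left.
  have hpos : 0 < B.k / onSphere h θ χ := div_pos hk (hh θ χ)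
  have le2 := mul_le_mul_of_nonneg_left le hpos.le
  rw [show -(c * B.k / onSphere h θ χ) = B.k / onSphere h θ χ * -c by ring]
  exact le2

/-- The mean horizon rate of a sub-extremal black hole is positive. -/
theorem integral_horizonRate_pos (hl : B.IsTrappedFamily τ h ε₀ c l) (hB : B.IsBlackHole) :
    0 < ∫ θ in (0 : ℝ)..Real.pi, B.horizonRate θ * Real.sin θ := by
  -- The right side −ck/h depends on the point; by compactness it is bounded above by one strictly
  -- negative constant.
  obtain ⟨d, hd, hdle⟩ : ∃ d, 0 < d ∧ ∀ θ ∈ Icc 0 Real.pi, ∀ χ ∈ Icc 0 (2 * Real.pi),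
      d ≤ c * B.k / onSphere h θ χ := by
    have hc : Continuous fun p : ℝ × ℝ => c * B.k / onSphere h p.1 p.2 :=
      continuous_const.div (contDiffOn_univ.1 (contDiff_onSphere hl.smooth_h)).continuous
        fun p => (hl.h_pos p.1 p.2).ne'
    obtain ⟨p, -, hmin⟩ := ((isCompact_Icc (a := (0 : ℝ)) (b := Real.pi)).prod
      (isCompact_Icc (a := (0 : ℝ)) (b := 2 * Real.pi))).exists_isMinOn
      ⟨(0, 0), ⟨⟨le_rfl, Real.pi_pos.le⟩, ⟨le_rfl, by positivity⟩⟩⟩ hc.continuousOn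
    exact ⟨_, div_pos (mul_pos hl.c_pos hB.k_pos) (hl.h_pos p.1 p.2), fun θ hθ χ hχ =>
      isMinOn_iff.1 hmin (θ, χ) (mk_mem_prod hθ hχ)⟩
  refine integral_mul_sin_pos_of_riccati (z := B.logDisplacement τ h) (d := d)
    (C := fun θ => 4 * B.k ^ 2 / (B.u B.rh θ * (B.u B.rh θ * Real.sin θ ^ 2)))
    (D := fun θ => B.k * dR B.Ω B.rh θ) hl.smooth_logDisplacement
    (fun θ χ => ?_) hd (fun θ hθ => ?_) hB.continuousOn_horizonRate fun θ hθ χ hχ => ?_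
  · rw [logDisplacement, onSphere_periodic, onSphere_periodic, logDisplacement]
  · have hu := hB.u_pos _ hB.rh_mem _ (Ioo_subset_Icc_self hθ)
    positivity
  · exact (hl.logDisplacement_inequality hB hθ χ).trans
      (neg_le_neg (hdle θ (Ioo_subset_Icc_self hθ) χ hχ))

end IsTrappedFamily

end HorizonData

theorem lemma2 :
    (∀ S T T' U U' : ℝ → ℝ, MemLp S 2 intervalMeasure → MemW012 T T' → MemW012 U U' →
      1 ≤ functionalI S T T' U U') ∧
    ((∀ S T T' U U' : ℝ → ℝ, MemLp S 2 intervalMeasure → MemW012 T T' → MemW012 U U' →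
      1 ≤ functionalI S T T' U U') →
      ∀ B : HorizonData, B.IsBlackHole → B.SubExtremal → B.pJ ^ 2 + B.pQ ^ 2 < 1) := by
  refine ⟨fun S T T' U U' hS hT hU => one_le_functionalI hS hT hU, fun _ B hB hs => ?_⟩
  obtain ⟨τ, h, ε₀, c, l, hl⟩ := hs.exists_trappedFamily
  exact hB.pJ_sq_add_pQ_sq_lt_one (hl.integral_horizonRate_pos hB)
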